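/- Let $(C,o)\subset(\mathbb C^N,0)$ be a reduced complex analytic curve singularity with irreducible components (branches) $(C_1,o),\dots,(C_r,o)$, $r\ge1$. Let $\mathcal O$ be its local algebra, $\mathfrak m\subset\mathcal O$ the maximal ideal, and $m(C,o)$ its multiplicity, i.e. the integer $a$ such that $\dim_{\mathbb C}\mathcal O/\mathfrak m^k=ak+b$ for all $k\gg0$, with some constant $b$. For each $i$ let $\mathfrak v_i:\mathcal O\to\mathbb Z_{\ge0}\cup\{\infty\}$ be the order of vanishing of the pull-back to the normalization of $(C_i,o)$, i.e. the discrete valuation given by the integral closure $\overline{\mathcal O_{C_i,o}}\cong\mathbb C\{t_i\}$. For $\ell\in\mathbb Z_{\ge0}^r$ set $$\mathcal F(\ell)=\{g\in\mathcal O:\mathfrak v_i(g)\ge\ell_i\text{ for all }i\},\qquad \mathfrak h(\ell)=\dim_{\mathbb C}\mathcal O/\mathcal F(\ell),\qquad w_0(\ell)=2\,\mathfrak h(\ell)-\sum_{i}\ell_i .$$ For $\ell\in\mathbb Z_{\ge0}^r$ and $I\subset\{1,\dots,r\}$, the closed cube with vertices $\ell+\sum_{i\in K}e_i$ ($K\subset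 I$) has as weight the maximum of $w_0$ over its vertices. For $n\in\mathbb Z$ let $S_n\subset\mathbb R_{\ge0}^r$ be the union of all closed cubes of weight at most $n$. Put $\mathbb H^q_{2n}=H^q(S_n,\mathbb Z)$, $\mathbb H^q=\bigoplus_{n\in\mathbb Z}\mathbb H^q_{2n}$ and $\mathbb H^q_{\mathrm{red}}=\bigoplus_{n\in\mathbb Z}\widetilde H^q(S_n,\mathbb Z)$ for $q\ge0$ (singular and reduced singular cohomology; all groups vanish if $S_n=\emptyset$). Then: (a) $m(C,o)\le2$ if and only if $\mathbb H^q_{2n}=0$ for all $n<0$ and all $q\ge0$; the latter is equivalent to $w_0(\ell)\ge0$ for all $\ell\in\mathbb Z_{\ge0}^r$. (b) $m(C,o)=1$ if and only if $\mathbb H^0_{\mathrm{red}}=0$; moreover $m(C,o)=1$ if and only if $(C,o)$ is smooth, i.e. $\mathcal O\cong\mathbb C\{t\}$ as $\mathbb C$-algebras. (c) $m(C,o)=2$ if and only if $\mathbb H^0_{\mathrm{red}}\ne0$ but $\mathbb H^0_{2n}=0$ for all $n<0$. In this case $(C,o)$ is isomorphic to the plane curve germ $x^2+y^k=0$ for some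 $k\ge2$, i.e. $\mathcal O\cong\mathbb C\{x,y\}/(x^2+y^k)$ as $\mathbb C$-algebras. (d) $m(C,o)>2$ if and only if $\mathbb H^0_{2n}\neq0$ for some $n<0$; the latter is equivalent to $S_n\ne\emptyset$ for some $n<0$. (e) If $m(C,o)\le2$, then $\mathbb H^q=0$ for all $q>0$. -/

import Mathlib

noncomputable section

namespace CurveLattice

/-! ### Convergent power series -/

/-- A formal power series in `N` complex variables converges (absolutely) on some polydisc
of positive radius around the origin. -/
def IsConvergent {N : ℕ} (f : MvPowerSeries (Fin N) ℂ) : Prop :=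
  ∃ ρ : ℝ, 0 < ρ ∧ Summable fun a : Fin N →₀ ℕ => ‖MvPowerSeries.coeff a f‖ * ρ ^ a.degree

theorem IsConvergent.of_le {N : ℕ} {f : MvPowerSeries (Fin N) ℂ} {ρ σ : ℝ} (hσ : 0 < σ)
    (hσρ : σ ≤ ρ)
    (h : Summable fun a : Fin N →₀ ℕ => ‖MvPowerSeries.coeff a f‖ * ρ ^ a.degree) :
    Summable fun a : Fin N →₀ ℕ => ‖MvPowerSeries.coeff a f‖ * σ ^ a.degree := by
  refine Summable.of_nonneg_of_le (fun a => by positivity) (fun a => ?_) h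
  gcongr

theorem IsConvergent.add {N : ℕ} {f g : MvPowerSeries (Fin N) ℂ} (hf : IsConvergent f)
    (hg : IsConvergent g) : IsConvergent (f + g) := by
  obtain ⟨ρ, hρ, hf⟩ := hf
  obtain ⟨σ, hσ, hg⟩ := hg
  have hm : 0 < min ρ σ := lt_min hρ hσ
  refine ⟨min ρ σ, hm, ?_⟩
  refine Summable.of_nonneg_of_le (fun a => by positivity) (fun a => ?_)
    ((IsConvergent.of_le hm (min_le_left _ _) hf).add
      (IsConvergent.of_le hm (min_le_right _ _) hg))
  rw [map_add, ← add_mul]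
  gcongr
  exact norm_add_le _ _

theorem IsConvergent.mul {N : ℕ} {f g : MvPowerSeries (Fin N) ℂ} (hf : IsConvergent f)
    (hg : IsConvergent g) : IsConvergent (f * g) := by
  classical
  obtain ⟨ρ, hρ, hf⟩ := hf
  obtain ⟨σ, hσ, hg⟩ := hg
  obtain ⟨τ, hm, h1, h2⟩ : ∃ τ : ℝ, 0 < τ ∧ τ ≤ ρ ∧ τ ≤ σ :=
    ⟨min ρ σ, lt_min hρ hσ, min_le_left _ _, min_le_right _ _⟩
  have hf' := IsConvergent.of_le hm h1 hf
  have hg' := IsConvergent.of_le hm h2 hg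
  have hF : ∀ (e : MvPowerSeries (Fin N) ℂ) (a : Fin N →₀ ℕ),
      0 ≤ ‖MvPowerSeries.coeff a e‖ * τ ^ a.degree :=
    fun e a => mul_nonneg (norm_nonneg _) (pow_nonneg hm.le _)
  have h0 := hf'.mul_of_nonneg hg' (hF f) (hF g)
  have key : Summable fun a : Fin N →₀ ℕ => ∑ p ∈ Finset.HasAntidiagonal.antidiagonal a,
      ‖MvPowerSeries.coeff p.1 f‖ * τ ^ p.1.degree *
        (‖MvPowerSeries.coeff p.2 g‖ * τ ^ p.2.degree) :=
    summable_sum_mul_antidiagonal_of_summable_mul (A := Fin N →₀ ℕ)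
      (f := fun a => ‖MvPowerSeries.coeff a f‖ * τ ^ a.degree)
      (g := fun a => ‖MvPowerSeries.coeff a g‖ * τ ^ a.degree) h0
  refine ⟨τ, hm, Summable.of_nonneg_of_le (hF (f * g)) (fun a => ?_) key⟩
  have hsum : ∑ p ∈ Finset.HasAntidiagonal.antidiagonal a, ‖MvPowerSeries.coeff p.1 f‖ * τ ^ p.1.degree *
        (‖MvPowerSeries.coeff p.2 g‖ * τ ^ p.2.degree) =
      (∑ p ∈ Finset.HasAntidiagonal.antidiagonal a, ‖MvPowerSeries.coeff p.1 f‖ * ‖MvPowerSeries.coeff p.2 g‖) *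
        τ ^ a.degree := by
    rw [Finset.sum_mul]
    refine Finset.sum_congr rfl fun p hp => ?_
    have hd : a.degree = p.1.degree + p.2.degree := by
      rw [← Finset.HasAntidiagonal.mem_antidiagonal.mp hp, map_add]
    rw [hd, pow_add]
    ring
  refine le_trans ?_ hsum.ge
  refine mul_le_mul_of_nonneg_right ?_ (pow_nonneg hm.le _)
  rw [MvPowerSeries.coeff_mul]
  refine (norm_sum_le _ _).trans (le_of_eq (Finset.sum_congr rfl fun p _ => norm_mul _ _))

theorem IsConvergent.of_finite_support {N : ℕ} {f : MvPowerSeries (Fin N) ℂ}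
    (h : (Function.support fun a : Fin N →₀ ℕ => MvPowerSeries.coeff a f).Finite) :
    IsConvergent f := by
  refine ⟨1, one_pos, summable_of_hasFiniteSupport (h.subset fun a ha => ?_)⟩
  contrapose! ha
  simp only [Function.mem_support, not_not] at ha ⊢
  simp [ha]

/-- The convergent power series form a subalgebra of the algebra of formal power series. -/
def convergentSubalgebra (N : ℕ) : Subalgebra ℂ (MvPowerSeries (Fin N) ℂ) where
  carrier := {f | IsConvergent f}
  mul_mem' := IsConvergent.mul
  add_mem' := IsConvergent.add
  algebraMap_mem' c := by
    refine IsConvergent.of_finite_support ((Set.finite_singleton 0).subset fun a ha => ?_)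
    classical
    by_contra h
    apply ha
    simp only [MvPowerSeries.algebraMap_apply, MvPowerSeries.coeff_C]
    exact if_neg h

/-- The ring `ℂ{x₁, …, x_N}` of convergent power series, i.e. the local ring of germs of
holomorphic functions at the origin of `ℂ^N`. -/
def ConvergentSeries (N : ℕ) : Type := convergentSubalgebra N

instance (N : ℕ) : CommRing (ConvergentSeries N) :=
  inferInstanceAs (CommRing (convergentSubalgebra N))

instance (N : ℕ) : Algebra ℂ (ConvergentSeries N) :=
  inferInstanceAs (Algebra ℂ (convergentSubalgebra N))

/-- The inclusion of convergent into formal power series. -/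
def toFormal (N : ℕ) : ConvergentSeries N →ₐ[ℂ] MvPowerSeries (Fin N) ℂ :=
  (convergentSubalgebra N).val

/-- The coordinate function `x_i` as an element of `ℂ{x₁, …, x_N}`. -/
def coord {N : ℕ} (i : Fin N) : ConvergentSeries N :=
  ⟨MvPowerSeries.X i, by
    refine IsConvergent.of_finite_support
      ((Set.finite_singleton (Finsupp.single i 1)).subset fun a ha => ?_)
    classical
    by_contra h
    apply ha
    simp only [MvPowerSeries.coeff_X]
    exact if_neg h⟩

/-- The ideal of convergent power series without constant term. -/
def originIdeal (N : ℕ) : Ideal (ConvergentSeries N) :=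
  RingHom.ker ((MvPowerSeries.constantCoeff (σ := Fin N) (R := ℂ)).comp
    (toFormal N : ConvergentSeries N →+* MvPowerSeries (Fin N) ℂ))

/-! ### Singular cohomology with integer coefficients -/

section SingularCohomology

variable (X : Type) [TopologicalSpace X]

/-- Singular `q`-simplices: continuous maps from the standard `q`-simplex. -/
abbrev SingularSimplex (q : ℕ) : Type := C(stdSimplex ℝ (Fin (q + 1)), X)

/-- The `j`-th face of a singular simplex. -/
def SingularSimplex.face {X : Type} [TopologicalSpace X] {q : ℕ} (σ : SingularSimplex X (q + 1))
    (j : Fin (q + 2)) : SingularSimplex X q :=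
  σ.comp ⟨stdSimplex.map j.succAbove, stdSimplex.continuous_map j.succAbove⟩

/-- Singular `q`-cochains with integer coefficients. -/
abbrev Cochain (q : ℕ) : Type := SingularSimplex X q → ℤ

/-- The coboundary `(d φ)(σ) = ∑ⱼ (-1)ʲ φ(∂ⱼ σ)`. -/
def coboundary (q : ℕ) : Cochain X q →+ Cochain X (q + 1) where
  toFun φ σ := ∑ j : Fin (q + 2), (-1 : ℤ) ^ (j : ℕ) * φ (σ.face j)
  map_zero' := by ext σ; simp
  map_add' φ ψ := by ext σ; simp [mul_add, Finset.sum_add_distrib]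

/-- Cocycles. -/
abbrev cocycles (q : ℕ) : AddSubgroup (Cochain X q) := (coboundary X q).ker

/-- Coboundaries; there are no nonzero ones in degree `0`. -/
def coboundaries : (q : ℕ) → AddSubgroup (Cochain X q)
  | 0 => ⊥
  | q + 1 => (coboundary X q).range

/-- The constant `0`-cochains, i.e. the image of the augmentation `ℤ → C⁰(X)`. -/
def constantCochains : AddSubgroup (Cochain X 0) :=
  (Pi.constAddMonoidHom (SingularSimplex X 0) ℤ).range

/-- Coboundaries of the augmented complex `ℤ → C⁰(X) → C¹(X) → ⋯` in degrees `q ≥ 0`. -/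
def reducedCoboundaries : (q : ℕ) → AddSubgroup (Cochain X q)
  | 0 => constantCochains X
  | q + 1 => (coboundary X q).range

/-- Singular cohomology `H^q(X, ℤ)`. -/
abbrev Cohomology (q : ℕ) : Type :=
  cocycles X q ⧸ (coboundaries X q).addSubgroupOf (cocycles X q)

/-- Reduced singular cohomology `H̃^q(X, ℤ)` in degrees `q ≥ 0`. -/
abbrev ReducedCohomology (q : ℕ) : Type :=
  cocycles X q ⧸ (reducedCoboundaries X q).addSubgroupOf (cocycles X q)

end SingularCohomology

/-! ### Reduced curve singularities -/

/-- A reduced complex analytic curve singularity in `(ℂ^N, 0)` with `r ≥ 1` irreducible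
branches, given through its irreducible decomposition: the `i`-th branch is cut out by a prime
ideal of `ℂ{x₁, …, x_N}` with one-dimensional quotient, and different branches are
different. -/
structure ReducedCurveSingularity (N r : ℕ) where
  /-- the ideal of germs vanishing on the `i`-th branch -/
  branchIdeal : Fin r → Ideal (ConvergentSeries N)
  isPrime : ∀ i, (branchIdeal i).IsPrime
  dim_eq_one : ∀ i, ringKrullDim (ConvergentSeries N ⧸ branchIdeal i) = 1
  branchIdeal_injective : Function.Injective branchIdeal
  r_pos : 0 < r

namespace ReducedCurveSingularity

variable {N r : ℕ} (C : ReducedCurveSingularity N r)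

/-- The ideal of germs vanishing on all branches. -/
def ideal : Ideal (ConvergentSeries N) := ⨅ i, C.branchIdeal i

theorem ideal_le (i : Fin r) : C.ideal ≤ C.branchIdeal i := iInf_le C.branchIdeal i

/-- The local algebra of the curve singularity. -/
abbrev LocalRing : Type := ConvergentSeries N ⧸ C.ideal

/-- The maximal ideal of the local algebra: germs of functions that vanish at the origin. -/
def maxIdeal : Ideal C.LocalRing := (originIdeal N).map (Ideal.Quotient.mk C.ideal)

/-- The Hilbert–Samuel multiplicity: the coefficient `a` in
`dim_ℂ (𝒪 / 𝔪^k) = a k + b` for all large `k`. -/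
def multiplicity : ℕ :=
  sInf {a : ℕ | ∃ b : ℤ, ∀ᶠ k : ℕ in Filter.atTop,
    (Module.finrank ℂ (C.LocalRing ⧸ C.maxIdeal ^ k) : ℤ) = a * k + b}

/-- The local algebra of the `i`-th branch. -/
abbrev BranchRing (i : Fin r) : Type := ConvergentSeries N ⧸ C.branchIdeal i

/-- The normalization of the `i`-th branch: the integral closure of its local algebra in the
fraction field. -/
abbrev Normalization (i : Fin r) : Type :=
  integralClosure (C.BranchRing i) (FractionRing (C.BranchRing i))

instance (i : Fin r) : (C.branchIdeal i).IsPrime := C.isPrime i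

instance (i : Fin r) : CommRing (C.Normalization i) := inferInstance

/-- Pull-back of functions on the curve to the normalization of the `i`-th branch. -/
def pullback (i : Fin r) : C.LocalRing →+* C.Normalization i :=
  (algebraMap (C.BranchRing i) (C.Normalization i)).comp
    (Ideal.Quotient.factor (C.ideal_le i))

/-- The maximal ideal `(t_i)` of the normalization of the `i`-th branch (a discrete valuation
ring isomorphic to `ℂ{t_i}`, so that its only maximal ideal is its Jacobson radical). -/
def normalizationMaxIdeal (i : Fin r) : Ideal (C.Normalization i) :=
  Ring.jacobson (C.Normalization i)

/-- The valuation `𝔳_i(g) = ord_{t_i}(n_i^* g)`, the largest `n` with `n_i^* g ∈ (t_i)^n`; it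
is `∞` when `g` vanishes on the `i`-th branch. -/
def valuation (i : Fin r) (g : C.LocalRing) : ℕ∞ :=
  ⨆ n : {n : ℕ // C.pullback i g ∈ C.normalizationMaxIdeal i ^ n}, ((n : ℕ) : ℕ∞)

theorem le_valuation_iff (i : Fin r) (g : C.LocalRing) (n : ℕ) :
    (n : ℕ∞) ≤ C.valuation i g ↔ C.pullback i g ∈ C.normalizationMaxIdeal i ^ n := by
  constructor
  · intro h
    rcases n with _ | n
    · simp
    · have h1 : (n : ℕ∞) < C.valuation i g :=
        lt_of_lt_of_le (by exact_mod_cast Nat.lt_succ_self n) h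
      obtain ⟨⟨k, hk⟩, hnk⟩ := lt_iSup_iff.mp h1
      have hnk' : n < k := by exact_mod_cast hnk
      exact Ideal.pow_le_pow_right hnk' hk
  · intro h
    exact le_iSup (fun n : {n : ℕ // C.pullback i g ∈ C.normalizationMaxIdeal i ^ n} =>
      ((n : ℕ) : ℕ∞)) ⟨n, h⟩

/-- The multi-filtration `ℱ(ℓ) = {g ∈ 𝒪 | 𝔳_i(g) ≥ ℓ_i for all i}`. -/
def filtration (l : Fin r → ℕ) : Ideal C.LocalRing where
  carrier := {g | ∀ i, (l i : ℕ∞) ≤ C.valuation i g}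
  zero_mem' i := by rw [le_valuation_iff, map_zero]; exact zero_mem _
  add_mem' {f g} hf hg i := by
    rw [le_valuation_iff, map_add]
    exact add_mem ((C.le_valuation_iff _ _ _).mp (hf i)) ((C.le_valuation_iff _ _ _).mp (hg i))
  smul_mem' c g hg i := by
    rw [le_valuation_iff, smul_eq_mul, map_mul]
    exact Ideal.mul_mem_left _ _ ((C.le_valuation_iff _ _ _).mp (hg i))

/-- The Hilbert function `𝔥(ℓ) = dim_ℂ 𝒪 / ℱ(ℓ)`. -/
def hilbert (l : Fin r → ℕ) : ℕ := Module.finrank ℂ (C.LocalRing ⧸ C.filtration l)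

/-- The weight function `w₀(ℓ) = 2 𝔥(ℓ) - |ℓ|`. -/
def weight (l : Fin r → ℕ) : ℤ := 2 * (C.hilbert l : ℤ) - ∑ i, (l i : ℤ)

end ReducedCurveSingularity

/-! ### Cubes -/

/-- The vertex `ℓ + ∑_{i ∈ K} e_i`. -/
def vertex {r : ℕ} (l : Fin r → ℕ) (K : Finset (Fin r)) : Fin r → ℕ :=
  fun i => l i + if i ∈ K then 1 else 0

/-- The closed cube `(ℓ, I)` in `ℝ^r`, with vertices `ℓ + ∑_{i ∈ K} e_i` for `K ⊆ I`. -/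
def cube {r : ℕ} (l : Fin r → ℕ) (I : Finset (Fin r)) : Set (Fin r → ℝ) :=
  {x | ∀ i, (l i : ℝ) ≤ x i ∧ x i ≤ (vertex l I i : ℝ)}

namespace ReducedCurveSingularity

variable {N r : ℕ} (C : ReducedCurveSingularity N r)

/-- The weight of a cube: the maximum of the weights of its vertices. -/
def cubeWeight (l : Fin r → ℕ) (I : Finset (Fin r)) : ℤ :=
  I.powerset.sup' ⟨∅, Finset.empty_mem_powerset I⟩ fun K => C.weight (vertex l K)

/-- The sublevel set `S_n`: the union of the closed cubes of weight at most `n`. -/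
def sublevel (n : ℤ) : Set (Fin r → ℝ) :=
  ⋃ (l : Fin r → ℕ) (I : Finset (Fin r)) (_ : C.cubeWeight l I ≤ n), cube l I

/-- The piece `ℍ^q_{2n} = H^q(S_n, ℤ)` of lattice cohomology. -/
abbrev latticeCohomologyPiece (q : ℕ) (n : ℤ) : Type := Cohomology (C.sublevel n) q

/-- Lattice cohomology in degree `q`: `ℍ^q = ⨁_n H^q(S_n, ℤ)`. -/
abbrev latticeCohomology (q : ℕ) : Type :=
  DirectSum ℤ fun n => C.latticeCohomologyPiece q n

/-- Reduced lattice cohomology in degree `q`: `ℍ^q_red = ⨁_n H̃^q(S_n, ℤ)`. -/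
abbrev reducedLatticeCohomology (q : ℕ) : Type :=
  DirectSum ℤ fun n => ReducedCohomology (C.sublevel n) q

end ReducedCurveSingularity

end CurveLattice

end

/-!
Everything rests on two identities for the weight function. Let `n_i` be the smallest value of
`𝔳_i` on the maximal ideal `𝔪`, and `n = (n_1, …, n_r)`. A generic `x ∈ 𝔪` has `𝔳_i(x) = n_i` for all
`i`, and `dim 𝒪/x𝒪 = ∑ n_i`; since `𝔪^k ⊆ ℱ(k n)`, and `ℱ(k n + K) ⊆ x^k 𝒪` for a conductor exponent
`K`, the functions `dim 𝒪/𝔪^k` and `𝔥(k n)` both grow with slope `m = ∑ n_i`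
(`multiplicity_eq_sum`). As `ℱ(ℓ) = 𝔪` for `0 ≠ ℓ ≤ n`, it follows that `w₀(n) = 2 - m`
(`weight_branchOrder`) and `w₀(e_i) = 1` (`weight_single`). So for `m > 2` the set `S_{2-m}` is
nonempty, while for `m ≥ 2` the set `S_0` contains `n` next to the isolated point `0`, so that its
reduced `H⁰` does not vanish.

If `m ≤ 2`, then `r = 1` and `n_1 ≤ 2`, or `r = 2` and `n = (1, 1)`. In these cases enough values of
semigroup elements are known to see that `w₀ ≥ 0`, and that a sublevel set `S_n` with `n ≥ 1` (with
any `n` if `m = 1`) is stable under the truncations `x ↦ min(x, T)`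
(`weight_nonneg_and_truncation`). These truncations contract `S_n` to the origin. The sets `S_n` with
`n < 0` are empty, and `S_0` consists of lattice points because the weights of neighbouring lattice
points differ by `1`. The vanishing of singular cohomology is obtained from a cone operator on
singular simplices, which covers both contractible spaces and spaces in which all simplices are
constant (`subsingleton_cohomology_succ`).

The isomorphism types come from the finiteness of `𝒪` over `ℂ{x}`: germs spanning `𝒪/x𝒪` over `ℂ` span
`𝒪` over `ℂ{x}` (`exists_expansion_of_span`). For `m = 1` this gives `𝒪 = ℂ{x}`. For `m = 2` it gives
`𝒪 = ℂ{x} ⊕ ℂ{x} y`, and completing the square in the quadratic equation of `y` and extracting a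
square root of a unit of `ℂ{x}` turn this equation into `y² + x^k = 0`.

The valuations are usable because the normalization of a branch is a discrete valuation ring. It is
a Dedekind domain, being a finite extension of some `ℂ{x}`; the point is that it is local. A domain
`D` integral over `ℂ{t}` is local by `isLocalRing_of_isIntegral`: for `e ∈ D` with minimal polynomial
`f`, the ring `ℂ{t, X}/(f)` of germs is finite over `ℂ{t}`, so that `1 - X`, a unit there, provides an
inverse of `1 - e` unless `f(0)` is a unit, in which case `e` is one.
-/

open scoped ENNReal NNReal

namespace CurveLattice

/-! ### Weighted norms of formal power series -/

/-- The weighted `ℓ¹`-norm `∑ |f_a| ρ^{|a|}`, with values in `[0, ∞]`. -/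
noncomputable def wnorm {N : ℕ} (ρ : ℝ≥0) (f : MvPowerSeries (Fin N) ℂ) : ℝ≥0∞ :=
  ∑' a : Fin N →₀ ℕ, ‖MvPowerSeries.coeff a f‖ₑ * (ρ : ℝ≥0∞) ^ a.degree

variable {N : ℕ}

theorem isConvergent_iff_wnorm {f : MvPowerSeries (Fin N) ℂ} :
    IsConvergent f ↔ ∃ ρ : ℝ≥0, 0 < ρ ∧ wnorm ρ f ≠ ∞ := by
  have key : ∀ ρ : ℝ≥0, wnorm ρ f ≠ ∞ ↔
      Summable fun a : Fin N →₀ ℕ => ‖MvPowerSeries.coeff a f‖ * (ρ : ℝ) ^ a.degree := by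
    intro ρ
    have : wnorm ρ f = ∑' a : Fin N →₀ ℕ,
        ((‖MvPowerSeries.coeff a f‖₊ * ρ ^ a.degree : ℝ≥0) : ℝ≥0∞) := by
      unfold wnorm
      refine tsum_congr fun a => ?_
      push_cast
      rfl
    rw [this, ENNReal.tsum_coe_ne_top_iff_summable, ← NNReal.summable_coe]
    simp
  constructor
  · rintro ⟨ρ, hρ, h⟩
    exact ⟨⟨ρ, hρ.le⟩, hρ, (key _).2 h⟩
  · rintro ⟨ρ, hρ, h⟩
    exact ⟨ρ, hρ, (key _).1 h⟩

theorem wnorm_mono {ρ σ : ℝ≥0} (h : σ ≤ ρ) (f : MvPowerSeries (Fin N) ℂ) :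
    wnorm σ f ≤ wnorm ρ f := by
  unfold wnorm
  gcongr

theorem wnorm_le_tsum {ι : Type*} (ρ : ℝ≥0) (f : MvPowerSeries (Fin N) ℂ)
    (g : ι → MvPowerSeries (Fin N) ℂ)
    (h : ∀ a, ‖MvPowerSeries.coeff a f‖ₑ ≤ ∑' i, ‖MvPowerSeries.coeff a (g i)‖ₑ) :
    wnorm ρ f ≤ ∑' i, wnorm ρ (g i) := by
  unfold wnorm
  rw [ENNReal.tsum_comm]
  refine ENNReal.tsum_le_tsum fun a => ?_
  rw [ENNReal.tsum_mul_right]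
  gcongr
  exact h a

theorem wnorm_add_le (ρ : ℝ≥0) (f g : MvPowerSeries (Fin N) ℂ) :
    wnorm ρ (f + g) ≤ wnorm ρ f + wnorm ρ g := by
  unfold wnorm
  rw [← ENNReal.tsum_add]
  refine ENNReal.tsum_le_tsum fun a => ?_
  rw [← add_mul, map_add]
  gcongr
  exact enorm_add_le _ _

theorem wnorm_zero (ρ : ℝ≥0) : wnorm ρ (0 : MvPowerSeries (Fin N) ℂ) = 0 := by
  simp [wnorm]

theorem wnorm_sum_le {ι : Type*} (s : Finset ι) (ρ : ℝ≥0) (f : ι → MvPowerSeries (Fin N) ℂ) :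
    wnorm ρ (∑ i ∈ s, f i) ≤ ∑ i ∈ s, wnorm ρ (f i) :=
  Finset.le_sum_of_subadditive _ (wnorm_zero ρ).le (wnorm_add_le ρ) _ _

theorem wnorm_mul_le (ρ : ℝ≥0) (f g : MvPowerSeries (Fin N) ℂ) :
    wnorm ρ (f * g) ≤ wnorm ρ f * wnorm ρ g := by
  classical
  have h1 : wnorm ρ f * wnorm ρ g = ∑' p : (Fin N →₀ ℕ) × (Fin N →₀ ℕ),
      (‖MvPowerSeries.coeff p.1 f‖ₑ * (ρ : ℝ≥0∞) ^ p.1.degree) *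
        (‖MvPowerSeries.coeff p.2 g‖ₑ * (ρ : ℝ≥0∞) ^ p.2.degree) := by
    unfold wnorm
    rw [ENNReal.tsum_prod', ← ENNReal.tsum_mul_right]
    exact tsum_congr fun a => ENNReal.tsum_mul_left.symm
  rw [h1, ← Equiv.tsum_eq Finset.HasAntidiagonal.sigmaAntidiagonalEquivProd, ENNReal.tsum_sigma']
  unfold wnorm
  refine ENNReal.tsum_le_tsum fun a => ?_
  rw [tsum_fintype, MvPowerSeries.coeff_mul]
  calc _ ≤ (∑ p ∈ Finset.HasAntidiagonal.antidiagonal a,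
        ‖MvPowerSeries.coeff p.1 f‖ₑ * ‖MvPowerSeries.coeff p.2 g‖ₑ) * (ρ : ℝ≥0∞) ^ a.degree := by
        gcongr
        refine (enorm_sum_le _ _).trans (le_of_eq (Finset.sum_congr rfl fun p _ => enorm_mul _ _))
    _ = ∑ p ∈ Finset.HasAntidiagonal.antidiagonal a, ‖MvPowerSeries.coeff p.1 f‖ₑ * (ρ : ℝ≥0∞) ^ p.1.degree *
        (‖MvPowerSeries.coeff p.2 g‖ₑ * (ρ : ℝ≥0∞) ^ p.2.degree) := by
        rw [Finset.sum_mul]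
        refine Finset.sum_congr rfl fun p hp => ?_
        have hd : a.degree = p.1.degree + p.2.degree := by
          rw [← Finset.HasAntidiagonal.mem_antidiagonal.mp hp, map_add]
        rw [hd, pow_add]
        ring
    _ = _ := by
        rw [← Finset.sum_coe_sort]
        rfl
    _ ≤ _ := le_rfl

theorem wnorm_monomial (ρ : ℝ≥0) (a : Fin N →₀ ℕ) (c : ℂ) :
    wnorm ρ (MvPowerSeries.monomial a c) = ‖c‖ₑ * (ρ : ℝ≥0∞) ^ a.degree := by
  classical
  unfold wnorm
  rw [tsum_eq_single a]
  · simp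
  · intro b hb
    rw [MvPowerSeries.coeff_monomial_ne hb]
    simp

theorem wnorm_one (ρ : ℝ≥0) : wnorm ρ (1 : MvPowerSeries (Fin N) ℂ) = 1 := by
  have := wnorm_monomial (N := N) ρ 0 1
  simpa using this

theorem wnorm_pow_le (ρ : ℝ≥0) (f : MvPowerSeries (Fin N) ℂ) (n : ℕ) :
    wnorm ρ (f ^ n) ≤ wnorm ρ f ^ n := by
  induction n with
  | zero => simp [wnorm_one]
  | succ n ih =>
    rw [pow_succ, pow_succ]
    exact (wnorm_mul_le _ _ _).trans (by gcongr)

theorem wnorm_prod_le {ι : Type*} (s : Finset ι) (ρ : ℝ≥0) (f : ι → MvPowerSeries (Fin N) ℂ) :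
    wnorm ρ (∏ i ∈ s, f i) ≤ ∏ i ∈ s, wnorm ρ (f i) := by
  classical
  induction s using Finset.induction_on with
  | empty => simp [wnorm_one]
  | insert i s hi ih =>
    rw [Finset.prod_insert hi, Finset.prod_insert hi]
    exact (wnorm_mul_le _ _ _).trans (by gcongr)

theorem enorm_coeff_mul_le_wnorm (ρ : ℝ≥0) (f : MvPowerSeries (Fin N) ℂ) (a : Fin N →₀ ℕ) :
    ‖MvPowerSeries.coeff a f‖ₑ * (ρ : ℝ≥0∞) ^ a.degree ≤ wnorm ρ f :=
  ENNReal.le_tsum a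

/-- A convergent series without constant term becomes small on small polydiscs. -/
theorem exists_wnorm_le {f : MvPowerSeries (Fin N) ℂ} (hf : IsConvergent f)
    (h0 : MvPowerSeries.constantCoeff f = 0) {ε : ℝ≥0} (hε : 0 < ε) :
    ∃ ρ : ℝ≥0, 0 < ρ ∧ ∀ σ ≤ ρ, wnorm σ f ≤ ε := by
  obtain ⟨ρ, hρ, h⟩ := isConvergent_iff_wnorm.1 hf
  obtain ⟨w, hw⟩ : ∃ w : ℝ≥0, (w : ℝ≥0∞) = wnorm ρ f :=
    ⟨_, ENNReal.coe_toNNReal h⟩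
  -- shrinking the radius by a factor `τ ≤ 1` shrinks the norm by at least `τ`
  have key : ∀ τ : ℝ≥0, τ ≤ 1 → wnorm (τ * ρ) f ≤ τ * wnorm ρ f := by
    intro τ hτ
    unfold wnorm
    rw [← ENNReal.tsum_mul_left]
    refine ENNReal.tsum_le_tsum fun a => ?_
    by_cases ha : a = 0
    · subst ha
      simp [h0]
    · have hd : a.degree ≠ 0 := by
        rwa [Ne, Finsupp.degree_eq_zero_iff]
      have h1 : (τ : ℝ≥0∞) ^ a.degree ≤ τ :=
        pow_le_of_le_one (by simp) (by exact_mod_cast hτ) hd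
      calc _ = ((τ : ℝ≥0∞) ^ a.degree) * (‖MvPowerSeries.coeff a f‖ₑ * (ρ : ℝ≥0∞) ^ a.degree) := by
            push_cast; ring
        _ ≤ _ := by gcongr
  refine ⟨min 1 (ε / (w + 1)) * ρ, by positivity, fun σ hσ => ?_⟩
  refine (wnorm_mono hσ f).trans ((key _ (min_le_left _ _)).trans ?_)
  rw [← hw]
  have : min 1 (ε / (w + 1)) * w ≤ ε := by
    calc min 1 (ε / (w + 1)) * w ≤ (ε / (w + 1)) * (w + 1) := by
          gcongr
          · exact min_le_right _ _
          · simp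
      _ = ε := by field_simp
  exact_mod_cast this

/-! ### Substitution of convergent series without constant term -/

/-- Substituting convergent series without constant term into a convergent series gives a
convergent series. -/
theorem IsConvergent.subst {n : ℕ} {g : Fin n → MvPowerSeries (Fin N) ℂ}
    (hg : ∀ i, IsConvergent (g i)) (h0 : ∀ i, MvPowerSeries.constantCoeff (g i) = 0)
    {f : MvPowerSeries (Fin n) ℂ} (hf : IsConvergent f) :
    IsConvergent (MvPowerSeries.subst g f) := by
  obtain ⟨τ, hτ, hfτ⟩ := isConvergent_iff_wnorm.1 hf
  choose r hr hrle using fun i => exists_wnorm_le (hg i) (h0 i) hτ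
  obtain ⟨σ, hσ, hσr⟩ : ∃ σ : ℝ≥0, 0 < σ ∧ ∀ i, σ ≤ r i := by
    rcases isEmpty_or_nonempty (Fin n) with hn | hn
    · exact ⟨1, one_pos, fun i => hn.elim i⟩
    · exact ⟨Finset.univ.inf' Finset.univ_nonempty r,
        (Finset.lt_inf'_iff _).2 fun i _ => hr i, fun i => Finset.inf'_le _ (Finset.mem_univ i)⟩
  have hsub := MvPowerSeries.hasSubst_of_constantCoeff_zero h0
  refine isConvergent_iff_wnorm.2 ⟨σ, hσ, ne_top_of_le_ne_top hfτ ?_⟩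
  calc wnorm σ (MvPowerSeries.subst g f)
      ≤ ∑' d : Fin n →₀ ℕ, wnorm σ (MvPowerSeries.coeff d f • d.prod fun s e => g s ^ e) := by
        refine wnorm_le_tsum _ _ _ fun a => ?_
        rw [MvPowerSeries.coeff_subst hsub]
        have hfin := MvPowerSeries.coeff_subst_finite hsub f a
        rw [finsum_eq_sum _ hfin]
        refine (enorm_sum_le _ _).trans ((ENNReal.sum_le_tsum _).trans_eq ?_)
        simp
    _ ≤ wnorm τ f := by
        refine ENNReal.tsum_le_tsum fun d => ?_
        rw [MvPowerSeries.smul_eq_C_mul]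
        refine (wnorm_mul_le _ _ _).trans ?_
        have hC := wnorm_monomial (N := N) σ 0 (MvPowerSeries.coeff d f)
        rw [MvPowerSeries.monomial_zero_eq_C_apply] at hC
        rw [hC]
        simp only [map_zero, pow_zero, mul_one]
        gcongr
        refine (wnorm_prod_le _ _ _).trans ?_
        rw [Finsupp.degree_eq_sum, ← Finset.prod_pow_eq_pow_sum,
          ← Finset.prod_subset (Finset.subset_univ d.support)]
        · refine Finset.prod_le_prod' fun i _ => (wnorm_pow_le _ _ _).trans ?_
          gcongr
          exact hrle i σ (hσr i)
        · intro i _ hi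
          simp [Finsupp.notMem_support_iff.1 hi]

theorem IsConvergent.of_wnorm {f : MvPowerSeries (Fin N) ℂ} {ρ : ℝ≥0} (hρ : 0 < ρ)
    (h : wnorm ρ f ≠ ∞) : IsConvergent f :=
  isConvergent_iff_wnorm.2 ⟨ρ, hρ, h⟩

theorem toFormal_injective (N : ℕ) : Function.Injective (toFormal N) :=
  Subtype.val_injective

theorem isConvergent_toFormal (f : ConvergentSeries N) : IsConvergent (toFormal N f) :=
  f.2

@[simp] theorem toFormal_coord (i : Fin N) : toFormal N (coord i) = MvPowerSeries.X i := rfl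

/-- A convergent formal power series as an element of `ConvergentSeries N`. -/
def ofConvergent (f : MvPowerSeries (Fin N) ℂ) (hf : IsConvergent f) : ConvergentSeries N :=
  ⟨f, hf⟩

@[simp] theorem toFormal_ofConvergent (f : MvPowerSeries (Fin N) ℂ) (hf : IsConvergent f) :
    toFormal N (ofConvergent f hf) = f := rfl

theorem mem_originIdeal {f : ConvergentSeries N} :
    f ∈ originIdeal N ↔ MvPowerSeries.constantCoeff (toFormal N f) = 0 := Iff.rfl

theorem coord_mem_originIdeal (i : Fin N) : coord i ∈ originIdeal N := by
  simp [mem_originIdeal]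

/-- The value of a germ at the origin. -/
noncomputable def evalOrigin (N : ℕ) : ConvergentSeries N →ₐ[ℂ] ℂ :=
  { (MvPowerSeries.constantCoeff (σ := Fin N) (R := ℂ)).comp
      (toFormal N : ConvergentSeries N →+* MvPowerSeries (Fin N) ℂ) with
    commutes' := fun c => by
      change MvPowerSeries.constantCoeff (toFormal N (algebraMap ℂ _ c)) = c
      rw [AlgHom.commutes, MvPowerSeries.algebraMap_apply, MvPowerSeries.constantCoeff_C]
      rfl }

theorem mem_originIdeal_iff_evalOrigin {f : ConvergentSeries N} :
    f ∈ originIdeal N ↔ evalOrigin N f = 0 := Iff.rfl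

theorem evalOrigin_apply (f : ConvergentSeries N) :
    evalOrigin N f = MvPowerSeries.constantCoeff (toFormal N f) := rfl

theorem sub_evalOrigin_mem (f : ConvergentSeries N) :
    f - algebraMap ℂ _ (evalOrigin N f) ∈ originIdeal N := by
  rw [mem_originIdeal_iff_evalOrigin, map_sub, AlgHom.commutes]
  exact sub_self _

instance : IsDomain (ConvergentSeries N) :=
  haveI : IsDomain (MvPowerSeries (Fin N) ℂ) := NoZeroDivisors.to_isDomain _
  (toFormal_injective N).isDomain (toFormal N : ConvergentSeries N →+* MvPowerSeries (Fin N) ℂ)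

theorem hasSubst_toFormal {n : ℕ} {g : Fin n → ConvergentSeries N}
    (hg : ∀ i, g i ∈ originIdeal N) : MvPowerSeries.HasSubst fun i => toFormal N (g i) :=
  MvPowerSeries.hasSubst_of_constantCoeff_zero hg

/-- Substitution of germs vanishing at the origin for the variables. -/
noncomputable def substHom {n : ℕ} (g : Fin n → ConvergentSeries N)
    (hg : ∀ i, g i ∈ originIdeal N) : ConvergentSeries n →ₐ[ℂ] ConvergentSeries N :=
  AlgHom.codRestrict
    ((MvPowerSeries.substAlgHom (R := ℂ) (hasSubst_toFormal hg)).comp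
      (toFormal n)) (convergentSubalgebra N) fun f => by
        rw [AlgHom.comp_apply, MvPowerSeries.substAlgHom_apply]
        exact IsConvergent.subst (fun i => isConvergent_toFormal (g i)) hg
          (isConvergent_toFormal f)

theorem toFormal_substHom {n : ℕ} (g : Fin n → ConvergentSeries N)
    (hg : ∀ i, g i ∈ originIdeal N) (f : ConvergentSeries n) :
    toFormal N (substHom g hg f) =
      MvPowerSeries.subst (fun i => toFormal N (g i)) (toFormal n f) := by
  rw [← MvPowerSeries.substAlgHom_apply (hasSubst_toFormal hg)]
  rfl

@[simp] theorem substHom_coord {n : ℕ} (g : Fin n → ConvergentSeries N)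
    (hg : ∀ i, g i ∈ originIdeal N) (i : Fin n) : substHom g hg (coord i) = g i := by
  apply toFormal_injective
  rw [toFormal_substHom, toFormal_coord,
    MvPowerSeries.subst_X (hasSubst_toFormal hg)]

theorem evalOrigin_substHom {n : ℕ} (g : Fin n → ConvergentSeries N)
    (hg : ∀ i, g i ∈ originIdeal N) (f : ConvergentSeries n) :
    evalOrigin N (substHom g hg f) = evalOrigin n f := by
  have h := sub_evalOrigin_mem f
  have : evalOrigin N (substHom g hg (f - algebraMap ℂ _ (evalOrigin n f))) = 0 := by
    rw [evalOrigin_apply, toFormal_substHom]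
    exact MvPowerSeries.constantCoeff_subst_eq_zero (hasSubst_toFormal hg) hg h
  rw [map_sub, map_sub, AlgHom.commutes, AlgHom.commutes, sub_eq_zero] at this
  exact this

theorem substHom_mem_originIdeal {n : ℕ} {g : Fin n → ConvergentSeries N}
    (hg : ∀ i, g i ∈ originIdeal N) {f : ConvergentSeries n} (hf : f ∈ originIdeal n) :
    substHom g hg f ∈ originIdeal N := by
  rw [mem_originIdeal_iff_evalOrigin, evalOrigin_substHom]
  exact hf

theorem substHom_substHom {n k : ℕ} (g : Fin n → ConvergentSeries N)
    (hg : ∀ i, g i ∈ originIdeal N) (g' : Fin k → ConvergentSeries n)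
    (hg' : ∀ i, g' i ∈ originIdeal n) (f : ConvergentSeries k) :
    substHom g hg (substHom g' hg' f) =
      substHom (fun i => substHom g hg (g' i)) (fun i => substHom_mem_originIdeal hg (hg' i)) f := by
  apply toFormal_injective
  simp only [toFormal_substHom]
  rw [MvPowerSeries.subst_comp_subst_apply (hasSubst_toFormal hg')
    (hasSubst_toFormal hg)]

theorem substHom_coord_self (f : ConvergentSeries N) :
    substHom (fun i : Fin N => coord i) coord_mem_originIdeal f = f := by
  apply toFormal_injective
  rw [toFormal_substHom]
  exact congrFun MvPowerSeries.subst_self _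

/-! ### Approximation in low degrees -/

/-- The ideal of formal power series without terms of degree less than `K`. -/
def lowIdeal (N K : ℕ) : Ideal (MvPowerSeries (Fin N) ℂ) where
  carrier := {f | ∀ e : Fin N →₀ ℕ, e.degree < K → MvPowerSeries.coeff e f = 0}
  zero_mem' := by simp
  add_mem' {f g} hf hg e he := by rw [map_add, hf e he, hg e he, add_zero]
  smul_mem' c f hf e he := by
    classical
    rw [smul_eq_mul, MvPowerSeries.coeff_mul]
    refine Finset.sum_eq_zero fun p hp => ?_
    have : p.1.degree + p.2.degree = e.degree := by
      rw [← map_add, Finset.HasAntidiagonal.mem_antidiagonal.1 hp]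
    rw [hf p.2 (by omega), mul_zero]

theorem mul_mem_lowIdeal {a b : ℕ} {f g : MvPowerSeries (Fin N) ℂ} (hf : f ∈ lowIdeal N a)
    (hg : g ∈ lowIdeal N b) : f * g ∈ lowIdeal N (a + b) := by
  classical
  intro e he
  rw [MvPowerSeries.coeff_mul]
  refine Finset.sum_eq_zero fun p hp => ?_
  have : p.1.degree + p.2.degree = e.degree := by
    rw [← map_add, Finset.HasAntidiagonal.mem_antidiagonal.1 hp]
  by_cases h : p.1.degree < a
  · rw [hf _ h, zero_mul]
  · rw [hg _ (by omega), mul_zero]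

theorem pow_mem_lowIdeal {x : MvPowerSeries (Fin N) ℂ} (hx : MvPowerSeries.constantCoeff x = 0)
    (n : ℕ) : x ^ n ∈ lowIdeal N n := by
  induction n with
  | zero => intro e he; omega
  | succ n ih =>
    rw [pow_succ]
    refine mul_mem_lowIdeal ih fun e he => ?_
    have : e = 0 := by
      rw [← Finsupp.degree_eq_zero_iff]; omega
    rw [this]
    exact hx

theorem eq_of_forall_sub_mem_lowIdeal {f g : MvPowerSeries (Fin N) ℂ}
    (h : ∀ K, f - g ∈ lowIdeal N K) : f = g := by
  ext e
  have := h (e.degree + 1) e (Nat.lt_succ_self _)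
  rwa [map_sub, sub_eq_zero] at this

/-- The formal series `∑ xⁿ qₙ`, meaningful when `x` has no constant term. -/
noncomputable def powerSum (x : MvPowerSeries (Fin N) ℂ) (q : ℕ → MvPowerSeries (Fin N) ℂ) :
    MvPowerSeries (Fin N) ℂ :=
  fun e => ∑ n ∈ Finset.range (e.degree + 1), MvPowerSeries.coeff e (x ^ n * q n)

theorem powerSum_sub_mem_lowIdeal {x : MvPowerSeries (Fin N) ℂ}
    (hx : MvPowerSeries.constantCoeff x = 0) (q : ℕ → MvPowerSeries (Fin N) ℂ) (K : ℕ) :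
    powerSum x q - ∑ n ∈ Finset.range K, x ^ n * q n ∈ lowIdeal N K := by
  intro e he
  have h1 : MvPowerSeries.coeff e (powerSum x q) =
      ∑ n ∈ Finset.range (e.degree + 1), MvPowerSeries.coeff e (x ^ n * q n) := rfl
  rw [map_sub, h1, map_sum, sub_eq_zero]
  refine Finset.sum_subset (Finset.range_subset_range.2 he) fun n _ hn => ?_
  have hn' : e.degree < n := by simpa using hn
  exact Ideal.mul_mem_right _ (lowIdeal N n) (pow_mem_lowIdeal hx n) e hn'

/-- A series `∑ xⁿ qₙ` with geometrically bounded coefficients converges on a small polydisc. -/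
theorem isConvergent_powerSum {x : MvPowerSeries (Fin N) ℂ} (hxc : IsConvergent x)
    (hx : MvPowerSeries.constantCoeff x = 0) {q : ℕ → MvPowerSeries (Fin N) ℂ} {ρ : ℝ≥0}
    (hρ : 0 < ρ) {B M : ℝ≥0} (hq : ∀ n, wnorm ρ (q n) ≤ B * M ^ n) :
    IsConvergent (powerSum x q) := by
  obtain ⟨σ, hσ, hσx⟩ := exists_wnorm_le hxc hx (ε := 1 / (2 * (M + 1))) (by positivity)
  have hτ : 0 < min σ ρ := lt_min hσ hρ
  refine IsConvergent.of_wnorm hτ (ne_top_of_le_ne_top (b := ∑' n : ℕ, (B : ℝ≥0∞) * (2⁻¹) ^ n) ?_ ?_)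
  · rw [ENNReal.tsum_mul_left, ENNReal.tsum_geometric]
    refine ENNReal.mul_ne_top ENNReal.coe_ne_top ?_
    simp
  · calc wnorm (min σ ρ) (powerSum x q) ≤ ∑' n, wnorm (min σ ρ) (x ^ n * q n) := by
          refine wnorm_le_tsum _ _ _ fun a => ?_
          exact (enorm_sum_le (Finset.range (a.degree + 1))
            fun n => MvPowerSeries.coeff a (x ^ n * q n)).trans (ENNReal.sum_le_tsum _)
      _ ≤ _ := by
          refine ENNReal.tsum_le_tsum fun n => ?_
          calc wnorm (min σ ρ) (x ^ n * q n)
              ≤ ((1 / (2 * (M + 1)) : ℝ≥0) : ℝ≥0∞) ^ n * (B * M ^ n) := by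
                refine (wnorm_mul_le _ _ _).trans (mul_le_mul' ?_ ?_)
                · exact (wnorm_pow_le _ _ _).trans
                    (pow_le_pow_left' (hσx _ (min_le_left _ _)) n)
                · exact (wnorm_mono (min_le_right _ _) _).trans (hq n)
            _ = B * ((1 / (2 * (M + 1)) * M : ℝ≥0) : ℝ≥0∞) ^ n := by
                push_cast; ring
            _ ≤ B * (2⁻¹) ^ n := by
                gcongr
                have : 1 / (2 * (M + 1)) * M ≤ (2⁻¹ : ℝ≥0) := by
                  calc 1 / (2 * (M + 1)) * M ≤ 1 / (2 * (M + 1)) * (M + 1) := by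
                        gcongr; simp
                    _ = 2⁻¹ := by field_simp
                calc ((1 / (2 * (M + 1)) * M : ℝ≥0) : ℝ≥0∞) ≤ ((2⁻¹ : ℝ≥0) : ℝ≥0∞) := by
                      exact_mod_cast this
                  _ = _ := by simp

/-- The formal power series in one variable with prescribed coefficients. -/
def ofCoeffs (c : ℕ → ℂ) : MvPowerSeries (Fin 1) ℂ := fun a => c (a 0)

@[simp] theorem coeff_ofCoeffs (c : ℕ → ℂ) (a : Fin 1 →₀ ℕ) :
    MvPowerSeries.coeff a (ofCoeffs c) = c (a 0) := rfl

theorem subst_ofCoeffs_sub_mem {x : MvPowerSeries (Fin N) ℂ}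
    (hx : MvPowerSeries.constantCoeff x = 0) (c : ℕ → ℂ) (K : ℕ) :
    MvPowerSeries.subst (fun _ : Fin 1 => x) (ofCoeffs c) -
      ∑ n ∈ Finset.range K, c n • x ^ n ∈ lowIdeal N K := by
  intro e he
  have hs : MvPowerSeries.HasSubst (fun _ : Fin 1 => x) :=
    MvPowerSeries.hasSubst_of_constantCoeff_zero fun _ => hx
  rw [map_sub, MvPowerSeries.coeff_subst hs, map_sum, sub_eq_zero]
  let φ : ℕ ≃ (Fin 1 →₀ ℕ) := (Finsupp.uniqueEquiv (0 : Fin 1)).symm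
  have hφ : ∀ n, φ n = Finsupp.single 0 n := fun n => rfl
  rw [← finsum_comp_equiv φ]
  rw [finsum_eq_sum_of_support_subset (s := Finset.range K)]
  · refine Finset.sum_congr rfl fun n _ => ?_
    rw [hφ, coeff_ofCoeffs, Finsupp.prod_single_index (by simp)]
    simp
  · intro n hn
    by_contra h
    apply hn
    have h' : e.degree < n := by
      have : K ≤ n := by simpa using h
      omega
    change _ • MvPowerSeries.coeff e ((φ n).prod fun s k => x ^ k) = 0
    rw [hφ, Finsupp.prod_single_index (by simp), pow_mem_lowIdeal hx n e h', smul_zero]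

theorem isConvergent_ofCoeffs {c : ℕ → ℂ} {B M : ℝ≥0} (h : ∀ n, ‖c n‖ₑ ≤ B * M ^ n) :
    IsConvergent (ofCoeffs c) := by
  have h0 : MvPowerSeries.constantCoeff (MvPowerSeries.X 0 : MvPowerSeries (Fin 1) ℂ) = 0 := by
    simp
  have hX := isConvergent_toFormal (coord (0 : Fin 1))
  rw [toFormal_coord] at hX
  have hc := isConvergent_powerSum (N := 1) hX h0
    (q := fun n => MvPowerSeries.monomial 0 (c n)) one_pos (B := B) (M := M) fun n => by
      rw [wnorm_monomial]; simpa using h n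
  convert hc using 1
  refine eq_of_forall_sub_mem_lowIdeal fun K => ?_
  have h1 := subst_ofCoeffs_sub_mem h0 c K
  have h2 := powerSum_sub_mem_lowIdeal h0 (fun n => MvPowerSeries.monomial 0 (c n)) K
  have h3 : MvPowerSeries.subst (fun _ : Fin 1 => (MvPowerSeries.X 0 : MvPowerSeries (Fin 1) ℂ))
      (ofCoeffs c) = ofCoeffs c := by
    have : (fun _ : Fin 1 => (MvPowerSeries.X 0 : MvPowerSeries (Fin 1) ℂ)) = MvPowerSeries.X := by
      funext i
      rw [Subsingleton.elim i 0]
    rw [this]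
    exact congrFun MvPowerSeries.subst_self _
  rw [h3] at h1
  have h4 := sub_mem h1 h2
  convert h4 using 1
  have : ∀ n, (MvPowerSeries.X 0 : MvPowerSeries (Fin 1) ℂ) ^ n * MvPowerSeries.monomial 0 (c n) =
      c n • MvPowerSeries.X 0 ^ n := fun n => by
    rw [MvPowerSeries.monomial_zero_eq_C_apply, mul_comm, MvPowerSeries.smul_eq_C_mul]
  simp only [this]
  ring

/-! ### The local ring of convergent power series -/

theorem isUnit_of_evalOrigin_ne_zero {f : ConvergentSeries N} (hf : evalOrigin N f ≠ 0) :
    IsUnit f := by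
  set c := evalOrigin N f with hc
  -- write `f = c (1 - g)` and substitute `g` into the geometric series
  set g : ConvergentSeries N := 1 - algebraMap ℂ _ c⁻¹ * f with hg
  have hg0 : g ∈ originIdeal N := by
    rw [mem_originIdeal_iff_evalOrigin, hg, map_sub, map_one, map_mul, AlgHom.commutes]
    change 1 - c⁻¹ * c = 0
    rw [inv_mul_cancel₀ hf, sub_self]
  have hgeo : IsConvergent (ofCoeffs fun _ => 1) :=
    isConvergent_ofCoeffs (B := 1) (M := 1) (by simp)
  set s : ConvergentSeries N := substHom (fun _ : Fin 1 => g) (fun _ => hg0) (ofConvergent _ hgeo)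
  have hs : (1 - g) * s = 1 := by
    apply toFormal_injective
    refine eq_of_forall_sub_mem_lowIdeal fun K => ?_
    have h1 := subst_ofCoeffs_sub_mem (x := toFormal N g) hg0 (fun _ => 1) K
    have h2 := Ideal.mul_mem_left _ (1 - toFormal N g) h1
    have h3 := sub_mem h2 (pow_mem_lowIdeal (x := toFormal N g) hg0 K)
    have h4 := mul_neg_geom_sum (toFormal N g) K
    convert h3 using 1
    rw [map_mul, toFormal_substHom, toFormal_ofConvergent, mul_sub]
    simp only [one_smul, h4, map_sub, map_one]
    ring
  have hfg : algebraMap ℂ _ c⁻¹ * f = 1 - g := by rw [hg]; ring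
  rw [← hfg] at hs
  exact IsUnit.of_mul_eq_one (algebraMap ℂ _ c⁻¹ * s) (by rw [← hs]; ring)

theorem isUnit_iff_evalOrigin {f : ConvergentSeries N} : IsUnit f ↔ evalOrigin N f ≠ 0 :=
  ⟨fun h => (h.map (evalOrigin N)).ne_zero, isUnit_of_evalOrigin_ne_zero⟩

instance : IsLocalRing (ConvergentSeries N) :=
  IsLocalRing.of_isUnit_or_isUnit_one_sub_self fun f => by
    simp only [isUnit_iff_evalOrigin, map_sub, map_one]
    by_contra! h
    simp [h.1] at h

theorem maximalIdeal_eq_originIdeal :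
    IsLocalRing.maximalIdeal (ConvergentSeries N) = originIdeal N := by
  ext f
  rw [IsLocalRing.mem_maximalIdeal, mem_nonunits_iff, isUnit_iff_evalOrigin, not_not]
  rfl

instance : (originIdeal N).IsMaximal := by
  rw [← maximalIdeal_eq_originIdeal]; infer_instance

/-! ### Division by coordinates -/

/-- Every formal power series is `f(0) + ∑ⱼ xⱼ qⱼ(f)`, where `qⱼ` collects the monomials whose
first variable is `xⱼ`. -/
noncomputable def coordQuot (j : Fin N) :
    MvPowerSeries (Fin N) ℂ →ₗ[ℂ] MvPowerSeries (Fin N) ℂ where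
  toFun f := fun a =>
    if ∀ i < j, a i = 0 then MvPowerSeries.coeff (a + Finsupp.single j 1) f else 0
  map_add' f g := by
    funext a
    change (if ∀ i < j, a i = 0 then MvPowerSeries.coeff (a + Finsupp.single j 1) (f + g) else 0) =
      (if ∀ i < j, a i = 0 then MvPowerSeries.coeff (a + Finsupp.single j 1) f else 0) +
      (if ∀ i < j, a i = 0 then MvPowerSeries.coeff (a + Finsupp.single j 1) g else 0)
    split_ifs <;> simp
  map_smul' c f := by
    funext a
    change (if ∀ i < j, a i = 0 then MvPowerSeries.coeff (a + Finsupp.single j 1) (c • f) else 0) =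
      c • (if ∀ i < j, a i = 0 then MvPowerSeries.coeff (a + Finsupp.single j 1) f else 0)
    split_ifs <;> simp

theorem coeff_coordQuot (j : Fin N) (f : MvPowerSeries (Fin N) ℂ) (a : Fin N →₀ ℕ) :
    MvPowerSeries.coeff a (coordQuot j f) =
      if ∀ i < j, a i = 0 then MvPowerSeries.coeff (a + Finsupp.single j 1) f else 0 := rfl

theorem eq_C_add_sum_coordQuot (f : MvPowerSeries (Fin N) ℂ) :
    f = MvPowerSeries.C (MvPowerSeries.constantCoeff f) +
      ∑ j, MvPowerSeries.X j * coordQuot j f := by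
  classical
  ext b
  have hX : ∀ j : Fin N, MvPowerSeries.coeff b (MvPowerSeries.X j * coordQuot j f) =
      if 1 ≤ b j ∧ ∀ i < j, b i = 0 then MvPowerSeries.coeff b f else 0 := by
    intro j
    rw [MvPowerSeries.X, MvPowerSeries.coeff_monomial_mul, one_mul]
    by_cases hb : 1 ≤ b j
    · rw [if_pos (by simpa using hb), coeff_coordQuot]
      have h1 : b - Finsupp.single j 1 + Finsupp.single j 1 = b :=
        tsub_add_cancel_of_le (by simpa using hb)
      rw [h1]
      refine if_congr ?_ rfl rfl
      simp only [hb, true_and]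
      refine forall₂_congr fun i hi => ?_
      simp [Finsupp.single_eq_of_ne hi.ne]
    · rw [if_neg (by simpa using hb), if_neg (by tauto)]
  rw [map_add, map_sum, Finset.sum_congr rfl fun j _ => hX j, MvPowerSeries.coeff_C]
  by_cases hb : b = 0
  · subst hb; simp
  · rw [if_neg hb, zero_add]
    have hex : ∃ j, b j ≠ 0 := by
      by_contra! h
      exact hb (Finsupp.ext h)
    obtain ⟨j, hj, hmin⟩ : ∃ j, b j ≠ 0 ∧ ∀ i < j, b i = 0 := by
      have hne : (Finset.univ.filter fun j => b j ≠ 0).Nonempty :=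
        ⟨hex.choose, by simpa using hex.choose_spec⟩
      refine ⟨Finset.min' _ hne, by simpa using Finset.min'_mem _ hne, fun i hi => ?_⟩
      by_contra h
      exact absurd (Finset.min'_le _ i (by simpa using h)) (not_le.2 hi)
    rw [Finset.sum_eq_single j]
    · rw [if_pos ⟨Nat.one_le_iff_ne_zero.2 hj, hmin⟩]
    · intro i _ hij
      rw [if_neg]
      rintro ⟨h1, h2⟩
      rcases lt_or_gt_of_ne hij with h | h
      · have := hmin i h; omega
      · exact hj (h2 j h)
    · simp

theorem wnorm_coordQuot_le {ρ : ℝ≥0} (hρ : 0 < ρ) (j : Fin N) (f : MvPowerSeries (Fin N) ℂ) :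
    wnorm ρ (coordQuot j f) ≤ (ρ⁻¹ : ℝ≥0) * wnorm ρ f := by
  classical
  have h1 : (ρ : ℝ≥0∞) * wnorm ρ (coordQuot j f) ≤ wnorm ρ f := by
    unfold wnorm
    rw [← ENNReal.tsum_mul_left]
    refine le_trans (ENNReal.tsum_le_tsum fun a => ?_) (ENNReal.tsum_comp_le_tsum_of_injective
      (add_left_injective (Finsupp.single j 1)) _)
    rw [coeff_coordQuot, map_add, Finsupp.degree_single, pow_succ]
    split_ifs
    · exact le_of_eq (by ring)
    · simp
  calc wnorm ρ (coordQuot j f) = (ρ⁻¹ : ℝ≥0) * (ρ * wnorm ρ (coordQuot j f)) := by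
        rw [← mul_assoc, ← ENNReal.coe_mul, inv_mul_cancel₀ hρ.ne']; simp
    _ ≤ _ := by gcongr

theorem IsConvergent.coordQuot {f : MvPowerSeries (Fin N) ℂ} (hf : IsConvergent f) (j : Fin N) :
    IsConvergent (coordQuot j f) := by
  obtain ⟨ρ, hρ, h⟩ := isConvergent_iff_wnorm.1 hf
  exact .of_wnorm hρ (ne_top_of_le_ne_top (ENNReal.mul_ne_top ENNReal.coe_ne_top h)
    (wnorm_coordQuot_le hρ j f))

theorem exists_eq_add_sum_coord_mul (f : ConvergentSeries N) :
    ∃ q : Fin N → ConvergentSeries N,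
      f = algebraMap ℂ _ (evalOrigin N f) + ∑ j, coord j * q j := by
  refine ⟨fun j => ofConvergent _ ((isConvergent_toFormal f).coordQuot j), ?_⟩
  apply toFormal_injective
  conv_lhs => rw [eq_C_add_sum_coordQuot (toFormal N f)]
  rw [map_add, AlgHom.commutes, map_sum, MvPowerSeries.algebraMap_apply]
  simp only [map_mul, toFormal_coord, toFormal_ofConvergent]
  rfl

theorem originIdeal_eq_span : originIdeal N = Ideal.span (Set.range coord) := by
  refine le_antisymm (fun f hf => ?_) (Ideal.span_le.2 ?_)
  · obtain ⟨q, hq⟩ := exists_eq_add_sum_coord_mul f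
    rw [mem_originIdeal_iff_evalOrigin.1 hf, map_zero, zero_add] at hq
    rw [hq]
    exact sum_mem fun j _ => Ideal.mul_mem_right _ _ (Ideal.subset_span ⟨j, rfl⟩)
  · rintro _ ⟨j, rfl⟩
    exact coord_mem_originIdeal j

theorem originIdeal_fg : (originIdeal N).FG := by
  rw [originIdeal_eq_span]
  exact ⟨(Set.finite_range coord).toFinset, by simp⟩

/-! ### Finiteness over one-variable convergent series -/

/-- Iterated division by coordinates: a formal power series is a finite combination of fixed
elements with scalar coefficients, plus a combination of elements of the `k`-th power of the
maximal ideal. Scalars and cofactors depend linearly on the series, with bounds on every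
polydisc. -/
theorem exists_bounded_decomposition (N k : ℕ) :
    ∃ (ι κ : Type) (_ : Fintype ι) (_ : Fintype κ)
      (l : ι → MvPowerSeries (Fin N) ℂ →ₗ[ℂ] ℂ) (b : ι → ConvergentSeries N)
      (q : κ → MvPowerSeries (Fin N) ℂ →ₗ[ℂ] MvPowerSeries (Fin N) ℂ)
      (u : κ → ConvergentSeries N),
      (∀ j, u j ∈ originIdeal N ^ k) ∧
      (∀ ρ : ℝ≥0, 0 < ρ → ∃ B : ℝ≥0, ∀ f, (∀ i, ‖l i f‖ₑ ≤ B * wnorm ρ f) ∧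
        ∀ j, wnorm ρ (q j f) ≤ B * wnorm ρ f) ∧
      ∀ f, f = ∑ i, l i f • toFormal N (b i) + ∑ j, toFormal N (u j) * q j f := by
  induction k with
  | zero =>
    refine ⟨Empty, Unit, inferInstance, inferInstance, Empty.elim, Empty.elim,
      fun _ => LinearMap.id, fun _ => 1, fun _ => by simp, fun ρ _ => ⟨1, fun f => ?_⟩, fun f => ?_⟩
    · exact ⟨fun i => i.elim, fun _ => by simp⟩
    · simp
  | succ k ih =>
    obtain ⟨ι, κ, _, _, l, b, q, u, hu, hB, hf⟩ := ih
    refine ⟨ι ⊕ κ, κ × Fin N, inferInstance, inferInstance,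
      Sum.elim l fun j => (MvPowerSeries.coeff (0 : Fin N →₀ ℕ)).comp (q j), Sum.elim b u,
      fun p => (coordQuot p.2).comp (q p.1), fun p => u p.1 * coord p.2, fun p => ?_,
      fun ρ hρ => ?_, fun f => ?_⟩
    · rw [pow_succ]
      exact Ideal.mul_mem_mul (hu _) (coord_mem_originIdeal _)
    · obtain ⟨B, hB⟩ := hB ρ hρ
      refine ⟨max B (ρ⁻¹ * B), fun f => ⟨?_, fun p => ?_⟩⟩
      · rintro (i | j)
        · refine ((hB f).1 i).trans ?_
          gcongr
          exact le_max_left _ _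
        · have h1 := enorm_coeff_mul_le_wnorm ρ (q j f) 0
          simp only [map_zero, pow_zero, mul_one] at h1
          refine h1.trans (((hB f).2 j).trans ?_)
          gcongr
          exact le_max_left _ _
      · refine (wnorm_coordQuot_le hρ _ _).trans ?_
        calc ((ρ⁻¹ : ℝ≥0) : ℝ≥0∞) * wnorm ρ (q p.1 f) ≤ (ρ⁻¹ : ℝ≥0) * (B * wnorm ρ f) := by
              gcongr
              exact (hB f).2 _
          _ = ((ρ⁻¹ * B : ℝ≥0) : ℝ≥0∞) * wnorm ρ f := by push_cast; ring
          _ ≤ _ := by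
              gcongr
              exact le_max_right _ _
    · conv_lhs => rw [hf f]
      rw [Fintype.sum_sum_type, Fintype.sum_prod_type, add_assoc, ← Finset.sum_add_distrib]
      simp only [Sum.elim_inl, Sum.elim_inr]
      congr 1
      refine Finset.sum_congr rfl fun j _ => ?_
      conv_lhs => rw [eq_C_add_sum_coordQuot (q j f)]
      rw [mul_add, Finset.mul_sum, MvPowerSeries.smul_eq_C_mul, mul_comm (toFormal N (u j))]
      congr 1
      refine Finset.sum_congr rfl fun i _ => ?_
      rw [map_mul, toFormal_coord, mul_assoc]
      rfl

/-- If some power of the maximal ideal lies in `(x) + I`, then every germ is congruent modulo `I`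
to a combination of finitely many fixed germs whose coefficients are convergent power series
in `x`. The coefficients and the cofactors of the generators of `I` are sums over iterates of a
bounded operator `T` with `f ≡ (finite part) + x T(f)`; they converge because `x` is small near
the origin. -/
theorem exists_expansion {I : Ideal (ConvergentSeries N)} {x : ConvergentSeries N}
    (hx : x ∈ originIdeal N) (h : originIdeal N ≤ (Ideal.span {x} ⊔ I).radical) :
    ∃ (ι : Type) (_ : Fintype ι) (b : ι → ConvergentSeries N), ∀ f : ConvergentSeries N,
      ∃ a : ι → ConvergentSeries 1,
        f - ∑ i, substHom (fun _ => x) (fun _ => hx) (a i) * b i ∈ I := by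
  obtain ⟨k, hk⟩ := Ideal.exists_pow_le_of_le_radical_of_fg h originIdeal_fg
  obtain ⟨ι, κ, _, _, l, b, q, u, hu, hB, hdec⟩ := exists_bounded_decomposition N k
  have hu' : ∀ j, ∃ g : ConvergentSeries N, ∃ w ∈ I, u j = x * g + w := fun j => by
    obtain ⟨y, hy, w, hw, e⟩ := Submodule.mem_sup.1 (hk (hu j))
    obtain ⟨g, rfl⟩ := Ideal.mem_span_singleton'.1 hy
    exact ⟨g, w, hw, by rw [← e, mul_comm]⟩
  choose g w hw huw using hu'
  refine ⟨ι, inferInstance, b, fun f => ?_⟩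
  set X := toFormal N x with hX
  have hX0 : MvPowerSeries.constantCoeff X = 0 := hx
  let T : MvPowerSeries (Fin N) ℂ →ₗ[ℂ] MvPowerSeries (Fin N) ℂ :=
    ∑ j, (LinearMap.mulLeft ℂ (toFormal N (g j))).comp (q j)
  have hT : ∀ f, T f = ∑ j, toFormal N (g j) * q j f := fun f => by simp [T]
  -- one step of the expansion and its iterates
  have step : ∀ f, f = ∑ i, l i f • toFormal N (b i) + ∑ j, toFormal N (w j) * q j f + X * T f := by
    intro f
    conv_lhs => rw [hdec f]
    rw [hT, add_assoc, Finset.mul_sum, ← Finset.sum_add_distrib]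
    congr 1
    refine Finset.sum_congr rfl fun j _ => ?_
    rw [huw j, map_add, map_mul]
    ring
  have iter : ∀ (f : MvPowerSeries (Fin N) ℂ) (K : ℕ), f = ∑ n ∈ Finset.range K, X ^ n *
      (∑ i, l i ((T ^ n) f) • toFormal N (b i) + ∑ j, toFormal N (w j) * q j ((T ^ n) f)) +
      X ^ K * (T ^ K) f := by
    intro f K
    induction K with
    | zero => simp
    | succ K ih =>
      conv_lhs => rw [ih]
      rw [Finset.sum_range_succ, add_assoc, add_right_inj]
      conv_lhs => rw [step ((T ^ K) f)]
      rw [mul_add, pow_succ' T, Module.End.mul_apply]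
      ring
  -- a common polydisc on which `f` and the `g j` converge
  obtain ⟨ρ, hρ, hfρ, hgρ⟩ : ∃ ρ : ℝ≥0, 0 < ρ ∧ wnorm ρ (toFormal N f) ≠ ∞ ∧
      ∀ j, wnorm ρ (toFormal N (g j)) ≠ ∞ := by
    obtain ⟨ρ, hρ, h1⟩ := isConvergent_iff_wnorm.1 (isConvergent_toFormal f)
    choose r hr h2 using fun j => isConvergent_iff_wnorm.1 (isConvergent_toFormal (g j))
    obtain ⟨σ, hσ, hσr⟩ : ∃ σ : ℝ≥0, 0 < σ ∧ ∀ j, σ ≤ r j := by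
      rcases isEmpty_or_nonempty κ with hn | hn
      · exact ⟨1, one_pos, fun i => hn.elim i⟩
      · exact ⟨Finset.univ.inf' Finset.univ_nonempty r,
          (Finset.lt_inf'_iff _).2 fun i _ => hr i, fun i => Finset.inf'_le _ (Finset.mem_univ i)⟩
    exact ⟨min ρ σ, lt_min hρ hσ, ne_top_of_le_ne_top h1 (wnorm_mono (min_le_left _ _) _),
      fun j => ne_top_of_le_ne_top (h2 j) (wnorm_mono ((min_le_right _ _).trans (hσr j)) _)⟩
  obtain ⟨B, hB⟩ := hB ρ hρ
  obtain ⟨W, hW⟩ : ∃ W : ℝ≥0, (W : ℝ≥0∞) = wnorm ρ (toFormal N f) :=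
    ⟨_, ENNReal.coe_toNNReal hfρ⟩
  choose G hG using fun j => (⟨_, ENNReal.coe_toNNReal (hgρ j)⟩ :
    ∃ G : ℝ≥0, (G : ℝ≥0∞) = wnorm ρ (toFormal N (g j)))
  set M : ℝ≥0 := ∑ j, G j * B with hM
  have hTM : ∀ f, wnorm ρ (T f) ≤ M * wnorm ρ f := by
    intro f
    rw [hT, hM]
    push_cast
    rw [Finset.sum_mul]
    refine (wnorm_sum_le _ _ _).trans (Finset.sum_le_sum fun j _ => ?_)
    rw [hG, mul_assoc]
    refine (wnorm_mul_le _ _ _).trans ?_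
    gcongr
    exact (hB f).2 j
  have hTn : ∀ n, wnorm ρ ((T ^ n) (toFormal N f)) ≤ W * M ^ n := by
    intro n
    induction n with
    | zero => simp [hW]
    | succ n ih =>
      rw [pow_succ' T, Module.End.mul_apply]
      refine (hTM _).trans ?_
      calc (M : ℝ≥0∞) * wnorm ρ ((T ^ n) (toFormal N f)) ≤ M * (W * M ^ n) := by gcongr
        _ = _ := by ring
  have hlc : ∀ i, IsConvergent (ofCoeffs fun n => l i ((T ^ n) (toFormal N f))) := fun i =>
    isConvergent_ofCoeffs (B := B * W) (M := M) fun n => by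
      refine ((hB _).1 i).trans ?_
      calc (B : ℝ≥0∞) * wnorm ρ ((T ^ n) (toFormal N f)) ≤ B * (W * M ^ n) := by
            gcongr; exact hTn n
        _ = _ := by push_cast; ring
  have hqc : ∀ j, IsConvergent (powerSum X fun n => q j ((T ^ n) (toFormal N f))) := fun j =>
    isConvergent_powerSum (isConvergent_toFormal x) hX0 hρ (B := B * W) (M := M) fun n => by
      refine ((hB _).2 j).trans ?_
      calc (B : ℝ≥0∞) * wnorm ρ ((T ^ n) (toFormal N f)) ≤ B * (W * M ^ n) := by
            gcongr; exact hTn n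
        _ = _ := by push_cast; ring
  refine ⟨fun i => ofConvergent _ (hlc i), ?_⟩
  have main : f - ∑ i, substHom (fun _ => x) (fun _ => hx) (ofConvergent _ (hlc i)) * b i =
      ∑ j, w j * ofConvergent _ (hqc j) := by
    apply toFormal_injective
    refine eq_of_forall_sub_mem_lowIdeal fun K => ?_
    simp only [map_sub, map_sum, map_mul, toFormal_substHom, toFormal_ofConvergent]
    have e1 : ∀ i, _ := fun i => Ideal.mul_mem_right (toFormal N (b i)) (lowIdeal N K)
      (subst_ofCoeffs_sub_mem hX0 (fun n => l i ((T ^ n) (toFormal N f))) K)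
    have e2 : ∀ j, _ := fun j => Ideal.mul_mem_left (lowIdeal N K) (toFormal N (w j))
      (powerSum_sub_mem_lowIdeal hX0 (fun n => q j ((T ^ n) (toFormal N f))) K)
    have e3 : X ^ K * (T ^ K) (toFormal N f) ∈ lowIdeal N K :=
      Ideal.mul_mem_right _ _ (pow_mem_lowIdeal hX0 K)
    have e4 := sub_mem (sub_mem e3 (sum_mem fun i (_ : i ∈ Finset.univ) => e1 i))
      (sum_mem fun j (_ : j ∈ Finset.univ) => e2 j)
    convert e4 using 1
    have e5 := iter (toFormal N f) K
    simp only [sub_mul, mul_sub, Finset.sum_sub_distrib]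
    have e6 : ∑ n ∈ Finset.range K, X ^ n *
      (∑ i, l i ((T ^ n) (toFormal N f)) • toFormal N (b i) +
        ∑ j, toFormal N (w j) * q j ((T ^ n) (toFormal N f))) =
      ∑ i, (∑ n ∈ Finset.range K, l i ((T ^ n) (toFormal N f)) • X ^ n) * toFormal N (b i) +
      ∑ j, toFormal N (w j) * ∑ n ∈ Finset.range K, X ^ n * q j ((T ^ n) (toFormal N f)) := by
      simp only [mul_add, Finset.sum_add_distrib, Finset.mul_sum, Finset.sum_mul]
      congr 1
      · rw [Finset.sum_comm]
        refine Finset.sum_congr rfl fun i _ => Finset.sum_congr rfl fun n _ => ?_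
        rw [MvPowerSeries.smul_eq_C_mul, MvPowerSeries.smul_eq_C_mul]; ring
      · rw [Finset.sum_comm]
        refine Finset.sum_congr rfl fun i _ => Finset.sum_congr rfl fun n _ => ?_
        ring
    rw [e6] at e5
    linear_combination e5
  rw [main]
  exact sum_mem fun j _ => Ideal.mul_mem_right _ _ (hw j)

/-- Quasi-finite analytic algebras are finite. -/
theorem finite_comp_substHom {R : Type*} [CommRing R] [Algebra ℂ R]
    (π : ConvergentSeries N →ₐ[ℂ] R) (hπ : Function.Surjective π) {x : ConvergentSeries N}
    (hx : x ∈ originIdeal N)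
    (h : originIdeal N ≤ (Ideal.span {x} ⊔ RingHom.ker π).radical) :
    ((π.comp (substHom (fun _ : Fin 1 => x) fun _ => hx) : ConvergentSeries 1 →ₐ[ℂ] R) :
      ConvergentSeries 1 →+* R).Finite := by
  obtain ⟨ι, _, b, hb⟩ := exists_expansion hx h
  let _ := ((π.comp (substHom (fun _ : Fin 1 => x) fun _ => hx) : ConvergentSeries 1 →ₐ[ℂ] R) :
      ConvergentSeries 1 →+* R).toAlgebra
  change Module.Finite (ConvergentSeries 1) R
  refine Module.Finite.of_surjective (Fintype.linearCombination (ConvergentSeries 1)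
    fun i => π (b i)) fun r => ?_
  obtain ⟨f, rfl⟩ := hπ r
  obtain ⟨a, ha⟩ := hb f
  refine ⟨a, ?_⟩
  rw [RingHom.mem_ker, map_sub, sub_eq_zero] at ha
  rw [ha, Fintype.linearCombination_apply, map_sum]
  refine Finset.sum_congr rfl fun i _ => ?_
  rw [map_mul, Algebra.smul_def]
  rfl

/-! ### Convergent series in one variable -/

theorem originIdeal_one : originIdeal 1 = Ideal.span {coord 0} := by
  rw [originIdeal_eq_span, Set.range_unique]
  rfl

theorem coord_ne_zero (i : Fin N) : (coord i : ConvergentSeries N) ≠ 0 := by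
  intro h
  have := congrArg (MvPowerSeries.coeff (Finsupp.single i 1)) (congrArg (toFormal N) h)
  simp at this

/-- A nonzero one-variable germ is a power of the coordinate times a unit. -/
theorem exists_eq_pow_mul_unit {f : ConvergentSeries 1} (hf : f ≠ 0) :
    ∃ (n : ℕ) (u : ConvergentSeries 1), IsUnit u ∧ f = coord 0 ^ n * u := by
  have hex : ∃ d, MvPowerSeries.coeff (Finsupp.single (0 : Fin 1) d) (toFormal 1 f) ≠ 0 := by
    by_contra! h
    apply hf
    apply toFormal_injective
    ext a
    have ha : a = Finsupp.single 0 (a 0) := by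
      ext; simp
    rw [ha, h]
    simp
  obtain ⟨d, hd⟩ := hex
  induction d generalizing f with
  | zero =>
    exact ⟨0, f, isUnit_of_evalOrigin_ne_zero (by simpa [evalOrigin_apply] using hd), by simp⟩
  | succ d ih =>
    by_cases h0 : evalOrigin 1 f = 0
    · obtain ⟨q, hq⟩ := exists_eq_add_sum_coord_mul f
      simp only [h0, map_zero, zero_add, Finset.univ_unique, Fin.default_eq_zero, Fin.isValue,
        Finset.sum_singleton] at hq
      have hq0 : q 0 ≠ 0 := by
        rintro h
        rw [h, mul_zero] at hq
        exact hf hq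
      obtain ⟨n, u, hu, e⟩ := ih hq0 (by
        rw [hq, map_mul, toFormal_coord, MvPowerSeries.X, Finsupp.single_add, add_comm,
          MvPowerSeries.coeff_add_monomial_mul, one_mul] at hd
        exact hd)
      exact ⟨n + 1, u, hu, by rw [hq, e, pow_succ']; ring⟩
    · exact ⟨0, f, isUnit_of_evalOrigin_ne_zero h0, by simp⟩

theorem irreducible_coord : Irreducible (coord 0 : ConvergentSeries 1) := by
  refine (Prime.irreducible ?_)
  rw [← Ideal.span_singleton_prime (coord_ne_zero 0), ← originIdeal_one]
  exact Ideal.IsMaximal.isPrime inferInstance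

instance : IsDiscreteValuationRing (ConvergentSeries 1) := by
  refine IsDiscreteValuationRing.ofHasUnitMulPowIrreducibleFactorization
    ⟨coord 0, irreducible_coord, fun {f} hf => ?_⟩
  obtain ⟨n, u, hu, e⟩ := exists_eq_pow_mul_unit hf
  exact ⟨n, hu.unit, e.symm⟩

/-! ### Weierstrass-type division -/

/-- Germs that span modulo `(x) + I` over `ℂ` also span modulo `I` over the convergent power
series in `x`. -/
theorem exists_expansion_of_span {I : Ideal (ConvergentSeries N)} {x : ConvergentSeries N}
    (hx : x ∈ originIdeal N) (h : originIdeal N ≤ (Ideal.span {x} ⊔ I).radical)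
    {ι : Type*} [Fintype ι] (b : ι → ConvergentSeries N)
    (hb : ∀ f, ∃ c : ι → ℂ, f - ∑ i, c i • b i ∈ Ideal.span {x} ⊔ I) (f : ConvergentSeries N) :
    ∃ a : ι → ConvergentSeries 1,
      f - ∑ i, substHom (fun _ => x) (fun _ => hx) (a i) * b i ∈ I := by
  set π := Ideal.Quotient.mkₐ ℂ I with hπ
  have hker : RingHom.ker π = I := Ideal.Quotient.mkₐ_ker ℂ I
  set φ := π.comp (substHom (fun _ : Fin 1 => x) fun _ => hx) with hφ
  have hfin := finite_comp_substHom π (Ideal.Quotient.mkₐ_surjective ℂ I) hx (by rwa [hker])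
  let _ := (φ : ConvergentSeries 1 →+* ConvergentSeries N ⧸ I).toAlgebra
  have hfin' : Module.Finite (ConvergentSeries 1) (ConvergentSeries N ⧸ I) := hfin
  have hsm : ∀ (a : ConvergentSeries 1) (r : ConvergentSeries N ⧸ I), a • r = φ a * r :=
    fun a r => Algebra.smul_def a r
  have key : (⊤ : Submodule (ConvergentSeries 1) (ConvergentSeries N ⧸ I)) ≤
      LinearMap.range (Fintype.linearCombination (ConvergentSeries 1) fun i => π (b i)) := by
    refine Submodule.le_of_le_smul_of_le_jacobson_bot (I := originIdeal 1) hfin'.fg_top ?_ ?_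
    · rw [← maximalIdeal_eq_originIdeal]
      exact (IsLocalRing.jacobson_eq_maximalIdeal ⊥ bot_ne_top).ge
    · rintro r -
      obtain ⟨g, rfl⟩ := Ideal.Quotient.mkₐ_surjective ℂ I r
      obtain ⟨c, hc⟩ := hb g
      obtain ⟨y, hy, w, hw, e⟩ := Submodule.mem_sup.1 hc
      obtain ⟨z, rfl⟩ := Ideal.mem_span_singleton'.1 hy
      have hw0 : π w = 0 := Ideal.Quotient.eq_zero_iff_mem.2 hw
      have hg : π g = (∑ i, (algebraMap ℂ (ConvergentSeries 1) (c i)) • π (b i)) +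
          coord (0 : Fin 1) • π z := by
        have h1 : g = ∑ i, c i • b i + (z * x + w) := by rw [e]; ring
        rw [h1, map_add, map_add, hw0, add_zero, map_sum]
        congr 1
        · refine Finset.sum_congr rfl fun i _ => ?_
          rw [hsm, AlgHom.commutes, map_smul, Algebra.smul_def]
        · rw [hsm, hφ, AlgHom.comp_apply, substHom_coord, map_mul, mul_comm]
      rw [hg]
      refine Submodule.add_mem_sup ⟨_, Fintype.linearCombination_apply _ _ _⟩ ?_
      exact Submodule.smul_mem_smul (coord_mem_originIdeal 0) trivial
  obtain ⟨a, ha⟩ := key (Submodule.mem_top (x := π f))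
  refine ⟨a, ?_⟩
  rw [← hker, RingHom.mem_ker, map_sub, sub_eq_zero, ← ha, Fintype.linearCombination_apply,
    map_sum]
  refine Finset.sum_congr rfl fun i _ => ?_
  rw [map_mul, hsm]
  rfl

theorem exists_sub_sum_pow_mem (k : ℕ) (g : ConvergentSeries 2) :
    ∃ c : Fin k → ℂ, g - ∑ i, c i • (coord 1 : ConvergentSeries 2) ^ (i : ℕ) ∈
      Ideal.span {(coord 0 : ConvergentSeries 2)} ⊔ Ideal.span {coord 1 ^ k} := by
  induction k with
  | zero => exact ⟨Fin.elim0, by simp⟩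
  | succ k ih =>
    obtain ⟨c, hc⟩ := ih
    obtain ⟨y, hy, w, hw, e⟩ := Submodule.mem_sup.1 hc
    obtain ⟨z, rfl⟩ := Ideal.mem_span_singleton'.1 hw
    obtain ⟨q, hq⟩ := exists_eq_add_sum_coord_mul z
    rw [Fin.sum_univ_two] at hq
    refine ⟨Fin.snoc c (evalOrigin 2 z), ?_⟩
    have h1 : g - ∑ i, (Fin.snoc c (evalOrigin 2 z) : Fin (k + 1) → ℂ) i •
        (coord 1 : ConvergentSeries 2) ^ (i : ℕ) =
        (y + coord 0 * (q 0 * coord 1 ^ k)) + q 1 * coord 1 ^ (k + 1) := by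
      rw [Fin.sum_univ_castSucc]
      simp only [Fin.snoc_castSucc, Fin.snoc_last, Fin.val_castSucc, Fin.val_last]
      rw [Algebra.smul_def (evalOrigin 2 z)]
      linear_combination -e + coord 1 ^ k * hq
    rw [h1]
    refine Submodule.add_mem_sup (add_mem hy (Ideal.mul_mem_right _ _ ?_))
      (Ideal.mul_mem_left _ _ ?_)
    · exact Ideal.mem_span_singleton_self _
    · exact Ideal.mem_span_singleton_self _

theorem originIdeal_two_le_radical {I : Ideal (ConvergentSeries 2)} {k : ℕ}
    (h0 : coord 0 ∈ I) (h1 : coord 1 ^ k ∈ I) : originIdeal 2 ≤ I.radical := by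
  rw [originIdeal_eq_span, Ideal.span_le]
  rintro _ ⟨j, rfl⟩
  fin_cases j
  · exact Ideal.le_radical h0
  · exact ⟨k, h1⟩

theorem substHom_congr {n : ℕ} {g g' : Fin n → ConvergentSeries N} (h : g = g')
    (hg : ∀ i, g i ∈ originIdeal N) (hg' : ∀ i, g' i ∈ originIdeal N) (f : ConvergentSeries n) :
    substHom g hg f = substHom g' hg' f := by
  subst h
  rfl

theorem evalOrigin_coord (i : Fin N) : evalOrigin N (coord i) = 0 :=
  mem_originIdeal_iff_evalOrigin.1 (coord_mem_originIdeal i)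

/-- Evaluation of polynomials over `ℂ{t}` as germs in the two variables `t` and `X`. -/
noncomputable def polyToGerm : Polynomial (ConvergentSeries 1) →+* ConvergentSeries 2 :=
  Polynomial.eval₂RingHom
    (substHom (fun _ : Fin 1 => (coord 0 : ConvergentSeries 2)) fun _ => coord_mem_originIdeal 0 :
      ConvergentSeries 1 →ₐ[ℂ] ConvergentSeries 2) (coord 1)

theorem polyToGerm_X : polyToGerm Polynomial.X = coord 1 := by
  simp [polyToGerm]

theorem polyToGerm_C (a : ConvergentSeries 1) : polyToGerm (Polynomial.C a) =
    substHom (fun _ : Fin 1 => (coord 0 : ConvergentSeries 2))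
      (fun _ => coord_mem_originIdeal 0) a := by
  simp [polyToGerm]

theorem evalOrigin_polyToGerm (p : Polynomial (ConvergentSeries 1)) :
    evalOrigin 2 (polyToGerm p) = evalOrigin 1 (p.coeff 0) := by
  conv_lhs => rw [← Polynomial.divX_mul_X_add p]
  rw [map_add, map_mul, polyToGerm_X, polyToGerm_C, map_add, map_mul, evalOrigin_coord, mul_zero,
    zero_add, evalOrigin_substHom]

theorem polyToGerm_sub_mem (p : Polynomial (ConvergentSeries 1)) :
    polyToGerm p - Polynomial.aeval (coord 1) (p.map (evalOrigin 1 : ConvergentSeries 1 →+* ℂ)) ∈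
      Ideal.span {(coord 0 : ConvergentSeries 2)} := by
  induction p using Polynomial.induction_on' with
  | add p q hp hq =>
    rw [map_add, Polynomial.map_add, map_add]
    convert add_mem hp hq using 1
    ring
  | monomial n a =>
    rw [← Polynomial.C_mul_X_pow_eq_monomial, map_mul, map_pow, polyToGerm_X, polyToGerm_C,
      Polynomial.map_mul, Polynomial.map_pow, Polynomial.map_X, Polynomial.map_C, map_mul, map_pow,
      Polynomial.aeval_X, Polynomial.aeval_C, ← sub_mul]
    refine Ideal.mul_mem_right _ _ ?_
    obtain ⟨q, hq⟩ := exists_eq_add_sum_coord_mul a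
    rw [Finset.univ_unique, Finset.sum_singleton] at hq
    have h1 := congrArg (substHom (fun _ : Fin 1 => (coord 0 : ConvergentSeries 2))
      fun _ => coord_mem_originIdeal 0) hq
    rw [map_add, map_mul, substHom_coord, AlgHom.commutes] at h1
    rw [h1]
    refine Ideal.mem_span_singleton'.2 ⟨_, (mul_comm _ _).trans (add_sub_cancel_left _ _).symm⟩

/-- A monic polynomial over `ℂ{t}` becomes a power of `X` times a unit germ when `t = 0`. -/
theorem exists_polyToGerm_sub_pow_mul_mem {p : Polynomial (ConvergentSeries 1)} (hp : p.Monic) :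
    ∃ (k : ℕ) (u : ConvergentSeries 2), IsUnit u ∧
      polyToGerm p - coord 1 ^ k * u ∈ Ideal.span {(coord 0 : ConvergentSeries 2)} := by
  have hp' := hp.map (evalOrigin 1 : ConvergentSeries 1 →+* ℂ)
  obtain ⟨q, hq, hq0⟩ := Polynomial.exists_eq_pow_rootMultiplicity_mul_and_not_dvd _ hp'.ne_zero 0
  refine ⟨Polynomial.rootMultiplicity 0 (p.map (evalOrigin 1 : ConvergentSeries 1 →+* ℂ)),
    Polynomial.aeval (coord 1) q, ?_, ?_⟩
  rotate_left
  · have h := polyToGerm_sub_mem p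
    rw [hq] at h
    simpa using h
  · refine isUnit_of_evalOrigin_ne_zero ?_
    rw [← Polynomial.aeval_algHom_apply, evalOrigin_coord]
    rwa [map_zero, sub_zero, Polynomial.X_dvd_iff, Polynomial.coeff_zero_eq_aeval_zero] at hq0

/-- If `p` is monic, every germ in `t` and `X` is congruent to a polynomial in `X` modulo the germ
of `p`. -/
theorem exists_sub_polyToGerm_mem {p : Polynomial (ConvergentSeries 1)} (hp : p.Monic)
    (g : ConvergentSeries 2) : ∃ s, g - polyToGerm s ∈ Ideal.span {polyToGerm p} := by
  obtain ⟨k, u, hu, hk⟩ := exists_polyToGerm_sub_pow_mul_mem hp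
  have h1 : (coord 1 : ConvergentSeries 2) ^ k ∈
      Ideal.span {(coord 0 : ConvergentSeries 2)} ⊔ Ideal.span {polyToGerm p} := by
    have h2 : coord 1 ^ k * u ∈
        Ideal.span {(coord 0 : ConvergentSeries 2)} ⊔ Ideal.span {polyToGerm p} := by
      have := sub_mem (Ideal.mem_sup_right (S := Ideal.span {(coord 0 : ConvergentSeries 2)})
        (Ideal.mem_span_singleton_self (polyToGerm p))) (Ideal.mem_sup_left hk)
      simpa using this
    exact (Ideal.mul_unit_mem_iff_mem _ hu).1 h2
  have h0 : (coord 0 : ConvergentSeries 2) ∈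
      Ideal.span {(coord 0 : ConvergentSeries 2)} ⊔ Ideal.span {polyToGerm p} :=
    Ideal.mem_sup_left (Ideal.mem_span_singleton_self _)
  obtain ⟨a, ha⟩ := exists_expansion_of_span (coord_mem_originIdeal 0)
    (originIdeal_two_le_radical h0 h1) (fun i : Fin k => (coord 1 : ConvergentSeries 2) ^ (i : ℕ))
    (fun f => (exists_sub_sum_pow_mem k f).imp fun c hc =>
      (sup_le le_sup_left ((Ideal.span_singleton_le_iff_mem _).2 h1)) hc) g
  refine ⟨∑ i, Polynomial.C (a i) * Polynomial.X ^ (i : ℕ), ?_⟩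
  simpa only [map_sum, map_mul, map_pow, polyToGerm_C, polyToGerm_X] using ha

/-- The germ of a monic polynomial without constant term at `t = 0` divides no nonzero germ that
depends on `t` only. -/
theorem polyToGerm_C_notMem_span {p : Polynomial (ConvergentSeries 1)} (hp : p.Monic)
    (hp0 : evalOrigin 1 (p.coeff 0) = 0) {c : ConvergentSeries 1} (hc : c ≠ 0) :
    polyToGerm (Polynomial.C c) ∉ Ideal.span {polyToGerm p} := by
  -- restriction to the axis `t = 0`
  set σ : ConvergentSeries 2 →ₐ[ℂ] ConvergentSeries 1 := substHom ![0, coord 0] (by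
    intro i
    fin_cases i
    · exact zero_mem _
    · exact coord_mem_originIdeal 0) with hσ
  have hσ0 : σ (coord 0) = 0 := by rw [hσ, substHom_coord]; rfl
  have hσ1 : σ (coord 1) = coord 0 := by rw [hσ, substHom_coord]; rfl
  have hker : ∀ q, σ q = 0 → q ∈ Ideal.span {(coord 0 : ConvergentSeries 2)} := by
    intro q hq
    have hm : ∀ {k}, (coord k : ConvergentSeries 2) ∈
        Ideal.span {(coord 1 : ConvergentSeries 2)} ⊔ Ideal.span {coord 0} := by
      intro k
      fin_cases k
      · exact Ideal.mem_sup_right (Ideal.mem_span_singleton_self _)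
      · exact Ideal.mem_sup_left (Ideal.mem_span_singleton_self _)
    obtain ⟨a, ha⟩ := exists_expansion_of_span (I := Ideal.span {(coord 0 : ConvergentSeries 2)})
      (coord_mem_originIdeal 1)
      (originIdeal_two_le_radical (k := 1) hm (by simpa using hm)) (fun _ : Unit => 1)
      (fun f => ⟨fun _ => evalOrigin 2 f, by
        obtain ⟨q, hq⟩ := exists_eq_add_sum_coord_mul f
        have e : f - ∑ _i : Unit, evalOrigin 2 f • (1 : ConvergentSeries 2) =
            ∑ j, coord j * q j := by
          rw [Finset.univ_unique, Finset.sum_singleton, ← Algebra.algebraMap_eq_smul_one]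
          linear_combination hq
        rw [e]
        exact sum_mem fun j _ => Ideal.mul_mem_right _ _ hm⟩) q
    simp only [Finset.univ_unique, Finset.sum_singleton, mul_one] at ha
    obtain ⟨w, hw⟩ := Ideal.mem_span_singleton'.1 ha
    have h1 := congrArg σ hw
    rw [map_mul, hσ0, mul_zero, map_sub, hq, zero_sub, hσ, substHom_substHom] at h1
    have h2 : (a default) = 0 := by
      rw [eq_comm, neg_eq_zero] at h1
      rw [← h1, ← substHom_coord_self (a default), substHom_substHom]
      refine substHom_congr (funext fun i => ?_) _ _ _
      rw [substHom_coord, Subsingleton.elim i 0]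
      exact hσ1.symm
    rw [h2, map_zero, sub_zero] at ha
    exact ha
  have hσp : σ (polyToGerm p) ≠ 0 := by
    obtain ⟨k, u, hu, hk⟩ := exists_polyToGerm_sub_pow_mul_mem hp
    obtain ⟨w, hw⟩ := Ideal.mem_span_singleton'.1 hk
    have h1 := congrArg σ hw
    rw [map_mul, hσ0, mul_zero, map_sub, map_mul, map_pow, hσ1, eq_comm, sub_eq_zero] at h1
    rw [h1]
    exact mul_ne_zero (pow_ne_zero _ (coord_ne_zero 0)) (hu.map σ).ne_zero
  obtain ⟨n, u, hu, rfl⟩ := exists_eq_pow_mul_unit hc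
  rw [polyToGerm_C, map_mul, map_pow, substHom_coord,
    Ideal.mul_unit_mem_iff_mem _ (hu.map (substHom _ _))]
  clear hc
  induction n with
  | zero =>
    rw [pow_zero]
    intro h
    have := (mem_originIdeal_iff_evalOrigin (f := polyToGerm p)).2
      (by rw [evalOrigin_polyToGerm, hp0])
    have h2 := (Ideal.span_singleton_le_iff_mem _).2 this h
    exact (Ideal.ne_top_iff_one _).1 (Ideal.IsPrime.ne_top (Ideal.IsMaximal.isPrime inferInstance)) h2
  | succ n ih =>
    intro h
    obtain ⟨q, hq⟩ := Ideal.mem_span_singleton'.1 h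
    have h1 := congrArg σ hq
    rw [map_mul, map_pow, hσ0, zero_pow (Nat.succ_ne_zero n)] at h1
    obtain ⟨w, hw⟩ := Ideal.mem_span_singleton'.1
      (hker q ((mul_eq_zero.1 h1).resolve_right hσp))
    refine ih (Ideal.mem_span_singleton'.2 ⟨w, ?_⟩)
    refine mul_left_cancel₀ (coord_ne_zero (0 : Fin 2)) ?_
    rw [← pow_succ', ← hq, ← hw]
    ring

/-- A domain that is integral over `ℂ{t}` is local. This is the Henselian property of `ℂ{t}`: for
a nonunit `e` with minimal polynomial `p`, the germ `1 - X` is a unit, so it has a polynomial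
inverse modulo the germ of `p`, and this remains an inverse modulo `p` itself. -/
theorem isLocalRing_of_isIntegral (D : Type*) [CommRing D] [IsDomain D]
    [Algebra (ConvergentSeries 1) D] [FaithfulSMul (ConvergentSeries 1) D]
    [Algebra.IsIntegral (ConvergentSeries 1) D] : IsLocalRing D := by
  refine IsLocalRing.of_isUnit_or_isUnit_one_sub_self fun e => ?_
  have he : IsIntegral (ConvergentSeries 1) e := Algebra.IsIntegral.isIntegral e
  set p := minpoly (ConvergentSeries 1) e with hpdef
  have hp : p.Monic := minpoly.monic he
  by_cases hp0 : evalOrigin 1 (p.coeff 0) = 0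
  · right
    have hunit : IsUnit (1 - coord 1 : ConvergentSeries 2) :=
      isUnit_of_evalOrigin_ne_zero (by simp [evalOrigin_coord])
    obtain ⟨w, hw⟩ := hunit.exists_right_inv
    obtain ⟨s, hs⟩ := exists_sub_polyToGerm_mem hp w
    set H : Polynomial (ConvergentSeries 1) := 1 - (1 - Polynomial.X) * s with hH
    have hHmem : polyToGerm H ∈ Ideal.span {polyToGerm p} := by
      have : polyToGerm H = (1 - coord 1) * (w - polyToGerm s) := by
        rw [hH, map_sub, map_mul, map_sub, map_one, polyToGerm_X]
        linear_combination -hw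
      rw [this]
      exact Ideal.mul_mem_left _ _ hs
    have hHe : Polynomial.aeval e H = 0 := by
      by_contra hne
      obtain ⟨h, hc, hh⟩ := (Algebra.IsIntegral.isIntegral (R := ConvergentSeries 1)
        (Polynomial.aeval e H)).isAlgebraic.exists_nonzero_coeff_and_aeval_eq_zero
          (mem_nonZeroDivisors_of_ne_zero hne)
      have hdvd : p ∣ h.comp H := minpoly.isIntegrallyClosed_dvd he (by
        rw [Polynomial.aeval_comp, hh])
      refine polyToGerm_C_notMem_span hp hp0 hc ?_
      have h1 : Polynomial.C (h.coeff 0) = h.comp H - h.divX.comp H * H := by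
        have h2 := congrArg (fun g => Polynomial.comp g H) (Polynomial.divX_mul_X_add h)
        simp only [Polynomial.add_comp, Polynomial.mul_comp, Polynomial.X_comp,
          Polynomial.C_comp] at h2
        linear_combination h2
      rw [h1, map_sub, map_mul]
      refine sub_mem ?_ (Ideal.mul_mem_left _ _ hHmem)
      exact Ideal.mem_span_singleton.2 (map_dvd polyToGerm hdvd)
    refine IsUnit.of_mul_eq_one (Polynomial.aeval e s) ?_
    rw [hH] at hHe
    simp only [map_sub, map_one, map_mul, Polynomial.aeval_X] at hHe
    linear_combination -hHe
  · left
    have hu : IsUnit (algebraMap (ConvergentSeries 1) D (p.coeff 0)) :=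
      (isUnit_of_evalOrigin_ne_zero hp0).map _
    have h1 : Polynomial.aeval e p = 0 := minpoly.aeval _ _
    rw [← Polynomial.divX_mul_X_add p, map_add, map_mul, Polynomial.aeval_X,
      Polynomial.aeval_C] at h1
    refine isUnit_of_dvd_unit (Dvd.intro_left (-Polynomial.aeval e p.divX) ?_) hu
    linear_combination -h1

end CurveLattice

namespace CurveLattice

/-! ### Normalization of a branch -/

theorem faithfulSMul_normalization (B : Type*) [CommRing B] [Algebra (ConvergentSeries 1) B]
    [FaithfulSMul (ConvergentSeries 1) B] :
    FaithfulSMul (ConvergentSeries 1) (integralClosure B (FractionRing B)) := by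
  rw [faithfulSMul_iff_algebraMap_injective]
  have h1 : Function.Injective (algebraMap (ConvergentSeries 1) (FractionRing B)) := by
    rw [IsScalarTower.algebraMap_eq (ConvergentSeries 1) B (FractionRing B)]
    exact (IsFractionRing.injective B (FractionRing B)).comp
      (FaithfulSMul.algebraMap_injective _ _)
  exact fun a b h => h1 (congrArg Subtype.val h)

section Normalization

variable (B : Type*) [CommRing B] [Algebra (ConvergentSeries 1) B]
  [Module.Finite (ConvergentSeries 1) B]

theorem isIntegralClosure_normalization :
    IsIntegralClosure (integralClosure B (FractionRing B)) (ConvergentSeries 1)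
      (FractionRing B) where
  algebraMap_injective := Subtype.val_injective
  isIntegral_iff {x} := by
    constructor
    · intro hx
      exact ⟨⟨x, hx.tower_top⟩, rfl⟩
    · rintro ⟨y, rfl⟩
      exact isIntegral_trans (R := ConvergentSeries 1) (A := B) _ y.2

variable [IsDomain B] [FaithfulSMul (ConvergentSeries 1) B]

theorem normalization_finite_and_isDedekindDomain :
    Module.Finite (ConvergentSeries 1) (integralClosure B (FractionRing B)) ∧
      IsDedekindDomain (integralClosure B (FractionRing B)) := by
  let K := FractionRing (ConvergentSeries 1)
  let L := FractionRing B
  let _ : Algebra K L := FractionRing.liftAlgebra (ConvergentSeries 1) L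
  have := FractionRing.isScalarTower_liftAlgebra (ConvergentSeries 1) L
  have : IsLocalization (Algebra.algebraMapSubmonoid B (nonZeroDivisors (ConvergentSeries 1))) L :=
    inferInstance
  have : FiniteDimensional K L :=
    .of_isLocalization (ConvergentSeries 1) B (nonZeroDivisors (ConvergentSeries 1))
  have : CharZero (ConvergentSeries 1) :=
    charZero_of_injective_algebraMap (algebraMap ℂ (ConvergentSeries 1)).injective
  have : CharZero K :=
    charZero_of_injective_algebraMap (IsFractionRing.injective (ConvergentSeries 1) K)
  have := isIntegralClosure_normalization B
  exact ⟨IsIntegralClosure.finite (ConvergentSeries 1) K L _,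
    IsIntegralClosure.isDedekindDomain (ConvergentSeries 1) K L _⟩

theorem normalization_isLocalRing : IsLocalRing (integralClosure B (FractionRing B)) := by
  have := (normalization_finite_and_isDedekindDomain B).1
  have := faithfulSMul_normalization B
  exact isLocalRing_of_isIntegral _

theorem normalization_isDiscreteValuationRing :
    IsDiscreteValuationRing (integralClosure B (FractionRing B)) := by
  obtain ⟨_, _⟩ := normalization_finite_and_isDedekindDomain B
  have := faithfulSMul_normalization B
  have := normalization_isLocalRing B
  have hnf : ¬ IsField (integralClosure B (FractionRing B)) := by
    intro h
    have h2 : IsField (ConvergentSeries 1) :=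
      isField_of_isIntegral_of_isField (FaithfulSMul.algebraMap_injective _ _) h
    exact IsDiscreteValuationRing.not_isField _ h2
  have h : IsDiscreteValuationRing (integralClosure B (FractionRing B)) ↔
      IsDedekindDomain (integralClosure B (FractionRing B)) :=
    (IsDiscreteValuationRing.TFAE _ hnf).out 0 2
  exact h.2 inferInstance

/-- The residue field of the normalization is `ℂ`. -/
theorem exists_sub_algebraMap_not_isUnit [Algebra ℂ B] [IsScalarTower ℂ (ConvergentSeries 1) B]
    (d : integralClosure B (FractionRing B)) :
    ∃ c : ℂ, ¬ IsUnit (d - algebraMap ℂ _ c) := by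
  obtain ⟨_, _⟩ := normalization_finite_and_isDedekindDomain B
  have := faithfulSMul_normalization B
  have := normalization_isLocalRing B
  let D := integralClosure B (FractionRing B)
  have htow : ∀ c : ℂ, algebraMap (ConvergentSeries 1) D (algebraMap ℂ _ c) = algebraMap ℂ D c := by
    intro c
    apply Subtype.val_injective
    change algebraMap (ConvergentSeries 1) (FractionRing B) (algebraMap ℂ _ c) =
      algebraMap ℂ (FractionRing B) c
    rw [IsScalarTower.algebraMap_apply (ConvergentSeries 1) B (FractionRing B),
      IsScalarTower.algebraMap_apply ℂ B (FractionRing B),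
      IsScalarTower.algebraMap_apply ℂ (ConvergentSeries 1) B]
  let res := IsLocalRing.residue D
  have hres : ∀ a : ConvergentSeries 1, res (algebraMap _ D a) =
      res (algebraMap ℂ D (evalOrigin 1 a)) := by
    intro a
    rw [← sub_eq_zero, ← map_sub, ← htow, ← map_sub, IsLocalRing.residue_eq_zero_iff,
      IsLocalRing.mem_maximalIdeal, mem_nonunits_iff, isUnit_map_iff]
    rw [isUnit_iff_evalOrigin, not_not]
    exact sub_evalOrigin_mem a
  have hint : IsIntegral (ConvergentSeries 1) d := Algebra.IsIntegral.isIntegral d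
  obtain ⟨p, hp, hpd⟩ := hint
  set p' := p.map (evalOrigin 1 : ConvergentSeries 1 →+* ℂ) with hp'
  have hroot : p'.eval₂ (res.comp (algebraMap ℂ D)) (res d) = 0 := by
    rw [hp', Polynomial.eval₂_map]
    have : (res.comp (algebraMap ℂ D)).comp (evalOrigin 1 : ConvergentSeries 1 →+* ℂ) =
        res.comp (algebraMap (ConvergentSeries 1) D) := by
      ext a
      exact (hres a).symm
    rw [this, ← Polynomial.hom_eval₂, hpd, map_zero]
  have hsplit := IsAlgClosed.splits p'
  have hmonic : p'.Monic := hp.map _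
  rw [hsplit.eq_prod_roots_of_monic hmonic, Polynomial.eval₂_multiset_prod,
    Multiset.prod_eq_zero_iff] at hroot
  simp only [Multiset.map_map, Multiset.mem_map, Function.comp_apply, Polynomial.eval₂_sub,
    Polynomial.eval₂_X, Polynomial.eval₂_C, RingHom.comp_apply] at hroot
  obtain ⟨c, -, hc⟩ := hroot
  refine ⟨c, ?_⟩
  rw [← map_sub, IsLocalRing.residue_eq_zero_iff] at hc
  exact hc

/-- The conductor of the normalization is nonzero. -/
theorem exists_conductor : ∃ γ : B, γ ≠ 0 ∧ ∀ d : integralClosure B (FractionRing B),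
    ∃ b : B, algebraMap B (integralClosure B (FractionRing B)) b = algebraMap B _ γ * d := by
  obtain ⟨_, _⟩ := normalization_finite_and_isDedekindDomain B
  have hfin : Module.Finite B (integralClosure B (FractionRing B)) :=
    Module.Finite.of_restrictScalars_finite (ConvergentSeries 1) B _
  obtain ⟨s, hs⟩ := hfin.fg_top
  classical
  obtain ⟨γ, hγ⟩ := IsLocalization.exist_integer_multiples_of_finset (nonZeroDivisors B)
    (s.image Subtype.val : Finset (FractionRing B))
  refine ⟨γ, nonZeroDivisors.ne_zero γ.2, fun d => ?_⟩
  have hd : d ∈ Submodule.span B (s : Set (integralClosure B (FractionRing B))) := by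
    rw [hs]; trivial
  induction hd using Submodule.span_induction with
  | mem x hx =>
    obtain ⟨b, hb⟩ := hγ x (Finset.mem_image_of_mem _ hx)
    refine ⟨b, Subtype.val_injective ?_⟩
    rw [Algebra.smul_def] at hb
    exact hb
  | zero => exact ⟨0, by simp⟩
  | add x y _ _ hx hy =>
    obtain ⟨b, hb⟩ := hx
    obtain ⟨b', hb'⟩ := hy
    exact ⟨b + b', by rw [map_add, hb, hb', mul_add]⟩
  | smul a x _ hx =>
    obtain ⟨b, hb⟩ := hx
    exact ⟨a * b, by rw [map_mul, hb, Algebra.smul_def]; ring⟩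

end Normalization

/-! ### Branches of a curve singularity -/

namespace ReducedCurveSingularity

variable {N r : ℕ} (C : ReducedCurveSingularity N r)

theorem branchIdeal_ne_originIdeal (i : Fin r) : C.branchIdeal i ≠ originIdeal N := by
  intro h
  have h1 := C.dim_eq_one i
  rw [h] at h1
  have h2 := ringKrullDim_eq_zero_of_isField
    ((Ideal.Quotient.maximal_ideal_iff_isField_quotient _).1 (inferInstance : (originIdeal N).IsMaximal))
  rw [h2] at h1
  exact zero_ne_one h1

theorem eq_originIdeal_of_branchIdeal_lt {i : Fin r} {q : Ideal (ConvergentSeries N)}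
    (hq : q.IsPrime) (h : C.branchIdeal i < q) : q = originIdeal N := by
  have h1 : Ring.KrullDimLE 1 (C.BranchRing i) := Ring.krullDimLE_iff.2 (C.dim_eq_one i).le
  have h2 : q.map (Ideal.Quotient.mk (C.branchIdeal i)) ≠ ⊥ := by
    intro h3
    rw [Ideal.map_eq_bot_iff_le_ker, Ideal.mk_ker] at h3
    exact absurd h3 (not_le_of_gt h)
  have h3 : (q.map (Ideal.Quotient.mk (C.branchIdeal i))).IsPrime :=
    Ideal.map_isPrime_of_surjective Ideal.Quotient.mk_surjective (by rw [Ideal.mk_ker]; exact h.le)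
  have h4 := Ring.krullDimLE_one_iff_of_noZeroDivisors.1 h1 _ h2 h3
  have h5 := Ideal.comap_isMaximal_of_surjective (Ideal.Quotient.mk (C.branchIdeal i))
    Ideal.Quotient.mk_surjective (K := q.map (Ideal.Quotient.mk (C.branchIdeal i)))
  rw [Ideal.comap_map_of_surjective _ Ideal.Quotient.mk_surjective,
    ← RingHom.ker_eq_comap_bot, Ideal.mk_ker, sup_of_le_left h.le] at h5
  rw [← maximalIdeal_eq_originIdeal]
  exact IsLocalRing.eq_maximalIdeal h5

theorem branchIdeal_le_originIdeal (i : Fin r) : C.branchIdeal i ≤ originIdeal N := by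
  rw [← maximalIdeal_eq_originIdeal]
  exact IsLocalRing.le_maximalIdeal (C.isPrime i).ne_top

/-- The distinct branch ideals are pairwise incomparable. -/
theorem not_branchIdeal_le {i j : Fin r} (hij : i ≠ j) : ¬ C.branchIdeal i ≤ C.branchIdeal j := by
  intro h
  have h1 : C.branchIdeal i < C.branchIdeal j :=
    lt_of_le_of_ne h fun e => hij (C.branchIdeal_injective e)
  exact C.branchIdeal_ne_originIdeal j (C.eq_originIdeal_of_branchIdeal_lt (C.isPrime j) h1)

/-- A parameter makes the local ring of a branch a finite torsion-free extension of `ℂ{t}`. -/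
theorem exists_parameter (i : Fin r) : ∃ φ : ConvergentSeries 1 →ₐ[ℂ] C.BranchRing i,
    (φ : ConvergentSeries 1 →+* C.BranchRing i).Finite ∧ Function.Injective φ := by
  obtain ⟨x, hx, hxp⟩ : ∃ x ∈ originIdeal N, x ∉ C.branchIdeal i := by
    by_contra! h
    exact C.branchIdeal_ne_originIdeal i (le_antisymm (C.branchIdeal_le_originIdeal i) h)
  have hker : RingHom.ker (Ideal.Quotient.mkₐ ℂ (C.branchIdeal i)) = C.branchIdeal i :=
    Ideal.Quotient.mkₐ_ker ℂ _
  refine ⟨(Ideal.Quotient.mkₐ ℂ (C.branchIdeal i)).comp (substHom (fun _ => x) fun _ => hx),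
    finite_comp_substHom _ (Ideal.Quotient.mkₐ_surjective ℂ _) hx ?_, ?_⟩
  · rw [hker, Ideal.radical_eq_sInf]
    refine le_sInf fun q hq => ?_
    obtain ⟨h1, h2⟩ := hq
    rw [sup_le_iff, Ideal.span_singleton_le_iff_mem] at h1
    refine (C.eq_originIdeal_of_branchIdeal_lt h2 (lt_of_le_of_ne h1.2 ?_)).ge
    rintro rfl
    exact hxp h1.1
  · rw [injective_iff_map_eq_zero]
    intro f hf
    by_contra hne
    obtain ⟨n, u, hu, rfl⟩ := exists_eq_pow_mul_unit hne
    rw [map_mul, map_pow, AlgHom.comp_apply, substHom_coord] at hf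
    have h1 := (mul_eq_zero.1 hf).resolve_right (hu.map _).ne_zero
    exact pow_ne_zero n (fun h => hxp (Ideal.Quotient.eq_zero_iff_mem.1 h)) h1

theorem isDiscreteValuationRing_normalization_and_residue_and_conductor (i : Fin r) :
    IsDiscreteValuationRing (C.Normalization i) ∧
    (∀ d : C.Normalization i, ∃ c : ℂ, ¬ IsUnit (d - algebraMap ℂ _ c)) ∧
    ∃ γ : C.BranchRing i, γ ≠ 0 ∧ ∀ d : C.Normalization i,
      ∃ b : C.BranchRing i, algebraMap (C.BranchRing i) (C.Normalization i) b =
        algebraMap (C.BranchRing i) (C.Normalization i) γ * d := by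
  obtain ⟨φ, hfin, hinj⟩ := C.exists_parameter i
  let _ : Algebra (ConvergentSeries 1) (C.BranchRing i) :=
    (φ : ConvergentSeries 1 →+* C.BranchRing i).toAlgebra
  have : Module.Finite (ConvergentSeries 1) (C.BranchRing i) := hfin
  have : FaithfulSMul (ConvergentSeries 1) (C.BranchRing i) :=
    (faithfulSMul_iff_algebraMap_injective _ _).2 hinj
  have : IsScalarTower ℂ (ConvergentSeries 1) (C.BranchRing i) :=
    IsScalarTower.of_algebraMap_eq fun c => (φ.commutes c).symm
  exact ⟨normalization_isDiscreteValuationRing (C.BranchRing i),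
    exists_sub_algebraMap_not_isUnit (C.BranchRing i), exists_conductor (C.BranchRing i)⟩

end ReducedCurveSingularity

end CurveLattice

namespace CurveLattice
theorem isUnit_of_isUnit_algebraMap_normalization (B : Type*) [CommRing B] [IsDomain B] {b : B}
    (h : IsUnit (algebraMap B (integralClosure B (FractionRing B)) b)) : IsUnit b := by
  have : FaithfulSMul B (integralClosure B (FractionRing B)) :=
    (faithfulSMul_iff_algebraMap_injective _ _).2 fun _ _ e =>
      IsFractionRing.injective B (FractionRing B) (congrArg Subtype.val e)
  have := Algebra.IsIntegral.isLocalHom (R := B) (S := integralClosure B (FractionRing B))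
  exact (isUnit_map_iff _ _).1 h

namespace ReducedCurveSingularity

variable {N r : ℕ} (C : ReducedCurveSingularity N r)

/-! ### The valuations of a curve singularity -/

instance (i : Fin r) : IsDiscreteValuationRing (C.Normalization i) :=
  (C.isDiscreteValuationRing_normalization_and_residue_and_conductor i).1

open IsDiscreteValuationRing in
theorem valuation_eq_addVal (i : Fin r) (g : C.LocalRing) :
    C.valuation i g = addVal (C.Normalization i) (C.pullback i g) := by
  obtain ⟨ϖ, hϖ⟩ := exists_irreducible (C.Normalization i)
  refine ENat.eq_of_forall_natCast_le_iff fun n => ?_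
  rw [le_valuation_iff, normalizationMaxIdeal, IsLocalRing.ringJacobson_eq_maximalIdeal,
    hϖ.maximalIdeal_eq, Ideal.span_singleton_pow, Ideal.mem_span_singleton, ← addVal_le_iff_dvd,
    hϖ.addVal_pow]

theorem pullback_mk (i : Fin r) (f : ConvergentSeries N) :
    C.pullback i (Ideal.Quotient.mk C.ideal f) =
      algebraMap (C.BranchRing i) (C.Normalization i) (Ideal.Quotient.mk _ f) := rfl

theorem pullback_algebraMap (i : Fin r) (c : ℂ) :
    C.pullback i (algebraMap ℂ _ c) = algebraMap ℂ (C.Normalization i) c := rfl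

theorem algebraMap_normalization_injective (i : Fin r) :
    Function.Injective (algebraMap (C.BranchRing i) (C.Normalization i)) := fun _ _ h =>
  IsFractionRing.injective (C.BranchRing i) (FractionRing (C.BranchRing i))
    (congrArg Subtype.val h)

theorem eq_zero_of_pullback_eq_zero {g : C.LocalRing} (h : ∀ i, C.pullback i g = 0) : g = 0 := by
  obtain ⟨f, rfl⟩ := Ideal.Quotient.mk_surjective g
  rw [Ideal.Quotient.eq_zero_iff_mem]
  refine (Submodule.mem_iInf _).2 fun i => ?_
  have := h i
  rw [pullback_mk] at this
  rw [← Ideal.Quotient.eq_zero_iff_mem]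
  exact C.algebraMap_normalization_injective i (this.trans (map_zero _).symm)

theorem eq_zero_of_valuation_eq_top {g : C.LocalRing} (h : ∀ i, C.valuation i g = ⊤) : g = 0 :=
  C.eq_zero_of_pullback_eq_zero fun i =>
    IsDiscreteValuationRing.addVal_eq_top_iff.1 (by rw [← valuation_eq_addVal, h])

/-- The local ring contains a nonzero ideal of the product of the normalizations. -/
theorem exists_conductor_pullback : ∃ γ : ∀ i, C.Normalization i, (∀ i, γ i ≠ 0) ∧
    ∀ d : ∀ i, C.Normalization i, ∃ g : C.LocalRing, ∀ i, C.pullback i g = γ i * d i := by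
  classical
  choose γ hγ hγd using fun i =>
    (C.isDiscreteValuationRing_normalization_and_residue_and_conductor i).2.2
  have hsep : ∀ i, ∃ f : ConvergentSeries N, f ∉ C.branchIdeal i ∧
      ∀ j, j ≠ i → f ∈ C.branchIdeal j := by
    intro i
    have h1 : ∀ j, ∃ h : ConvergentSeries N, j ≠ i → h ∈ C.branchIdeal j ∧ h ∉ C.branchIdeal i := by
      intro j
      by_cases hj : j = i
      · exact ⟨0, fun h => absurd hj h⟩
      · obtain ⟨h, h2, h3⟩ := Set.not_subset.1 (C.not_branchIdeal_le hj)
        exact ⟨h, fun _ => ⟨h2, h3⟩⟩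
    choose h hh using h1
    refine ⟨∏ j ∈ Finset.univ.erase i, h j, fun hmem => ?_, fun j hj => ?_⟩
    · obtain ⟨j, hj, hj'⟩ := (C.isPrime i).prod_mem_iff.1 hmem
      exact (hh j (Finset.ne_of_mem_erase hj)).2 hj'
    · exact Ideal.mem_of_dvd _ (Finset.dvd_prod_of_mem h (by simpa using hj)) (hh j hj).1
  choose f hf hf' using hsep
  refine ⟨fun i => algebraMap (C.BranchRing i) _ (Ideal.Quotient.mk _ (f i) * γ i),
    fun i => ?_, fun d => ?_⟩
  · rw [Ne, ← map_zero (algebraMap (C.BranchRing i) (C.Normalization i)),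
      (C.algebraMap_normalization_injective i).eq_iff]
    exact mul_ne_zero (fun h => hf i (Ideal.Quotient.eq_zero_iff_mem.1 h)) (hγ i)
  · choose b hb using fun i => hγd i (d i)
    choose a ha using fun i => Ideal.Quotient.mk_surjective (b i)
    refine ⟨Ideal.Quotient.mk _ (∑ i, f i * a i), fun i => ?_⟩
    rw [pullback_mk, map_sum, Finset.sum_eq_single i]
    · simp only [map_mul, ha, hb, mul_assoc]
    · intro j _ hj
      exact Ideal.Quotient.eq_zero_iff_mem.2 (Ideal.mul_mem_right _ _ (hf' j i hj.symm))
    · simp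

theorem valuation_mul (i : Fin r) (f g : C.LocalRing) :
    C.valuation i (f * g) = C.valuation i f + C.valuation i g := by
  simp only [valuation_eq_addVal, map_mul, IsDiscreteValuationRing.addVal_mul]

theorem valuation_one (i : Fin r) : C.valuation i 1 = 0 := by
  simp only [valuation_eq_addVal, map_one, IsDiscreteValuationRing.addVal_one]

theorem valuation_pow (i : Fin r) (f : C.LocalRing) (n : ℕ) :
    C.valuation i (f ^ n) = n * C.valuation i f := by
  simp only [valuation_eq_addVal, map_pow, IsDiscreteValuationRing.addVal_pow, nsmul_eq_mul]

theorem min_le_valuation_add (i : Fin r) (f g : C.LocalRing) :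
    min (C.valuation i f) (C.valuation i g) ≤ C.valuation i (f + g) := by
  rw [valuation_eq_addVal, valuation_eq_addVal, valuation_eq_addVal, map_add (C.pullback i)]
  exact IsDiscreteValuationRing.addVal_add

theorem le_valuation_add {i : Fin r} {f g : C.LocalRing} {n : ℕ∞} (hf : n ≤ C.valuation i f)
    (hg : n ≤ C.valuation i g) : n ≤ C.valuation i (f + g) :=
  (le_min hf hg).trans (C.min_le_valuation_add i f g)

theorem valuation_neg (i : Fin r) (f : C.LocalRing) :
    C.valuation i (-f) = C.valuation i f := by
  rw [valuation_eq_addVal, valuation_eq_addVal, map_neg (C.pullback i), AddValuation.map_neg]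

theorem le_valuation_sub {i : Fin r} {f g : C.LocalRing} {n : ℕ∞} (hf : n ≤ C.valuation i f)
    (hg : n ≤ C.valuation i g) : n ≤ C.valuation i (f - g) := by
  rw [sub_eq_add_neg]
  exact C.le_valuation_add hf (by rwa [valuation_neg])

theorem mem_filtration {l : Fin r → ℕ} {g : C.LocalRing} :
    g ∈ C.filtration l ↔ ∀ i, (l i : ℕ∞) ≤ C.valuation i g := Iff.rfl

instance : IsLocalRing C.LocalRing :=
  have : Nontrivial C.LocalRing := Ideal.Quotient.nontrivial_iff.2 fun h => by
    have h1 := C.ideal_le ⟨0, C.r_pos⟩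
    rw [h, top_le_iff] at h1
    exact (C.isPrime _).ne_top h1
  .of_surjective' (Ideal.Quotient.mk C.ideal) Ideal.Quotient.mk_surjective

theorem maxIdeal_eq_maximalIdeal : C.maxIdeal = IsLocalRing.maximalIdeal C.LocalRing := by
  have : C.maxIdeal.IsMaximal := by
    refine (Ideal.map_eq_top_or_isMaximal_of_surjective _ Ideal.Quotient.mk_surjective
      (inferInstance : (originIdeal N).IsMaximal)).resolve_left fun h => ?_
    have h1 : (1 : C.LocalRing) ∈ C.maxIdeal := by
      rw [show C.maxIdeal = ⊤ from h]; trivial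
    obtain ⟨f, hf, h2⟩ := (Ideal.mem_map_iff_of_surjective _ Ideal.Quotient.mk_surjective).1 h1
    rw [← map_one (Ideal.Quotient.mk C.ideal), Ideal.Quotient.eq] at h2
    have h3 := C.branchIdeal_le_originIdeal ⟨0, C.r_pos⟩ (C.ideal_le _ h2)
    have h4 : (1 : ConvergentSeries N) ∈ originIdeal N := by
      have := sub_mem hf h3
      simpa using this
    exact (Ideal.ne_top_iff_one _).1
      (Ideal.IsMaximal.ne_top (inferInstance : (originIdeal N).IsMaximal)) h4
  exact IsLocalRing.eq_maximalIdeal this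

theorem isUnit_iff_notMem_maxIdeal {g : C.LocalRing} : IsUnit g ↔ g ∉ C.maxIdeal := by
  rw [maxIdeal_eq_maximalIdeal, IsLocalRing.mem_maximalIdeal, mem_nonunits_iff, not_not]

theorem exists_sub_algebraMap_mem_maxIdeal (g : C.LocalRing) :
    ∃ c : ℂ, g - algebraMap ℂ _ c ∈ C.maxIdeal := by
  obtain ⟨f, rfl⟩ := Ideal.Quotient.mk_surjective g
  exact ⟨evalOrigin N f, Ideal.mem_map_of_mem _ (sub_evalOrigin_mem f)⟩

theorem valuation_algebraMap (i : Fin r) {c : ℂ} (hc : c ≠ 0) :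
    C.valuation i (algebraMap ℂ _ c) = 0 := by
  rw [valuation_eq_addVal, IsDiscreteValuationRing.addVal_eq_zero_iff]
  exact ((isUnit_iff_ne_zero.2 hc).map (algebraMap ℂ C.LocalRing)).map (C.pullback i)

theorem valuation_smul (i : Fin r) {c : ℂ} (hc : c ≠ 0) (f : C.LocalRing) :
    C.valuation i (c • f) = C.valuation i f := by
  rw [Algebra.smul_def, valuation_mul, C.valuation_algebraMap i hc, zero_add]

theorem le_valuation_smul {i : Fin r} (c : ℂ) {f : C.LocalRing} {n : ℕ∞}
    (hf : n ≤ C.valuation i f) : n ≤ C.valuation i (c • f) := by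
  rw [Algebra.smul_def, valuation_mul]
  exact hf.trans le_add_self

theorem exists_smul_valuation_lt {i : Fin r} {f g : C.LocalRing} (hf : C.valuation i f ≠ ⊤)
    (hfg : C.valuation i f ≤ C.valuation i g) :
    ∃ c : ℂ, C.valuation i f < C.valuation i (g - c • f) := by
  simp only [valuation_eq_addVal] at *
  obtain ⟨u, hu⟩ := IsDiscreteValuationRing.addVal_le_iff_dvd.1 hfg
  obtain ⟨c, hc⟩ :=
    (C.isDiscreteValuationRing_normalization_and_residue_and_conductor i).2.1 u
  refine ⟨c, ?_⟩
  have h1 : C.pullback i (g - c • f) =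
      C.pullback i f * (u - algebraMap ℂ (C.Normalization i) c) := by
    rw [map_sub, hu, Algebra.smul_def, map_mul, pullback_algebraMap]
    ring
  rw [h1, IsDiscreteValuationRing.addVal_mul]
  have h2 : 0 < IsDiscreteValuationRing.addVal (C.Normalization i)
      (u - algebraMap ℂ (C.Normalization i) c) := by
    rw [pos_iff_ne_zero, Ne, IsDiscreteValuationRing.addVal_eq_zero_iff]
    exact hc
  exact ((ENat.lt_add_one_iff hf).2 le_rfl).trans_le
    (add_le_add le_rfl (Order.one_le_iff_pos.2 h2))

theorem one_le_valuation_iff (i : Fin r) {g : C.LocalRing} :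
    1 ≤ C.valuation i g ↔ g ∈ C.maxIdeal := by
  rw [← not_iff_not, ← isUnit_iff_notMem_maxIdeal, not_le, Order.lt_one_iff]
  constructor
  · intro h
    rw [isUnit_iff_notMem_maxIdeal]
    intro hg
    obtain ⟨f, hf, rfl⟩ := (Ideal.mem_map_iff_of_surjective _ Ideal.Quotient.mk_surjective).1 hg
    rw [valuation_eq_addVal, IsDiscreteValuationRing.addVal_eq_zero_iff, pullback_mk] at h
    -- the normalization is integral over the branch, so units descend
    have h1 := isUnit_of_isUnit_algebraMap_normalization _ h
    obtain ⟨b, hb⟩ := h1.exists_right_inv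
    obtain ⟨q, rfl⟩ := Ideal.Quotient.mk_surjective b
    rw [← map_mul, ← map_one (Ideal.Quotient.mk _), Ideal.Quotient.eq] at hb
    have h2 := sub_mem (Ideal.mul_mem_right q _ hf) (C.branchIdeal_le_originIdeal i hb)
    rw [sub_sub_cancel] at h2
    exact (Ideal.ne_top_iff_one _).1
      (Ideal.IsMaximal.ne_top (inferInstance : (originIdeal N).IsMaximal)) h2
  · intro h
    rw [valuation_eq_addVal, IsDiscreteValuationRing.addVal_eq_zero_iff]
    exact h.map _

/-- Conductor property: elements of sufficiently large relative valuation are multiples. -/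
theorem exists_conductor_exponent : ∃ K : ℕ,
    (∀ f g : C.LocalRing, (∀ i, C.valuation i f ≠ ⊤) →
      (∀ i, C.valuation i f + K ≤ C.valuation i g) → f ∣ g) ∧
    ∀ l : Fin r → ℕ, (∀ i, K ≤ l i) → ∃ f : C.LocalRing, ∀ i, C.valuation i f = l i := by
  obtain ⟨γ, hγ, hd⟩ := C.exists_conductor_pullback
  have hfin : ∀ i, ∃ n : ℕ, IsDiscreteValuationRing.addVal (C.Normalization i) (γ i) = n :=
    fun i => (ENat.ne_top_iff_exists.1
      (mt IsDiscreteValuationRing.addVal_eq_top_iff.1 (hγ i))).imp fun n h => h.symm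
  choose n hn using hfin
  have hK : ∀ i, n i ≤ ∑ j, n j := fun i =>
    Finset.single_le_sum (f := n) (fun _ _ => Nat.zero_le _) (Finset.mem_univ i)
  refine ⟨∑ j, n j, fun f g hf hfg => ?_, fun l hl => ?_⟩
  · have h1 : ∀ i, ∃ d, C.pullback i g = C.pullback i f * (γ i * d) := by
      intro i
      have h2 : C.pullback i f * γ i ∣ C.pullback i g := by
        rw [← IsDiscreteValuationRing.addVal_le_iff_dvd, IsDiscreteValuationRing.addVal_mul, hn,
          ← valuation_eq_addVal, ← valuation_eq_addVal]
        refine le_trans ?_ (hfg i)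
        gcongr
        exact hK i
      obtain ⟨d, hd⟩ := h2
      exact ⟨d, by rw [hd, mul_assoc]⟩
    choose d hd' using h1
    obtain ⟨q, hq⟩ := hd d
    refine ⟨q, ?_⟩
    rw [← sub_eq_zero]
    refine C.eq_zero_of_pullback_eq_zero fun i => ?_
    rw [map_sub, map_mul, hq, hd' i, sub_self]
  · have h1 : ∀ i, ∃ d : C.Normalization i,
        IsDiscreteValuationRing.addVal (C.Normalization i) d = (l i - n i : ℕ) := by
      intro i
      obtain ⟨ϖ, hϖ⟩ := IsDiscreteValuationRing.exists_irreducible (C.Normalization i)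
      exact ⟨ϖ ^ (l i - n i), hϖ.addVal_pow _⟩
    choose d hd' using h1
    obtain ⟨f, hf⟩ := hd d
    refine ⟨f, fun i => ?_⟩
    rw [valuation_eq_addVal, hf, IsDiscreteValuationRing.addVal_mul, hn, hd']
    have := (hK i).trans (hl i)
    norm_cast
    omega

end ReducedCurveSingularity
end CurveLattice

namespace CurveLattice

/-! ### Dimension counts -/

section Dimension

variable {R : Type*} [CommRing R] [Algebra ℂ R]

theorem finite_and_finrank_eq_of_exact {U V W : Type*} [AddCommGroup U] [Module ℂ U]
    [AddCommGroup V] [Module ℂ V] [AddCommGroup W] [Module ℂ W] {φ : U →ₗ[ℂ] V} {ψ : V →ₗ[ℂ] W}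
    (hφ : Function.Injective φ) (hψ : Function.Surjective ψ)
    (h : Function.Exact φ ψ) [Module.Finite ℂ U] [Module.Finite ℂ W] :
    Module.Finite ℂ V ∧ Module.finrank ℂ V = Module.finrank ℂ U + Module.finrank ℂ W := by
  have hV : Module.Finite ℂ V := Module.Finite.of_exact h hψ
  refine ⟨hV, ?_⟩
  rw [← LinearMap.finrank_range_add_finrank_ker ψ, h.linearMap_ker_eq,
    LinearMap.finrank_range_of_inj hφ, LinearMap.range_eq_top.2 hψ, finrank_top, add_comm]

theorem finite_quotient_of_le {I J : Ideal R} (h : I ≤ J) [Module.Finite ℂ (R ⧸ I)] :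
    Module.Finite ℂ (R ⧸ J) :=
  Module.Finite.of_surjective (Ideal.Quotient.factorₐ ℂ h).toLinearMap
    (Ideal.Quotient.factor_surjective h)

theorem finrank_quotient_le_of_le {I J : Ideal R} (h : I ≤ J) [Module.Finite ℂ (R ⧸ I)] :
    Module.finrank ℂ (R ⧸ J) ≤ Module.finrank ℂ (R ⧸ I) :=
  LinearMap.finrank_le_finrank_of_surjective (f := (Ideal.Quotient.factorₐ ℂ h).toLinearMap)
    (Ideal.Quotient.factor_surjective h)

/-- The colength grows by one along an inclusion of ideals of codimension one. -/
theorem finrank_quotient_eq_add_one {I J : Ideal R} (hIJ : I ≤ J) {f : R} (hf : f ∈ J)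
    (hfI : f ∉ I) (hspan : ∀ g ∈ J, ∃ c : ℂ, g - c • f ∈ I) [Module.Finite ℂ (R ⧸ J)] :
    Module.Finite ℂ (R ⧸ I) ∧
      Module.finrank ℂ (R ⧸ I) = Module.finrank ℂ (R ⧸ J) + 1 := by
  have := finite_and_finrank_eq_of_exact
    (φ := LinearMap.toSpanSingleton ℂ (R ⧸ I) (Ideal.Quotient.mkₐ ℂ I f))
    (ψ := (Ideal.Quotient.factorₐ ℂ hIJ).toLinearMap) ?_
    (Ideal.Quotient.factor_surjective hIJ) ?_
  · rwa [Module.finrank_self, add_comm] at this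
  · rw [← LinearMap.ker_eq_bot, LinearMap.ker_toSpanSingleton]
    intro h
    exact hfI (Ideal.Quotient.eq_zero_iff_mem.1 h)
  · intro y
    obtain ⟨g, rfl⟩ := Ideal.Quotient.mkₐ_surjective ℂ I y
    have h1 : (Ideal.Quotient.factorₐ ℂ hIJ).toLinearMap (Ideal.Quotient.mkₐ ℂ I g) =
      Ideal.Quotient.mk J g := rfl
    rw [h1, Ideal.Quotient.eq_zero_iff_mem]
    constructor
    · intro hg
      obtain ⟨c, hc⟩ := hspan g hg
      refine ⟨c, ?_⟩
      rw [LinearMap.toSpanSingleton_apply, ← map_smul, eq_comm]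
      exact Ideal.Quotient.eq.2 hc
    · rintro ⟨c, hc⟩
      rw [LinearMap.toSpanSingleton_apply, ← map_smul] at hc
      have h2 := hIJ (Ideal.Quotient.eq.1 hc)
      rw [Algebra.smul_def] at h2
      have h3 := sub_mem (Ideal.mul_mem_left J (algebraMap ℂ R c) hf) h2
      simpa using h3

/-- Colengths add up for the product of an ideal with a principal ideal generated by a
nonzerodivisor. -/
theorem finrank_quotient_span_mul {x : R} (hx : ∀ g, x * g = 0 → g = 0) (J : Ideal R)
    [Module.Finite ℂ (R ⧸ Ideal.span {x})] [Module.Finite ℂ (R ⧸ J)] :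
    Module.Finite ℂ (R ⧸ (Ideal.span {x} * J)) ∧
      Module.finrank ℂ (R ⧸ (Ideal.span {x} * J)) =
        Module.finrank ℂ (R ⧸ J) + Module.finrank ℂ (R ⧸ Ideal.span {x}) := by
  have hle : Ideal.span {x} * J ≤ Ideal.span {x} := Ideal.mul_le_left
  let μ : R →ₗ[ℂ] R ⧸ (Ideal.span {x} * J) :=
    (Ideal.Quotient.mkₐ ℂ (Ideal.span {x} * J)).toLinearMap.comp (LinearMap.mulLeft ℂ x)
  have hμ : ∀ g, μ g = Ideal.Quotient.mk _ (x * g) := fun g => rfl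
  have hμ0 : ∀ g, μ g = 0 ↔ g ∈ J := by
    intro g
    rw [hμ, Ideal.Quotient.eq_zero_iff_mem, Ideal.mem_span_singleton_mul]
    constructor
    · rintro ⟨z, hz, e⟩
      have : g = z := by
        rw [← sub_eq_zero]
        exact hx _ (by rw [mul_sub, e, sub_self])
      rwa [this]
    · intro hg
      exact ⟨g, hg, rfl⟩
  let φ : (R ⧸ J) →ₗ[ℂ] R ⧸ (Ideal.span {x} * J) :=
    Submodule.liftQ (J.restrictScalars ℂ) μ fun g hg => (hμ0 g).2 hg
  have hφ : ∀ g, φ (Ideal.Quotient.mk J g) = μ g := fun g => rfl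
  refine finite_and_finrank_eq_of_exact (φ := φ)
    (ψ := (Ideal.Quotient.factorₐ ℂ hle).toLinearMap) ?_ (Ideal.Quotient.factor_surjective hle) ?_
  · rw [injective_iff_map_eq_zero]
    intro y hy
    obtain ⟨g, rfl⟩ := Ideal.Quotient.mk_surjective y
    rw [hφ, hμ0] at hy
    exact Ideal.Quotient.eq_zero_iff_mem.2 hy
  · intro y
    obtain ⟨g, rfl⟩ := Ideal.Quotient.mk_surjective y
    have h1 : (Ideal.Quotient.factorₐ ℂ hle).toLinearMap (Ideal.Quotient.mk _ g) =
      Ideal.Quotient.mk (Ideal.span {x}) g := rfl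
    rw [h1, Ideal.Quotient.eq_zero_iff_mem, Ideal.mem_span_singleton]
    constructor
    · rintro ⟨z, rfl⟩
      exact ⟨Ideal.Quotient.mk J z, rfl⟩
    · rintro ⟨y, hy⟩
      obtain ⟨z, rfl⟩ := Ideal.Quotient.mk_surjective y
      rw [hφ, hμ, Ideal.Quotient.eq] at hy
      have h2 := Ideal.mem_span_singleton.1 (hle hy)
      have h3 := dvd_sub (Dvd.intro z rfl) h2
      simpa using h3

end Dimension

namespace ReducedCurveSingularity

variable {N r : ℕ} (C : ReducedCurveSingularity N r)

/-! ### The Hilbert function -/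

theorem filtration_anti {l l' : Fin r → ℕ} (h : l ≤ l') : C.filtration l' ≤ C.filtration l :=
  fun _ hg i => le_trans (by exact_mod_cast h i) (hg i)

theorem filtration_zero : C.filtration 0 = ⊤ :=
  (Ideal.eq_top_iff_one _).2 fun i => by simp

theorem mem_filtration_add_single {l : Fin r → ℕ} {i : Fin r} {g : C.LocalRing} :
    g ∈ C.filtration (l + Pi.single i 1) ↔ g ∈ C.filtration l ∧ (l i : ℕ∞) < C.valuation i g := by
  constructor
  · intro h
    refine ⟨C.filtration_anti (by simp) h, ?_⟩
    have h1 := h i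
    rw [Pi.add_apply, Pi.single_eq_same] at h1
    exact lt_of_lt_of_le (by exact_mod_cast Nat.lt_succ_self _) h1
  · rintro ⟨h1, h2⟩ j
    by_cases hj : j = i
    · subst hj
      rw [Pi.add_apply, Pi.single_eq_same, Nat.cast_add, Nat.cast_one]
      exact Order.add_one_le_of_lt h2
    · rw [Pi.add_apply, Pi.single_eq_of_ne hj, add_zero]
      exact h1 j

theorem filtration_add_single_of_forall_ne {l : Fin r → ℕ} {i : Fin r}
    (h : ∀ f ∈ C.filtration l, C.valuation i f ≠ l i) :
    C.filtration (l + Pi.single i 1) = C.filtration l := by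
  refine le_antisymm (C.filtration_anti (by simp)) fun g hg => ?_
  exact C.mem_filtration_add_single.2 ⟨hg, lt_of_le_of_ne (hg i) (h g hg).symm⟩

theorem finrank_filtration_add_single {l : Fin r → ℕ} {i : Fin r} {f : C.LocalRing}
    (hf : f ∈ C.filtration l) (hfi : C.valuation i f = l i)
    [Module.Finite ℂ (C.LocalRing ⧸ C.filtration l)] :
    Module.Finite ℂ (C.LocalRing ⧸ C.filtration (l + Pi.single i 1)) ∧
      C.hilbert (l + Pi.single i 1) = C.hilbert l + 1 := by
  refine finrank_quotient_eq_add_one (C.filtration_anti (by simp)) hf ?_ ?_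
  · rw [mem_filtration_add_single, hfi]
    exact fun h => lt_irrefl _ h.2
  · intro g hg
    obtain ⟨c, hc⟩ := C.exists_smul_valuation_lt (i := i) (f := f) (g := g)
      (by rw [hfi]; exact ENat.natCast_ne_top _) (by rw [hfi]; exact hg i)
    refine ⟨c, C.mem_filtration_add_single.2 ⟨?_, by rwa [hfi] at hc⟩⟩
    exact sub_mem hg (by rw [Algebra.smul_def]; exact Ideal.mul_mem_left _ _ hf)

/-- Induction on lattice points by unit steps. -/
theorem latticeInduction {P : (Fin r → ℕ) → Prop} (h0 : P 0)
    (hstep : ∀ l i, P l → P (l + Pi.single i 1)) (l : Fin r → ℕ) : P l := by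
  generalize hn : ∑ i, l i = n
  induction n generalizing l with
  | zero =>
    have : l = 0 := by
      funext i
      exact (Finset.sum_eq_zero_iff.1 hn) i (Finset.mem_univ i)
    rwa [this]
  | succ n ih =>
    obtain ⟨i, -, hi⟩ : ∃ i ∈ Finset.univ, l i ≠ 0 := by
      by_contra! h
      rw [Finset.sum_eq_zero h] at hn
      omega
    have h1 : l - (Pi.single i 1 : Fin r → ℕ) + Pi.single i 1 = l := by
      refine tsub_add_cancel_of_le (a := (Pi.single i 1 : Fin r → ℕ)) fun j => ?_
      by_cases hj : j = i
      · subst hj; simpa using Nat.one_le_iff_ne_zero.2 hi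
      · simp [Pi.single_eq_of_ne hj]
    rw [← h1]
    refine hstep _ _ (ih _ ?_)
    have h2 : ∑ j, l j = ∑ j, (l - Pi.single i 1 + Pi.single i 1 : Fin r → ℕ) j := by rw [h1]
    simp only [Pi.add_apply, Finset.sum_add_distrib, Finset.sum_pi_single', Finset.mem_univ,
      if_true] at h2
    omega

instance finite_quotient_filtration (l : Fin r → ℕ) :
    Module.Finite ℂ (C.LocalRing ⧸ C.filtration l) := by
  induction l using latticeInduction with
  | h0 =>
    rw [filtration_zero]
    exact Module.Finite.of_finite
  | hstep l i ih =>
    by_cases h : ∃ f ∈ C.filtration l, C.valuation i f = l i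
    · obtain ⟨f, hf, hfi⟩ := h
      exact (C.finrank_filtration_add_single hf hfi).1
    · push Not at h
      rwa [C.filtration_add_single_of_forall_ne h]

theorem hilbert_zero : C.hilbert 0 = 0 := by
  rw [hilbert, filtration_zero]
  exact Module.finrank_zero_of_subsingleton

theorem hilbert_add_single {l : Fin r → ℕ} {i : Fin r} {f : C.LocalRing}
    (hf : f ∈ C.filtration l) (hfi : C.valuation i f = l i) :
    C.hilbert (l + Pi.single i 1) = C.hilbert l + 1 :=
  (C.finrank_filtration_add_single hf hfi).2

theorem hilbert_add_single_of_forall_ne {l : Fin r → ℕ} {i : Fin r}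
    (h : ∀ f ∈ C.filtration l, C.valuation i f ≠ l i) :
    C.hilbert (l + Pi.single i 1) = C.hilbert l := by
  rw [hilbert, hilbert, C.filtration_add_single_of_forall_ne h]

theorem weight_zero : C.weight 0 = 0 := by
  simp [weight, hilbert_zero]

theorem sum_add_single (l : Fin r → ℕ) (i : Fin r) :
    ∑ j, (((l + Pi.single i 1 : Fin r → ℕ) j : ℕ) : ℤ) = ∑ j, (l j : ℤ) + 1 := by
  have : ∑ j, (l + Pi.single i 1 : Fin r → ℕ) j = ∑ j, l j + 1 := by
    simp [Finset.sum_add_distrib]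
  exact_mod_cast this

theorem weight_add_single {l : Fin r → ℕ} {i : Fin r} {f : C.LocalRing}
    (hf : f ∈ C.filtration l) (hfi : C.valuation i f = l i) :
    C.weight (l + Pi.single i 1) = C.weight l + 1 := by
  rw [weight, weight, C.hilbert_add_single hf hfi, sum_add_single]
  push_cast
  ring

theorem weight_add_single_of_forall_ne {l : Fin r → ℕ} {i : Fin r}
    (h : ∀ f ∈ C.filtration l, C.valuation i f ≠ l i) :
    C.weight (l + Pi.single i 1) = C.weight l - 1 := by
  rw [weight, weight, C.hilbert_add_single_of_forall_ne h, sum_add_single]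
  ring

/-- Far from the coordinate hyperplanes the Hilbert function is affine. -/
theorem exists_hilbert_add : ∃ K : ℕ, ∀ l : Fin r → ℕ, (∀ i, K ≤ l i) → ∀ n : Fin r → ℕ,
    C.hilbert (l + n) = C.hilbert l + ∑ i, n i := by
  obtain ⟨K, -, hK⟩ := C.exists_conductor_exponent
  refine ⟨K, fun l hl n => ?_⟩
  induction n using latticeInduction with
  | h0 => simp
  | hstep n i ih =>
    obtain ⟨f, hf⟩ := hK (l + n) fun i => (hl i).trans (Nat.le_add_right _ _)
    rw [← add_assoc, C.hilbert_add_single (f := f) (fun j => (hf j).ge) (hf i), ih]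
    simp [Finset.sum_add_distrib, add_assoc]

/-! ### Generic elements of the maximal ideal -/

/-- The least valuation along the `i`-th branch of a germ vanishing at the origin; it is the
multiplicity of the branch. -/
noncomputable def branchOrder (i : Fin r) : ℕ :=
  sInf {n : ℕ | ∃ g ∈ C.maxIdeal, C.valuation i g = n}

theorem exists_valuation_eq_branchOrder (i : Fin r) :
    ∃ g ∈ C.maxIdeal, C.valuation i g = C.branchOrder i := by
  have hne : {n : ℕ | ∃ g ∈ C.maxIdeal, C.valuation i g = n}.Nonempty := by
    obtain ⟨K, -, hK⟩ := C.exists_conductor_exponent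
    obtain ⟨f, hf⟩ := hK (fun _ => K + 1) fun _ => Nat.le_succ K
    refine ⟨K + 1, f, ?_, hf i⟩
    rw [← C.one_le_valuation_iff i, hf i]
    exact_mod_cast Nat.le_add_left 1 K
  exact Nat.sInf_mem hne

theorem branchOrder_le {g : C.LocalRing} (hg : g ∈ C.maxIdeal) (i : Fin r) :
    (C.branchOrder i : ℕ∞) ≤ C.valuation i g := by
  by_cases h : C.valuation i g = ⊤
  · rw [h]; exact le_top
  · obtain ⟨n, hn⟩ := ENat.ne_top_iff_exists.1 h
    rw [← hn]
    exact_mod_cast Nat.sInf_le (s := {n : ℕ | ∃ g ∈ C.maxIdeal, C.valuation i g = n})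
      ⟨g, hg, hn.symm⟩

theorem branchOrder_pos (i : Fin r) : 1 ≤ C.branchOrder i := by
  obtain ⟨g, hg, h⟩ := C.exists_valuation_eq_branchOrder i
  rw [← C.one_le_valuation_iff i, h] at hg
  exact_mod_cast hg

/-- A generic germ vanishing at the origin has minimal valuation along all branches. -/
theorem exists_generic : ∃ x ∈ C.maxIdeal, ∀ i, C.valuation i x = C.branchOrder i := by
  classical
  suffices h : ∀ s : Finset (Fin r), ∃ x ∈ C.maxIdeal, ∀ i ∈ s,
      C.valuation i x = C.branchOrder i by
    obtain ⟨x, hx, h⟩ := h Finset.univ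
    exact ⟨x, hx, fun i => h i (Finset.mem_univ i)⟩
  intro s
  induction s using Finset.induction_on with
  | empty => exact ⟨0, zero_mem _, by simp⟩
  | insert j s hj ih =>
    obtain ⟨x, hx, hxs⟩ := ih
    obtain ⟨f, hf, hfj⟩ := C.exists_valuation_eq_branchOrder j
    have hmem : ∀ c : ℂ, x + c • f ∈ C.maxIdeal := fun c =>
      add_mem hx (by rw [Algebra.smul_def]; exact Ideal.mul_mem_left _ _ hf)
    -- for every branch at most one value of `c` is bad
    have hbad : ∀ i ∈ insert j s,
        {c : ℂ | C.valuation i (x + c • f) ≠ C.branchOrder i}.Subsingleton := by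
      intro i hi c hc c' hc'
      by_contra hne
      have h1 := Order.add_one_le_of_lt (lt_of_le_of_ne (C.branchOrder_le (hmem c) i) (Ne.symm hc))
      have h2 := Order.add_one_le_of_lt (lt_of_le_of_ne (C.branchOrder_le (hmem c') i) (Ne.symm hc'))
      have h3 := C.le_valuation_sub h1 h2
      rw [add_sub_add_left_eq_sub, ← sub_smul, C.valuation_smul i (sub_ne_zero.2 hne)] at h3
      have hcontra : ∀ {n : ℕ}, ¬ ((n : ℕ∞) + 1 ≤ n) := fun {n} h => by
        have : n + 1 ≤ n := by exact_mod_cast h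
        omega
      rcases Finset.mem_insert.1 hi with rfl | his
      · rw [hfj] at h3
        exact hcontra h3
      · have h4 := C.le_valuation_sub h1 (C.le_valuation_smul c h3)
        rw [add_sub_cancel_right, hxs i his] at h4
        exact hcontra h4
    have hfin : (⋃ i ∈ insert j s, {c : ℂ | C.valuation i (x + c • f) ≠ C.branchOrder i}).Finite :=
      Set.Finite.biUnion (Finset.finite_toSet _) fun i hi => (hbad i hi).finite
    obtain ⟨c, hc⟩ := hfin.exists_notMem
    refine ⟨x + c • f, hmem c, fun i hi => ?_⟩
    by_contra h
    exact hc (Set.mem_biUnion hi h)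

/-! ### The multiplicity -/

theorem multiplicity_eq_of_eventually {a : ℕ} {b : ℤ} (h : ∀ᶠ k : ℕ in Filter.atTop,
    (Module.finrank ℂ (C.LocalRing ⧸ C.maxIdeal ^ k) : ℤ) = a * k + b) : C.multiplicity = a := by
  have hset : {a : ℕ | ∃ b : ℤ, ∀ᶠ k : ℕ in Filter.atTop,
    (Module.finrank ℂ (C.LocalRing ⧸ C.maxIdeal ^ k) : ℤ) = a * k + b} = {a} := by
    refine Set.eq_singleton_iff_unique_mem.2 ⟨⟨b, h⟩, ?_⟩
    rintro a' ⟨b', h'⟩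
    obtain ⟨k, hk⟩ := Filter.eventually_atTop.1 (h.and h')
    have h1 := hk k le_rfl
    have h2 := hk (k + 1) (Nat.le_succ k)
    have h3 := h1.1.symm.trans h1.2
    have h4 := h2.1.symm.trans h2.2
    push_cast at h4
    have : (a' : ℤ) = a := by linear_combination h3 - h4
    exact_mod_cast this
  rw [multiplicity, hset, csInf_singleton]

section Generic

variable {C} {x : C.LocalRing} (hx : x ∈ C.maxIdeal) (hxv : ∀ i, C.valuation i x = C.branchOrder i)
include hxv

theorem eq_zero_of_generic_mul {g : C.LocalRing} (h : x * g = 0) : g = 0 := by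
  refine C.eq_zero_of_valuation_eq_top fun i => ?_
  have h1 : C.valuation i (x * g) = ⊤ := by
    rw [h, valuation_eq_addVal, map_zero, IsDiscreteValuationRing.addVal_zero]
  rw [valuation_mul, hxv] at h1
  simpa using h1

theorem exists_filtration_le_span_pow : ∃ K : ℕ, ∀ k : ℕ, ∀ l : Fin r → ℕ,
    (∀ i, k * C.branchOrder i + K ≤ l i) → C.filtration l ≤ Ideal.span {x ^ k} := by
  obtain ⟨K, hK, -⟩ := C.exists_conductor_exponent
  refine ⟨K, fun k l hl g hg => Ideal.mem_span_singleton.2 (hK _ _ (fun i => ?_) fun i => ?_)⟩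
  · rw [valuation_pow, hxv]
    exact_mod_cast ENat.natCast_ne_top (k * C.branchOrder i)
  · rw [valuation_pow, hxv]
    refine le_trans ?_ (hg i)
    exact_mod_cast hl i

theorem finite_quotient_span_generic_pow (k : ℕ) :
    Module.Finite ℂ (C.LocalRing ⧸ Ideal.span {x ^ k}) := by
  obtain ⟨K, hK⟩ := exists_filtration_le_span_pow hxv
  exact finite_quotient_of_le (hK k (fun i => k * C.branchOrder i + K) fun i => le_rfl)

theorem finite_quotient_span_generic : Module.Finite ℂ (C.LocalRing ⧸ Ideal.span {x}) := by
  have := finite_quotient_span_generic_pow hxv 1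
  rwa [pow_one] at this

/-- The colength of a generic germ is the intersection number of its zero divisor with the
curve. -/
theorem finrank_quotient_span_generic :
    Module.finrank ℂ (C.LocalRing ⧸ Ideal.span {x}) = ∑ i, C.branchOrder i := by
  obtain ⟨K, hK⟩ := exists_filtration_le_span_pow hxv
  obtain ⟨K', hK'⟩ := C.exists_hilbert_add
  let l : Fin r → ℕ := fun _ => max K K'
  have hfin : Module.Finite ℂ (C.LocalRing ⧸ Ideal.span {x}) :=
    finite_quotient_span_generic hxv
  have heq : Ideal.span {x} * C.filtration l = C.filtration (l + C.branchOrder) := by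
    refine le_antisymm ?_ fun g hg => ?_
    · rw [Ideal.span_singleton_mul_le_iff]
      intro g hg i
      rw [valuation_mul, hxv, Pi.add_apply, Nat.cast_add, add_comm]
      exact add_le_add le_rfl (hg i)
    · have h1 := hK 1 (l + C.branchOrder) (fun i => by
        simp only [Pi.add_apply, l]; have := le_max_left K K'; omega) hg
      rw [pow_one] at h1
      obtain ⟨q, rfl⟩ := Ideal.mem_span_singleton.1 h1
      refine Ideal.mem_span_singleton_mul.2 ⟨q, fun i => ?_, rfl⟩
      have h2 := hg i
      rw [valuation_mul, hxv, Pi.add_apply, Nat.cast_add, add_comm] at h2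
      exact (ENat.add_le_add_iff_left (ENat.natCast_ne_top _)).1 h2
  have h1 := (finrank_quotient_span_mul (fun g => eq_zero_of_generic_mul hxv)
    (C.filtration l)).2
  have h2 := hK' l (fun _ => le_max_right _ _) C.branchOrder
  rw [heq] at h1
  rw [hilbert, hilbert] at h2
  omega

include hx

theorem finite_quotient_maxIdeal_pow (k : ℕ) :
    Module.Finite ℂ (C.LocalRing ⧸ C.maxIdeal ^ k) := by
  have := finite_quotient_span_generic_pow hxv k
  refine finite_quotient_of_le (I := Ideal.span {x ^ k}) ?_
  rw [Ideal.span_singleton_le_iff_mem]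
  exact Ideal.pow_mem_pow hx k

end Generic

theorem maxIdeal_pow_le_filtration (k : ℕ) : C.maxIdeal ^ k ≤ C.filtration (k • C.branchOrder) := by
  induction k with
  | zero => rw [zero_smul, filtration_zero]; exact le_top
  | succ k ih =>
    rw [pow_succ]
    refine Ideal.mul_le.2 fun f hf g hg i => ?_
    rw [valuation_mul, succ_nsmul, Pi.add_apply, Nat.cast_add]
    exact add_le_add (ih hf i) (C.branchOrder_le hg i)

/-- The multiplicity of a curve is the sum of the multiplicities of its branches. -/
theorem multiplicity_eq_sum : C.multiplicity = ∑ i, C.branchOrder i := by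
  obtain ⟨x, hx, hxv⟩ := C.exists_generic
  obtain ⟨K, hK⟩ := C.exists_hilbert_add
  set a := ∑ i, C.branchOrder i with ha
  set g : ℕ → ℕ := fun k => Module.finrank ℂ (C.LocalRing ⧸ C.maxIdeal ^ k) with hg
  set h : ℕ → ℕ := fun k => C.hilbert (k • C.branchOrder) with hh
  have hfin := fun k => finite_quotient_maxIdeal_pow hx hxv k
  have hhg : ∀ k, h k ≤ g k := fun k =>
    finrank_quotient_le_of_le (C.maxIdeal_pow_le_filtration k)
  have hstep : ∀ k, K ≤ k → h (k + 1) = h k + a := by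
    intro k hk
    rw [hh]
    simp only [succ_nsmul]
    refine hK _ (fun i => ?_) _
    rw [Pi.smul_apply, smul_eq_mul]
    exact hk.trans (Nat.le_mul_of_pos_right k (C.branchOrder_pos i))
  have gstep : ∀ k, g (k + 1) ≤ g k + a := by
    intro k
    have hfin1 : Module.Finite ℂ (C.LocalRing ⧸ Ideal.span {x}) :=
      finite_quotient_span_generic hxv
    obtain ⟨h1, h2⟩ := finrank_quotient_span_mul (fun g => eq_zero_of_generic_mul hxv)
      (C.maxIdeal ^ k)
    rw [finrank_quotient_span_generic hxv] at h2
    rw [← ha] at h2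
    rw [hg]
    simp only
    rw [← h2]
    refine finrank_quotient_le_of_le ?_
    rw [pow_succ']
    exact Ideal.mul_mono_left ((Ideal.span_singleton_le_iff_mem _).2 hx)
  -- the nonincreasing sequence `g k - h k` becomes constant
  obtain ⟨k₀, hk₀, hmin⟩ : ∃ k₀, K ≤ k₀ ∧ ∀ k, K ≤ k → g k₀ - h k₀ ≤ g k - h k := by
    have hne : ((fun k => g k - h k) '' {k | K ≤ k}).Nonempty := 
      ⟨_, K, show K ≤ K from le_rfl, rfl⟩
    obtain ⟨k₀, h1, h2⟩ := Nat.sInf_mem hne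
    exact ⟨k₀, h1, fun k (hk : K ≤ k) => by
      have := Nat.sInf_le (s := (fun k => g k - h k) '' {k | K ≤ k}) ⟨k, hk, rfl⟩
      rw [← h2] at this
      exact this⟩
  have main : ∀ k, k₀ ≤ k → (g k : ℤ) = a * k + ((g k₀ : ℤ) - a * k₀) := by
    intro k hk
    induction k, hk using Nat.le_induction with
    | base => ring
    | succ k hk ih =>
      have h1 := hmin (k + 1) (by omega)
      have h2 := hmin k (by omega)
      have h3 := gstep k
      have h4 := hstep k (by omega)
      have h5 := hhg k
      have h6 := hhg (k + 1)
      have h7 := hhg k₀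
      have h8 : h k = h k₀ + a * (k - k₀) := by
        clear ih h1 h2 h3 h4 h5 h6 h7
        induction k, hk using Nat.le_induction with
        | base => simp
        | succ k hk ih =>
          rw [hstep k (by omega), ih, Nat.succ_sub hk, Nat.mul_succ, add_assoc]
      have h9 : g k = h k + (g k₀ - h k₀) := by
        zify [hk, h7] at h8 ⊢
        linear_combination ih - h8
      have : g (k + 1) = g k + a := by omega
      push_cast [this]
      linear_combination ih
  exact C.multiplicity_eq_of_eventually (Filter.eventually_atTop.2 ⟨k₀, main⟩)

/-! ### The weight function -/

theorem filtration_eq_maxIdeal {l : Fin r → ℕ} (hl : l ≤ C.branchOrder) {i : Fin r}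
    (hi : 1 ≤ l i) : C.filtration l = C.maxIdeal := by
  ext g
  constructor
  · intro hg
    rw [← C.one_le_valuation_iff i]
    exact le_trans (by exact_mod_cast hi) (hg i)
  · intro hg j
    exact le_trans (by exact_mod_cast hl j) (C.branchOrder_le hg j)

theorem weight_single (i : Fin r) : C.weight (Pi.single i 1) = 1 := by
  have h := C.weight_add_single (l := 0) (i := i) (f := 1) (by rw [filtration_zero]; trivial)
    (by rw [valuation_one]; rfl)
  rwa [zero_add, weight_zero, zero_add] at h

theorem weight_branchOrder : C.weight C.branchOrder = 2 - C.multiplicity := by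
  have i : Fin r := ⟨0, C.r_pos⟩
  have h1 := C.weight_single i
  have hle : Pi.single i 1 ≤ C.branchOrder := fun j => by
    by_cases hj : j = i
    · subst hj; simpa using C.branchOrder_pos j
    · simp [Pi.single_eq_of_ne hj]
  have h2 : C.hilbert C.branchOrder = C.hilbert (Pi.single i 1) := by
    rw [hilbert, hilbert, C.filtration_eq_maxIdeal le_rfl (C.branchOrder_pos i),
      C.filtration_eq_maxIdeal hle (i := i) (by simp)]
  have h3 := sum_add_single 0 i
  simp only [zero_add, Pi.zero_apply, Nat.cast_zero, Finset.sum_const_zero] at h3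
  rw [weight, h3] at h1
  rw [weight, h2, multiplicity_eq_sum]
  push_cast
  linarith

theorem weight_add_single_eq (l : Fin r → ℕ) (i : Fin r) :
    C.weight (l + Pi.single i 1) = C.weight l + 1 ∨
      C.weight (l + Pi.single i 1) = C.weight l - 1 := by
  by_cases h : ∃ f ∈ C.filtration l, C.valuation i f = l i
  · obtain ⟨f, hf, hfi⟩ := h
    exact Or.inl (C.weight_add_single hf hfi)
  · push Not at h
    exact Or.inr (C.weight_add_single_of_forall_ne h)

theorem one_le_multiplicity : 1 ≤ C.multiplicity := by
  rw [multiplicity_eq_sum]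
  exact (C.branchOrder_pos ⟨0, C.r_pos⟩).trans
    (Finset.single_le_sum (f := C.branchOrder) (fun _ _ => Nat.zero_le _) (Finset.mem_univ _))

theorem r_le_multiplicity : r ≤ C.multiplicity := by
  rw [multiplicity_eq_sum]
  calc r = ∑ _i : Fin r, 1 := by simp
    _ ≤ _ := Finset.sum_le_sum fun i _ => C.branchOrder_pos i

/-- A walk on `ℕ` with steps `±1`, upwards at even times, and at odd times upwards from some
time on. -/
theorem walk_nonneg_and_le {W : ℕ → ℤ} {up : ℕ → Prop} (h0 : W 0 = 0)
    (hup : ∀ a, up a → W (a + 1) = W a + 1) (hdown : ∀ a, ¬ up a → W (a + 1) = W a - 1)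
    (heven : ∀ a, up (2 * a)) (hmono : ∀ a, up a → up (a + 2)) :
    (∀ a, 0 ≤ W a) ∧ ∀ a b, a ≤ b → W a ≤ max (W b) 1 := by
  have hd : ∀ k, ¬ up (2 * k + 1) → W (2 * k + 1) = 1 := by
    intro k
    induction k with
    | zero => intro _; have := hup 0 (heven 0); simpa [h0] using this
    | succ k ih =>
      intro hk
      have h1 : ¬ up (2 * k + 1) := fun h => hk (hmono _ h)
      have h2 := ih h1
      have h3 := hdown _ h1
      have h4 := hup _ (heven (k + 1))
      have e : 2 * (k + 1) = 2 * k + 1 + 1 := by ring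
      rw [e] at h4 ⊢
      omega
  constructor
  · have h2 : ∀ k, 0 ≤ W (2 * k) := by
      intro k
      induction k with
      | zero => simp [h0]
      | succ k ih =>
        have h1 := hup _ (heven k)
        have e : 2 * (k + 1) = 2 * k + 1 + 1 := by ring
        rw [e]
        by_cases h : up (2 * k + 1)
        · have := hup _ h; omega
        · have := hdown _ h; omega
    intro a
    obtain ⟨k, rfl | rfl⟩ := Nat.even_or_odd' a
    · exact h2 k
    · have := hup _ (heven k); have := h2 k; omega
  · intro a b hab
    induction b, hab using Nat.le_induction with
    | base => exact le_max_left _ _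
    | succ b _ ih =>
      by_cases h : up b
      · have := hup _ h; omega
      · obtain ⟨k, rfl | rfl⟩ := Nat.even_or_odd' b
        · exact absurd (heven k) h
        · have := hd k h; omega

theorem add_single_fin_one (a : ℕ) : (fun _ : Fin 1 => a) + Pi.single 0 1 = fun _ => a + 1 := by
  ext i
  rw [Subsingleton.elim i 0]
  simp

/-- The weight function of an irreducible germ of multiplicity at most two. -/
theorem weight_fin_one (C : ReducedCurveSingularity N 1) (h : C.branchOrder 0 ≤ 2) :
    (∀ l, 0 ≤ C.weight l) ∧
      ∀ l l' : Fin 1 → ℕ, l ≤ l' → C.weight l ≤ max (C.weight l') 1 := by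
  obtain ⟨x, hx, hxv⟩ := C.exists_generic
  have hmul : ∀ {f a}, f ∈ C.filtration (fun _ => a) → C.valuation 0 f = a → ∀ k : ℕ,
      x ^ k * f ∈ C.filtration (fun _ => a + k * C.branchOrder 0) ∧
      C.valuation 0 (x ^ k * f) = (a + k * C.branchOrder 0 : ℕ) := by
    intro f a _ hfa k
    have h1 : C.valuation 0 (x ^ k * f) = (a + k * C.branchOrder 0 : ℕ) := by
      rw [valuation_mul, valuation_pow, hxv, hfa, add_comm]
      push_cast
      rfl
    refine ⟨fun i => ?_, h1⟩
    rw [Subsingleton.elim i 0, h1]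
  have hb : C.branchOrder 0 ∣ 2 := by
    have := C.branchOrder_pos 0
    interval_cases C.branchOrder 0 <;> decide
  obtain ⟨m, hm⟩ := hb
  have key := walk_nonneg_and_le (W := fun a => C.weight fun _ => a)
    (up := fun a => ∃ f ∈ C.filtration (fun _ => a), C.valuation 0 f = a)
    C.weight_zero (fun a ⟨f, hf, hfa⟩ => by
      rw [← add_single_fin_one]; exact C.weight_add_single hf hfa)
    (fun a ha => by
      rw [← add_single_fin_one]
      exact C.weight_add_single_of_forall_ne fun f hf hfa => ha ⟨f, hf, hfa⟩)
    (fun a => ⟨_, by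
      have := hmul (f := 1) (a := 0) (by exact C.filtration_zero ▸ trivial)
        (by rw [valuation_one]; rfl) (a * m)
      have e : 0 + a * m * C.branchOrder 0 = 2 * a := by rw [hm]; ring
      rwa [e] at this⟩)
    (fun a ⟨f, hf, hfa⟩ => ⟨_, by
      have := hmul hf hfa m
      have e : a + m * C.branchOrder 0 = a + 2 := by rw [hm]; ring
      rwa [e] at this⟩)
  have hl : ∀ l : Fin 1 → ℕ, l = fun _ => l 0 := fun l => by
    ext i; rw [Subsingleton.elim i 0]
  refine ⟨fun l => ?_, fun l l' hll => ?_⟩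
  · rw [hl l]; exact key.1 _
  · rw [hl l, hl l']; exact key.2 _ _ (hll 0)

theorem add_single_zero_fin_two (a b : ℕ) :
    (![a, b] : Fin 2 → ℕ) + Pi.single 0 1 = ![a + 1, b] := by
  ext i; fin_cases i <;> simp

theorem add_single_one_fin_two (a b : ℕ) :
    (![a, b] : Fin 2 → ℕ) + Pi.single 1 1 = ![a, b + 1] := by
  ext i; fin_cases i <;> simp

theorem vec_mem_filtration (C : ReducedCurveSingularity N 2) {a b : ℕ} {f : C.LocalRing} :
    f ∈ C.filtration ![a, b] ↔ (a : ℕ∞) ≤ C.valuation 0 f ∧ (b : ℕ∞) ≤ C.valuation 1 f := by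
  rw [mem_filtration, Fin.forall_fin_two]
  rfl

/-- The weight function of two smooth branches: it is determined by its values `d` on the
diagonal, and `d` vanishes up to some point and then grows by two at each step. -/
theorem weight_fin_two (C : ReducedCurveSingularity N 2) (h : ∀ i, C.branchOrder i = 1) :
    ∃ d : ℕ → ℤ, d 0 = 0 ∧ (∀ a, d (a + 1) = d a + 2 ∨ (d a = 0 ∧ d (a + 1) = 0)) ∧
      ∀ a k, C.weight ![a, a + k] = d a + k ∧ C.weight ![a + k, a] = d a + k := by
  obtain ⟨x, hx, hxv⟩ := C.exists_generic
  have hxp : ∀ (k : ℕ) i, C.valuation i (x ^ k) = k := fun k i => by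
    rw [valuation_pow, hxv, h]; simp
  have hr : ∀ a b, a ≤ b → C.weight ![a, b + 1] = C.weight ![a, b] + 1 := by
    intro a b hab
    rw [← add_single_one_fin_two]
    refine C.weight_add_single (f := x ^ b) (C.vec_mem_filtration.2 ?_) (hxp b 1)
    rw [hxp, hxp]
    exact ⟨by exact_mod_cast hab, le_rfl⟩
  have hl : ∀ a b, b ≤ a → C.weight ![a + 1, b] = C.weight ![a, b] + 1 := by
    intro a b hab
    rw [← add_single_zero_fin_two]
    refine C.weight_add_single (f := x ^ a) (C.vec_mem_filtration.2 ?_) (hxp a 0)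
    rw [hxp, hxp]
    exact ⟨le_rfl, by exact_mod_cast hab⟩
  have h00 : C.weight ![0, 0] = 0 := by
    have : (![0, 0] : Fin 2 → ℕ) = 0 := by ext i; fin_cases i <;> rfl
    rw [this, weight_zero]
  let up : ℕ → Prop := fun a => ∃ f ∈ C.filtration ![a + 1, a], C.valuation 1 f = a
  have hup : ∀ a, up a → C.weight ![a + 1, a + 1] = C.weight ![a, a] + 2 := by
    rintro a ⟨f, hf, hfa⟩
    have h1 := C.weight_add_single hf hfa
    rw [add_single_one_fin_two, hl a a le_rfl] at h1
    rw [h1]; ring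
  have hdown : ∀ a, ¬ up a → C.weight ![a + 1, a + 1] = C.weight ![a, a] := by
    intro a ha
    have h1 := C.weight_add_single_of_forall_ne (l := ![a + 1, a]) (i := 1)
      fun f hf hfa => ha ⟨f, hf, hfa⟩
    rw [add_single_one_fin_two, hl a a le_rfl] at h1
    rw [h1]; ring
  have hmono : ∀ a, up a → up (a + 1) := by
    rintro a ⟨f, hf, hfa⟩
    rw [vec_mem_filtration] at hf
    have e : ∀ i, C.valuation i (x * f) = 1 + C.valuation i f := fun i => by
      rw [valuation_mul, hxv, h]; rfl
    refine ⟨x * f, C.vec_mem_filtration.2 ⟨?_, ?_⟩, ?_⟩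
    · rw [e]
      calc ((a + 1 + 1 : ℕ) : ℕ∞) = 1 + ((a + 1 : ℕ) : ℕ∞) := by push_cast; ring
        _ ≤ _ := by gcongr; exact hf.1
    · rw [e, hfa]
      push_cast
      exact le_of_eq (add_comm _ _)
    · rw [e, hfa]
      push_cast
      exact add_comm _ _
  have hzero : ∀ a, ¬ up a → C.weight ![a, a] = 0 := by
    intro a
    induction a with
    | zero => intro _; exact h00
    | succ a ih =>
      intro ha
      have h1 : ¬ up a := fun h => ha (hmono a h)
      rw [hdown a h1, ih h1]
  refine ⟨fun a => C.weight ![a, a], h00, fun a => ?_, fun a k => ?_⟩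
  · by_cases hu : up a
    · exact Or.inl (hup a hu)
    · exact Or.inr ⟨hzero a hu, (hdown a hu).trans (hzero a hu)⟩
  · induction k with
    | zero => simp
    | succ k ih =>
      rw [← add_assoc, hr _ _ (Nat.le_add_right _ _), hl _ _ (Nat.le_add_right _ _), ih.1, ih.2]
      push_cast
      constructor <;> ring

/-- For germs of multiplicity at most two the sublevel sets at positive levels are stable under
truncating the coordinates, here in terms of the vertices of a cube `[L, U]` and of its
truncation at a height between `c` and `c + 1`. -/
theorem weight_nonneg_and_truncation (h : C.multiplicity ≤ 2) :
    (∀ l, 0 ≤ C.weight l) ∧ ∀ n : ℤ, 1 ≤ n → ∀ L U l : Fin r → ℕ, ∀ c : ℕ, L ≤ U →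
      (∀ l', L ≤ l' → l' ≤ U → C.weight l' ≤ n) →
      (∀ i, min (L i) c ≤ l i) → (∀ i, l i ≤ min (U i) (c + 1)) → C.weight l ≤ n := by
  have h1 := C.r_le_multiplicity
  have h2 := C.r_pos
  have h3 := C.multiplicity_eq_sum
  obtain rfl | rfl : r = 1 ∨ r = 2 := by omega
  · have h4 : C.branchOrder 0 ≤ 2 := by
      rw [h3] at h; simpa using h
    obtain ⟨h5, h6⟩ := C.weight_fin_one h4
    refine ⟨h5, fun n hn L U l c hLU hw _ hl => ?_⟩
    refine (h6 l U fun i => (hl i).trans (min_le_left _ _)).trans (max_le (hw U hLU le_rfl) hn)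
  · have h4 : ∀ i, C.branchOrder i = 1 := by
      rw [h3, Fin.sum_univ_two] at h
      have := C.branchOrder_pos 0
      have := C.branchOrder_pos 1
      rw [Fin.forall_fin_two]
      omega
    obtain ⟨d, hd0, hd, hW⟩ := C.weight_fin_two h4
    have hdpos : ∀ a, 0 ≤ d a := by
      intro a
      induction a with
      | zero => exact hd0.ge
      | succ a ih => have := hd a; omega
    have hdmono : Monotone d := monotone_nat_of_le_succ fun a => by
      have := hd a; omega
    have hW' : ∀ a b, C.weight ![a, b] = d (min a b) + (max a b - min a b : ℕ) := by
      intro a b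
      rcases le_total a b with hab | hab
      · obtain ⟨k, rfl⟩ := Nat.exists_eq_add_of_le hab
        rw [(hW a k).1]; simp
      · obtain ⟨k, rfl⟩ := Nat.exists_eq_add_of_le hab
        rw [(hW b k).2]; simp
    have hvec : ∀ l : Fin 2 → ℕ, l = ![l 0, l 1] := fun l => by
      ext i; fin_cases i <;> rfl
    refine ⟨fun l => ?_, fun n hn L U l c hLU hw hl1 hl2 => ?_⟩
    · rw [hvec l, hW']
      have := hdpos (min (l 0) (l 1))
      omega
    have hw' : ∀ α β, L 0 ≤ α → α ≤ U 0 → L 1 ≤ β → β ≤ U 1 →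
        d (min α β) + (max α β - min α β : ℕ) ≤ n := by
      intro α β a1 a2 a3 a4
      rw [← hW']
      refine hw _ ?_ ?_ <;> rw [Pi.le_def, Fin.forall_fin_two]
      · exact ⟨a1, a3⟩
      · exact ⟨a2, a4⟩
    rw [hvec l, hW']
    have l0 := hl1 0
    have l1 := hl1 1
    have u0 := hl2 0
    have u1 := hl2 1
    have LU0 : L 0 ≤ U 0 := hLU 0
    have LU1 : L 1 ≤ U 1 := hLU 1
    generalize l 0 = α at *
    generalize l 1 = β at *
    have hU := hw' (U 0) (U 1) LU0 le_rfl LU1 le_rfl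
    rcases lt_trichotomy α β with hab | rfl | hab
    · rw [min_eq_left hab.le, max_eq_right hab.le]
      by_cases hL : L 0 ≤ α
      · have := hw' α (U 1) hL (by omega) LU1 le_rfl
        rw [min_eq_left (by omega), max_eq_right (by omega)] at this
        omega
      · have e : β = α + 1 := by omega
        have h7 : d (α + 1) ≤ d (min (U 0) (U 1)) := hdmono (by omega)
        have := hd α
        omega
    · have h7 : d α ≤ d (min (U 0) (U 1)) := hdmono (by omega)
      simp only [min_self, max_self]
      omega
    · rw [min_eq_right hab.le, max_eq_left hab.le]
      by_cases hL : L 1 ≤ β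
      · have := hw' (U 0) β LU0 le_rfl hL (by omega)
        rw [min_eq_right (by omega), max_eq_left (by omega)] at this
        omega
      · have e : α = β + 1 := by omega
        have h7 : d (β + 1) ≤ d (min (U 0) (U 1)) := hdmono (by omega)
        have := hd β
        omega

end ReducedCurveSingularity
end CurveLattice

namespace CurveLattice

/-! ### Contractions and singular cohomology -/

section Contraction

/-- The map `[0, 1] × Δ^q → Δ^(q+1)` exhibiting the simplex as a cone over its zeroth face; the apex
is the image of `{1} × Δ^q`. -/
def coneMap (q : ℕ) :
    C(unitInterval × stdSimplex ℝ (Fin (q + 1)), stdSimplex ℝ (Fin (q + 2))) where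
  toFun p := ⟨Fin.cons (p.1 : ℝ) fun i => (1 - (p.1 : ℝ)) * p.2 i, by
    refine ⟨fun i => ?_, ?_⟩
    · refine Fin.cases ?_ (fun i => ?_) i
      · simpa using p.1.2.1
      · simp only [Fin.cons_succ]
        exact mul_nonneg (sub_nonneg.mpr p.1.2.2) (p.2.2.1 i)
    · have h : ∑ i, p.2 i = 1 := p.2.2.2
      rw [Fin.sum_univ_succ]
      simp [← Finset.mul_sum, h]⟩
  continuous_toFun := by
    refine Continuous.subtype_mk (continuous_pi fun i => ?_) _
    refine Fin.cases ?_ (fun i => ?_) i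
    · simp only [Fin.cons_zero]
      exact continuous_subtype_val.comp continuous_fst
    · simp only [Fin.cons_succ]
      have h : Continuous fun p : unitInterval × stdSimplex ℝ (Fin (q + 1)) => p.2 i :=
        (continuous_apply i).comp (continuous_subtype_val.comp continuous_snd)
      exact (continuous_const.sub (continuous_subtype_val.comp continuous_fst)).mul h

theorem coneMap_zero (q : ℕ) (p : unitInterval × stdSimplex ℝ (Fin (q + 1))) :
    coneMap q p 0 = (p.1 : ℝ) := rfl

theorem coneMap_succ (q : ℕ) (p : unitInterval × stdSimplex ℝ (Fin (q + 1))) (i : Fin (q + 1)) :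
    coneMap q p i.succ = (1 - (p.1 : ℝ)) * p.2 i := rfl

theorem coneMap_surjective (q : ℕ) : Function.Surjective (coneMap q) := by
  intro v
  have hs : v 0 + ∑ i : Fin (q + 1), v i.succ = 1 := by
    rw [← Fin.sum_univ_succ]; exact v.2.2
  have hv : ∀ i, 0 ≤ v i := v.2.1
  have hsum : 0 ≤ ∑ i : Fin (q + 1), v i.succ := Finset.sum_nonneg fun i _ => hv _
  rcases eq_or_lt_of_le (show v 0 ≤ 1 by linarith) with h1 | h1
  · refine ⟨(1, Classical.arbitrary _), ?_⟩
    have h0 : ∑ i : Fin (q + 1), v i.succ = 0 := by linarith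
    rw [Finset.sum_eq_zero_iff_of_nonneg fun i _ => hv _] at h0
    ext i
    refine Fin.cases ?_ (fun i => ?_) i
    · rw [coneMap_zero]; simp [h1]
    · rw [coneMap_succ, h0 i (Finset.mem_univ _)]; simp
  · have hne : 1 - v 0 ≠ 0 := by linarith
    refine ⟨(⟨v 0, hv 0, h1.le⟩, ⟨fun i => v i.succ / (1 - v 0), fun i =>
      div_nonneg (hv _) (by linarith), ?_⟩), ?_⟩
    · rw [← Finset.sum_div, div_eq_one_iff_eq hne]; linarith
    · ext i
      refine Fin.cases ?_ (fun i => ?_) i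
      · rw [coneMap_zero]
      · rw [coneMap_succ]
        change (1 - v 0) * (v i.succ / (1 - v 0)) = _
        field_simp

theorem coneMap_eq_iff {q : ℕ} {p p' : unitInterval × stdSimplex ℝ (Fin (q + 1))}
    (h : coneMap q p = coneMap q p') : p.1 = p'.1 ∧ (p.1 = 1 ∨ p.2 = p'.2) := by
  have h1 : p.1 = p'.1 := by
    ext
    rw [← coneMap_zero, ← coneMap_zero, h]
  refine ⟨h1, or_iff_not_imp_left.mpr fun hne => ?_⟩
  ext i
  have h2 : (1 - (p.1 : ℝ)) * p.2 i = (1 - (p'.1 : ℝ)) * p'.2 i := by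
    rw [← coneMap_succ, ← coneMap_succ, h]
  rw [← h1] at h2
  refine mul_left_cancel₀ (fun h0 => hne ?_) h2
  ext
  simp only [Set.Icc.coe_one]
  linarith

theorem isQuotientMap_coneMap (q : ℕ) : Topology.IsQuotientMap (coneMap q) :=
  (coneMap q).continuous.isClosedMap.isQuotientMap (coneMap q).continuous (coneMap_surjective q)

variable {X : Type} [TopologicalSpace X]

/-- A family of simplices parametrized by `[0, 1]` and constant at time `1` is a simplex of one
dimension more. -/
theorem exists_cone {q : ℕ} (h : C(unitInterval × stdSimplex ℝ (Fin (q + 1)), X))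
    (h1 : ∀ u u', h (1, u) = h (1, u')) :
    ∃ τ : SingularSimplex X (q + 1), ∀ s u, τ (coneMap q (s, u)) = h (s, u) := by
  have hf : Function.FactorsThrough h (coneMap q) := by
    intro p p' hp
    obtain ⟨a, b⟩ := coneMap_eq_iff hp
    obtain ⟨s, u⟩ := p
    obtain ⟨s', u'⟩ := p'
    obtain rfl : s = s' := a
    rcases b with b | b
    · obtain rfl : s = 1 := b
      exact h1 _ _
    · obtain rfl : u = u' := b
      rfl
  exact ⟨(isQuotientMap_coneMap q).lift h hf, fun s u =>
    DFunLike.congr_fun ((isQuotientMap_coneMap q).lift_comp h hf) (s, u)⟩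

theorem stdSimplex_map_succAbove_apply {q : ℕ} (j : Fin (q + 2))
    (u : stdSimplex ℝ (Fin (q + 1))) (i : Fin (q + 2)) :
    stdSimplex.map j.succAbove u i = (Fin.insertNth j 0 (u : Fin (q + 1) → ℝ) : Fin (q + 2) → ℝ) i := by
  classical
  change FunOnFinite.linearMap ℝ ℝ j.succAbove u i = _
  rw [FunOnFinite.linearMap_apply_apply]
  refine Fin.succAboveCases j ?_ (fun k => ?_) i
  · rw [Fin.insertNth_apply_same]
    refine Finset.sum_eq_zero fun k hk => ?_
    exact absurd (Finset.mem_filter.mp hk).2 (Fin.succAbove_ne j k)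
  · rw [Fin.insertNth_apply_succAbove]
    have : Finset.univ.filter (fun a => j.succAbove a = j.succAbove k) = {k} := by
      ext a; simp
    rw [this, Finset.sum_singleton]

theorem stdSimplex_map_succAbove_zero {q : ℕ} (u : stdSimplex ℝ (Fin (q + 1))) :
    stdSimplex.map (Fin.succAbove 0) u = coneMap q (0, u) := by
  ext i
  rw [stdSimplex_map_succAbove_apply]
  refine Fin.cases ?_ (fun i => ?_) i
  · rw [coneMap_zero]; simp
  · rw [coneMap_succ]; simp

theorem stdSimplex_map_succAbove_succ {q : ℕ} (j : Fin (q + 2)) (s : unitInterval)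
    (u : stdSimplex ℝ (Fin (q + 1))) :
    stdSimplex.map j.succ.succAbove (coneMap q (s, u)) =
      coneMap (q + 1) (s, stdSimplex.map j.succAbove u) := by
  ext i
  rw [stdSimplex_map_succAbove_apply]
  refine Fin.cases ?_ (fun i => ?_) i
  · rw [coneMap_zero, ← Fin.succ_succAbove_zero j, Fin.insertNth_apply_succAbove, coneMap_zero]
  · rw [coneMap_succ, stdSimplex_map_succAbove_apply]
    refine Fin.succAboveCases j ?_ (fun k => ?_) i
    · simp
    · rw [Fin.insertNth_apply_succAbove, ← Fin.succ_succAbove_succ, Fin.insertNth_apply_succAbove,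
        coneMap_succ]

theorem stdSimplex_map_succAbove_one (u u' : stdSimplex ℝ (Fin 1)) :
    stdSimplex.map (Fin.succAbove (1 : Fin 2)) u = coneMap 0 (1, u') := by
  ext i
  have hu : u 0 = 1 := by
    have := u.2.2
    rwa [Fin.sum_univ_one] at this
  rw [stdSimplex_map_succAbove_apply]
  fin_cases i
  · change _ = coneMap 0 (1, u') 0
    rw [coneMap_zero, show (⟨0, by omega⟩ : Fin 2) = Fin.succAbove 1 0 from rfl,
      Fin.insertNth_apply_succAbove, hu]
    rfl
  · change _ = coneMap 0 (1, u') (Fin.succ 0)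
    rw [coneMap_succ]
    simp [show (⟨1, by omega⟩ : Fin 2) = 1 from rfl]

/-- The cone operator of a homotopy `G` that makes all simplices constant: the zeroth face of the
cone over `σ` is `σ`, and its other faces are the cones over the faces of `σ`. The homotopy is only
assumed to be continuous along simplices. -/
theorem exists_coneOperator (G : unitInterval → X → X) (hG0 : ∀ x, G 0 x = x)
    (hGc : ∀ (q : ℕ) (σ : SingularSimplex X q),
      Continuous fun p : unitInterval × stdSimplex ℝ (Fin (q + 1)) => G p.1 (σ p.2))
    (hG1 : ∀ (q : ℕ) (σ : SingularSimplex X q) u u', G 1 (σ u) = G 1 (σ u')) :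
    ∃ K : ∀ q, SingularSimplex X q → SingularSimplex X (q + 1),
      (∀ q σ s u, K q σ (coneMap q (s, u)) = G s (σ u)) ∧
      (∀ q σ, (K q σ).face 0 = σ) ∧
      ∀ q σ j, (K (q + 1) σ).face (Fin.succ j) = K q (σ.face j) := by
  have key : ∀ q (σ : SingularSimplex X q), ∃ τ : SingularSimplex X (q + 1),
      ∀ s u, τ (coneMap q (s, u)) = G s (σ u) := fun q σ =>
    exists_cone ⟨fun p => G p.1 (σ p.2), hGc q σ⟩ (hG1 q σ)
  choose K hK using key
  refine ⟨K, hK, fun q σ => ?_, fun q σ j => ?_⟩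
  · ext u
    change K q σ (stdSimplex.map (Fin.succAbove 0) u) = _
    rw [stdSimplex_map_succAbove_zero, hK, hG0]
  · ext v
    obtain ⟨⟨s, u⟩, rfl⟩ := coneMap_surjective q v
    change K (q + 1) σ (stdSimplex.map j.succ.succAbove (coneMap q (s, u))) = _
    rw [stdSimplex_map_succAbove_succ, hK, hK]
    rfl

theorem subsingleton_quotient_addSubgroupOf {A : Type} [AddCommGroup A] {H K : AddSubgroup A}
    (h : K ≤ H) : Subsingleton (K ⧸ H.addSubgroupOf K) := by
  rw [AddSubgroup.addSubgroupOf_eq_top.mpr h]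
  exact QuotientAddGroup.subsingleton_quotient_top

theorem le_of_subsingleton_quotient_addSubgroupOf {A : Type} [AddCommGroup A] {H K : AddSubgroup A}
    (h : Subsingleton (K ⧸ H.addSubgroupOf K)) : K ≤ H :=
  AddSubgroup.addSubgroupOf_eq_top.mp (QuotientAddGroup.subsingleton_iff.mp h)

/-- If a homotopy makes all simplices constant, then the cone operator is a contracting homotopy in
positive degrees: a cocycle `φ` is the coboundary of `τ ↦ φ(cone τ)`. The space need not be
contractible, as its components may be contracted to different points. -/
theorem subsingleton_cohomology_succ (G : unitInterval → X → X) (hG0 : ∀ x, G 0 x = x)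
    (hGc : ∀ (q : ℕ) (σ : SingularSimplex X q),
      Continuous fun p : unitInterval × stdSimplex ℝ (Fin (q + 1)) => G p.1 (σ p.2))
    (hG1 : ∀ (q : ℕ) (σ : SingularSimplex X q) u u', G 1 (σ u) = G 1 (σ u')) (q : ℕ) :
    Subsingleton (Cohomology X (q + 1)) := by
  obtain ⟨K, -, hK0, hK⟩ := exists_coneOperator G hG0 hGc hG1
  refine subsingleton_quotient_addSubgroupOf fun φ hφ => ?_
  refine ⟨fun τ => φ (K q τ), funext fun σ => ?_⟩
  have h : ∑ j : Fin (q + 1 + 2), (-1 : ℤ) ^ (j : ℕ) * φ ((K (q + 1) σ).face j) = 0 :=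
    congrFun hφ (K (q + 1) σ)
  rw [Fin.sum_univ_succ, hK0] at h
  simp only [hK, Fin.val_succ, pow_succ, Fin.val_zero, pow_zero, one_mul, mul_neg_one, neg_mul,
    Finset.sum_neg_distrib] at h
  change ∑ j : Fin (q + 2), (-1 : ℤ) ^ (j : ℕ) * φ (K q (σ.face j)) = φ σ
  linarith

theorem subsingleton_reducedCohomology_zero (G : unitInterval → X → X) (hG0 : ∀ x, G 0 x = x)
    (hGc : ∀ (q : ℕ) (σ : SingularSimplex X q),
      Continuous fun p : unitInterval × stdSimplex ℝ (Fin (q + 1)) => G p.1 (σ p.2))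
    (p : X) (hG1 : ∀ x, G 1 x = p) : Subsingleton (ReducedCohomology X 0) := by
  obtain ⟨K, hKG, hK0, -⟩ := exists_coneOperator G hG0 hGc fun q σ u u' => by rw [hG1, hG1]
  refine subsingleton_quotient_addSubgroupOf fun φ hφ => ?_
  refine ⟨φ (ContinuousMap.const _ p), funext fun σ => ?_⟩
  have h : ∑ j : Fin (0 + 2), (-1 : ℤ) ^ (j : ℕ) * φ ((K 0 σ).face j) = 0 :=
    congrFun hφ (K 0 σ)
  have h1 : (K 0 σ).face 1 = ContinuousMap.const _ p := by
    ext u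
    change K 0 σ (stdSimplex.map (Fin.succAbove (1 : Fin 2)) u) = _
    rw [stdSimplex_map_succAbove_one u u, hKG, hG1]
    rfl
  rw [Fin.sum_univ_two] at h
  simp only [Fin.val_zero, Fin.val_one, pow_zero, pow_one, one_mul, neg_mul] at h
  erw [hK0, h1] at h
  change φ (ContinuousMap.const _ p) = φ σ
  linarith

theorem subsingleton_cohomology_of_isEmpty [IsEmpty X] (q : ℕ) : Subsingleton (Cohomology X q) := by
  refine subsingleton_quotient_addSubgroupOf fun φ _ => ?_
  have : IsEmpty (SingularSimplex X q) := ⟨fun σ => isEmptyElim (σ (Classical.arbitrary _))⟩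
  rw [Subsingleton.elim φ 0]
  exact zero_mem _

theorem subsingleton_reducedCohomology_of_isEmpty [IsEmpty X] (q : ℕ) :
    Subsingleton (ReducedCohomology X q) := by
  refine subsingleton_quotient_addSubgroupOf fun φ _ => ?_
  have : IsEmpty (SingularSimplex X q) := ⟨fun σ => isEmptyElim (σ (Classical.arbitrary _))⟩
  rw [Subsingleton.elim φ 0]
  exact zero_mem _

/-- A locally constant function is a `0`-cocycle, since its values at the ends of a path agree. -/
theorem comp_mem_cocycles_zero (f : C(X, ℤ)) :
    (fun σ : SingularSimplex X 0 => f (σ (Classical.arbitrary _))) ∈ cocycles X 0 := by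
  refine funext fun σ => ?_
  have hc : ∀ v v', f (σ v) = f (σ v') := fun v v' =>
    PreconnectedSpace.constant inferInstance (f := fun v => f (σ v))
      (f.continuous.comp σ.continuous)
  change ∑ j : Fin (0 + 2), (-1 : ℤ) ^ (j : ℕ) * f ((σ.face j) _) = 0
  rw [Fin.sum_univ_two]
  simp only [Fin.val_zero, Fin.val_one, pow_zero, pow_one, one_mul, neg_mul]
  rw [add_neg_eq_zero]
  exact hc _ _

theorem not_subsingleton_cohomology_zero [Nonempty X] : ¬ Subsingleton (Cohomology X 0) := by
  intro h
  have h0 := AddSubgroup.mem_bot.mp (le_of_subsingleton_quotient_addSubgroupOf h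
    (comp_mem_cocycles_zero (ContinuousMap.const X 1)))
  have h1 := congrFun h0 (ContinuousMap.const _ (Classical.arbitrary X))
  simp at h1

theorem not_subsingleton_reducedCohomology_zero (f : C(X, ℤ)) {x y : X} (hxy : f x ≠ f y) :
    ¬ Subsingleton (ReducedCohomology X 0) := by
  intro h
  obtain ⟨c, hc⟩ := le_of_subsingleton_quotient_addSubgroupOf h (comp_mem_cocycles_zero f)
  have hx := congrFun hc (ContinuousMap.const _ x)
  have hy := congrFun hc (ContinuousMap.const _ y)
  exact hxy ((hx.symm.trans hy : _))

end Contraction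

theorem subsingleton_directSum {ι : Type} {A : ι → Type} [∀ i, AddCommGroup (A i)]
    (h : ∀ i, Subsingleton (A i)) : Subsingleton (DirectSum ι A) :=
  ⟨fun _ _ => DFinsupp.ext fun i => (h i).elim _ _⟩

theorem subsingleton_of_directSum {ι : Type} {A : ι → Type} [∀ i, AddCommGroup (A i)]
    (h : Subsingleton (DirectSum ι A)) (i : ι) : Subsingleton (A i) := by
  classical
  exact (DirectSum.of_injective (β := A) i).subsingleton

end CurveLattice

namespace CurveLattice
namespace ReducedCurveSingularity

variable {N r : ℕ} (C : ReducedCurveSingularity N r)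

/-! ### Topology of the sublevel sets -/

theorem cubeWeight_le_iff {l : Fin r → ℕ} {I : Finset (Fin r)} {n : ℤ} :
    C.cubeWeight l I ≤ n ↔ ∀ K ⊆ I, C.weight (vertex l K) ≤ n :=
  (Finset.sup'_le_iff _ _).trans (forall_congr' fun K => by rw [Finset.mem_powerset])

theorem mem_sublevel_iff {n : ℤ} {x : Fin r → ℝ} :
    x ∈ C.sublevel n ↔ ∃ L U : Fin r → ℕ, L ≤ U ∧ (∀ i, U i ≤ L i + 1) ∧
      (∀ l, L ≤ l → l ≤ U → C.weight l ≤ n) ∧ ∀ i, (L i : ℝ) ≤ x i ∧ x i ≤ U i := by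
  simp only [sublevel, Set.mem_iUnion, cubeWeight_le_iff, exists_prop]
  constructor
  · rintro ⟨l, I, hw, hx⟩
    refine ⟨l, vertex l I, fun i => Nat.le_add_right _ _, fun i => ?_, fun l' h1 h2 => ?_, hx⟩
    · unfold vertex; split_ifs <;> omega
    · have hl : l' = vertex l (Finset.univ.filter fun i => l' i = l i + 1) := by
        ext i
        have h1 : l i ≤ l' i := h1 i
        have h2 := h2 i
        simp only [vertex, Finset.mem_filter, Finset.mem_univ, true_and] at h2 ⊢
        split_ifs at h2 ⊢ <;> omega
      rw [hl]
      refine hw _ fun i hi => ?_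
      by_contra hI
      have h2 := h2 i
      simp only [vertex, if_neg hI] at h2
      have := (Finset.mem_filter.mp hi).2
      omega
  · rintro ⟨L, U, hLU, hU, hw, hx⟩
    have hv : vertex L (Finset.univ.filter fun i => U i = L i + 1) = U := by
      ext i
      have h1 : L i ≤ U i := hLU i
      have h2 := hU i
      simp only [vertex, Finset.mem_filter, Finset.mem_univ, true_and]
      split_ifs <;> omega
    refine ⟨L, Finset.univ.filter fun i => U i = L i + 1, fun K hK => hw _ (fun i => ?_) ?_, ?_⟩
    · exact Nat.le_add_right _ _
    · rw [← hv]
      intro i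
      unfold vertex
      by_cases h : i ∈ K
      · rw [if_pos h, if_pos (hK h)]
      · rw [if_neg h]; exact Nat.le_add_right _ _
    · intro i
      rw [hv]
      exact hx i

theorem natCast_mem_sublevel {n : ℤ} {l : Fin r → ℕ} (h : C.weight l ≤ n) :
    (fun i => (l i : ℝ)) ∈ C.sublevel n :=
  C.mem_sublevel_iff.mpr ⟨l, l, le_rfl, fun _ => Nat.le_succ _,
    fun l' h1 h2 => by rwa [le_antisymm h2 h1], fun _ => ⟨le_rfl, le_rfl⟩⟩

theorem sublevel_nonempty_iff {n : ℤ} : (C.sublevel n).Nonempty ↔ ∃ l, C.weight l ≤ n := by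
  constructor
  · rintro ⟨x, hx⟩
    obtain ⟨L, U, h, -, hw, -⟩ := C.mem_sublevel_iff.mp hx
    exact ⟨L, hw L le_rfl h⟩
  · rintro ⟨l, hl⟩
    exact ⟨_, C.natCast_mem_sublevel hl⟩

/-- The sublevel set `S_n` is stable under cutting off at a height `T ∈ [c, c + 1]`: with a cube
`[L, U]` it contains the cube `[min(L, c), min(U, c + 1)]`. -/
def IsTruncationStable (n : ℤ) : Prop :=
  ∀ L U l : Fin r → ℕ, ∀ c : ℕ, L ≤ U → (∀ l', L ≤ l' → l' ≤ U → C.weight l' ≤ n) →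
    (∀ i, min (L i) c ≤ l i) → (∀ i, l i ≤ min (U i) (c + 1)) → C.weight l ≤ n

variable {C}

theorem IsTruncationStable.min_mem_sublevel {n : ℤ} (h : C.IsTruncationStable n)
    {x : Fin r → ℝ} (hx : x ∈ C.sublevel n) {T : ℝ} (hT : 0 ≤ T) :
    (fun i => min (x i) T) ∈ C.sublevel n := by
  obtain ⟨L, U, hLU, hU, hw, hx⟩ := C.mem_sublevel_iff.mp hx
  have h1 : (⌊T⌋₊ : ℝ) ≤ T := Nat.floor_le hT
  have h2 : T ≤ ⌊T⌋₊ + 1 := (Nat.lt_floor_add_one T).le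
  refine C.mem_sublevel_iff.mpr ⟨fun i => min (L i) ⌊T⌋₊, fun i => min (U i) (⌊T⌋₊ + 1),
    fun i => min_le_min (hLU i) (Nat.le_succ _), fun i => ?_,
    fun l hl hl' => h L U l ⌊T⌋₊ hLU hw hl hl', fun i => ⟨?_, ?_⟩⟩
  · rw [← min_add_add_right]
    exact min_le_min (hU i) le_rfl
  · push_cast
    exact min_le_min (hx i).1 h1
  · push_cast
    exact min_le_min (hx i).2 h2

/-- The truncations `x ↦ min(x, (1 - s) ‖x‖)` contract a truncation stable sublevel set to the
origin. -/
theorem IsTruncationStable.subsingleton_cohomology {n : ℤ} (h : C.IsTruncationStable n) :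
    (∀ q, Subsingleton (Cohomology (C.sublevel n) (q + 1))) ∧
      Subsingleton (ReducedCohomology (C.sublevel n) 0) := by
  rcases isEmpty_or_nonempty (C.sublevel n) with he | ⟨⟨x₀, hx₀⟩⟩
  · exact ⟨fun q => subsingleton_cohomology_of_isEmpty _,
      subsingleton_reducedCohomology_of_isEmpty _⟩
  have hnn : ∀ x : C.sublevel n, ∀ i, 0 ≤ x.1 i := fun x i => by
    obtain ⟨L, U, -, -, -, hx⟩ := C.mem_sublevel_iff.mp x.2
    exact (Nat.cast_nonneg _).trans (hx i).1
  let G : unitInterval → C.sublevel n → C.sublevel n := fun s x =>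
    ⟨fun i => min (x.1 i) ((1 - (s : ℝ)) * ‖x.1‖),
      h.min_mem_sublevel x.2 (mul_nonneg (sub_nonneg.mpr s.2.2) (norm_nonneg _))⟩
  have hG0 : ∀ x, G 0 x = x := fun x => by
    ext i
    change min (x.1 i) ((1 - ((0 : unitInterval) : ℝ)) * ‖x.1‖) = x.1 i
    rw [Set.Icc.coe_zero, sub_zero, one_mul]
    exact min_eq_left ((le_abs_self _).trans (norm_le_pi_norm x.1 i))
  have hG1 : ∀ x y, G 1 x = G 1 y := fun x y => by
    ext i
    change min (x.1 i) ((1 - ((1 : unitInterval) : ℝ)) * ‖x.1‖) =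
      min (y.1 i) ((1 - ((1 : unitInterval) : ℝ)) * ‖y.1‖)
    rw [Set.Icc.coe_one, sub_self, zero_mul, zero_mul, min_eq_right (hnn x i),
      min_eq_right (hnn y i)]
  have hGc : ∀ (q : ℕ) (σ : SingularSimplex (C.sublevel n) q),
      Continuous fun p : unitInterval × stdSimplex ℝ (Fin (q + 1)) => G p.1 (σ p.2) := by
    intro q σ
    refine Continuous.subtype_mk (continuous_pi fun i => ?_) _
    have hσ : Continuous fun p : unitInterval × stdSimplex ℝ (Fin (q + 1)) => (σ p.2).1 :=
      continuous_subtype_val.comp (σ.continuous.comp continuous_snd)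
    have hs : Continuous fun p : unitInterval × stdSimplex ℝ (Fin (q + 1)) => (p.1 : ℝ) :=
      continuous_subtype_val.comp continuous_fst
    exact ((continuous_apply i).comp hσ).min ((continuous_const.sub hs).mul hσ.norm)
  exact ⟨subsingleton_cohomology_succ G hG0 hGc fun q σ u u' => hG1 _ _,
    subsingleton_reducedCohomology_zero G hG0 hGc (G 1 ⟨x₀, hx₀⟩) fun x => hG1 _ _⟩

variable (C)

/-- As weights of neighbours differ by one, a sublevel set at the minimum of the weights
consists of lattice points. -/
theorem exists_eq_natCast_of_mem_sublevel_zero (hw : ∀ l, 0 ≤ C.weight l) {x : Fin r → ℝ}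
    (hx : x ∈ C.sublevel 0) : ∃ l : Fin r → ℕ, C.weight l ≤ 0 ∧ ∀ i, x i = l i := by
  obtain ⟨L, U, hLU, hU, h, hx⟩ := C.mem_sublevel_iff.mp hx
  refine ⟨L, h L le_rfl hLU, fun i => le_antisymm ?_ (hx i).1⟩
  refine (hx i).2.trans ?_
  by_contra hlt
  have hlt : L i < U i := by exact_mod_cast not_le.mp hlt
  have h1 := h L le_rfl hLU
  have h2 := h (L + Pi.single i 1) (le_add_of_nonneg_right (by simp)) fun j => by
    by_cases hj : j = i
    · subst hj; simpa using hlt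
    · simpa [Pi.single_eq_of_ne hj] using hLU j
  have h3 := hw L
  have h4 := hw (L + Pi.single i 1)
  rcases C.weight_add_single_eq L i with h5 | h5 <;> omega

theorem subsingleton_cohomology_sublevel_zero (hw : ∀ l, 0 ≤ C.weight l) (q : ℕ) :
    Subsingleton (Cohomology (C.sublevel 0) (q + 1)) := by
  refine subsingleton_cohomology_succ (fun _ x => x) (fun _ => rfl)
    (fun q σ => σ.continuous.comp continuous_snd) (fun q σ u u' => ?_) q
  ext i
  have : DiscreteTopology (Set.range (Nat.cast : ℕ → ℝ)) :=
    Nat.isClosedEmbedding_coe_real.isEmbedding.toHomeomorph.symm.isEmbedding.discreteTopology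
  refine isPreconnected_univ.constant_of_mapsTo
    (isDiscrete_iff_discreteTopology.mpr this) (f := fun u => (σ u).1 i) ?_ (fun u _ => ?_) (Set.mem_univ u) (Set.mem_univ u')
  · exact ((continuous_apply i).comp
      (continuous_subtype_val.comp σ.continuous)).continuousOn
  · obtain ⟨l, -, hl⟩ := C.exists_eq_natCast_of_mem_sublevel_zero hw (σ u).2
    exact ⟨l i, (hl i).symm⟩

/-- The origin is isolated in `S_0`, as the weight of each `e_i` is one, so that `S_0` is
disconnected as soon as it contains another lattice point. -/
theorem not_subsingleton_reducedCohomology_sublevel_zero (h : 2 ≤ C.multiplicity) :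
    ¬ Subsingleton (ReducedCohomology (C.sublevel 0) 0) := by
  have h0 : (fun i => ((0 : Fin r → ℕ) i : ℝ)) ∈ C.sublevel 0 :=
    C.natCast_mem_sublevel C.weight_zero.le
  have hb : (fun i => (C.branchOrder i : ℝ)) ∈ C.sublevel 0 :=
    C.natCast_mem_sublevel (by rw [weight_branchOrder]; omega)
  let i₀ : Fin r := ⟨0, C.r_pos⟩
  have hU : IsClopen {x : C.sublevel 0 | ∀ i, x.1 i < 1} := by
    have hc : ∀ i, Continuous fun x : C.sublevel 0 => x.1 i := fun i =>
      (continuous_apply i).comp continuous_subtype_val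
    refine ⟨?_, ?_⟩
    · have he : {x : C.sublevel 0 | ∀ i, x.1 i < 1} = {x | ∀ i, x.1 i ≤ 0} := by
        ext ⟨x, hx⟩
        obtain ⟨L, U, hLU, hU, hw, hx⟩ := C.mem_sublevel_iff.mp hx
        refine ⟨fun h i => ?_, fun h i => (h i).trans_lt one_pos⟩
        have hL : L = 0 := by
          ext j
          have h1 : (L j : ℝ) < 1 := (hx j).1.trans_lt (h j)
          have h2 : L j < 1 := by exact_mod_cast h1
          simpa using h2
        subst hL
        refine (hx i).2.trans ?_
        by_contra hUi
        have hUi : 0 < U i := by exact_mod_cast not_le.mp hUi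
        have h3 := hw (Pi.single i 1) (by simp) fun j => by
          by_cases hj : j = i
          · subst hj; simpa using Nat.succ_le_of_lt hUi
          · simp [Pi.single_eq_of_ne hj]
        rw [weight_single] at h3
        omega
      rw [he, Set.ofPred_forall]
      exact isClosed_iInter fun i => isClosed_le (hc i) continuous_const
    · rw [Set.ofPred_forall]
      exact isOpen_iInter_of_finite fun i => isOpen_lt (hc i) continuous_const
  classical
  let f : C(C.sublevel 0, ℤ) := ⟨LocallyConstant.charFn ℤ hU, LocallyConstant.continuous _⟩
  have hf : ∀ x, f x = Set.indicator {x : C.sublevel 0 | ∀ i, x.1 i < 1} 1 x :=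
    congrFun (LocallyConstant.coe_charFn ℤ hU)
  refine not_subsingleton_reducedCohomology_zero f (x := ⟨_, h0⟩) (y := ⟨_, hb⟩) ?_
  have h1 : f ⟨_, h0⟩ = 1 := (hf _).trans (Set.indicator_of_mem (by simp) _)
  have h2 : f ⟨_, hb⟩ = 0 := by
    refine (hf _).trans (Set.indicator_of_notMem (fun hmem => ?_) _)
    have h3 : (C.branchOrder i₀ : ℝ) < 1 := hmem i₀
    have h4 : C.branchOrder i₀ < 1 := by exact_mod_cast h3
    have := C.branchOrder_pos i₀
    omega
  rw [h1, h2]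
  exact one_ne_zero

/-- In this case there is one branch, and `w₀(a) = a`. -/
theorem isTruncationStable_of_multiplicity_eq_one (h : C.multiplicity = 1) (n : ℤ) :
    C.IsTruncationStable n := by
  obtain rfl : r = 1 := le_antisymm (h ▸ C.r_le_multiplicity) C.r_pos
  have hb : C.branchOrder 0 = 1 := by simpa [multiplicity_eq_sum] using h
  obtain ⟨x, hx, hxv⟩ := C.exists_generic
  have hw : ∀ a : ℕ, C.weight (fun _ => a) = a := by
    intro a
    induction a with
    | zero => exact C.weight_zero
    | succ a ih =>
      have hv : C.valuation 0 (x ^ a) = a := by rw [valuation_pow, hxv, hb]; simp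
      rw [← add_single_fin_one, C.weight_add_single (f := x ^ a) (fun i => ?_) hv, ih]
      · push_cast; rfl
      · rw [Subsingleton.elim i 0, hv]
  have hl : ∀ l : Fin 1 → ℕ, C.weight l = l 0 := fun l => by
    rw [← hw]; congr; ext i; rw [Subsingleton.elim i 0]
  intro L U l c hLU hn _ h2
  have h3 := hn U hLU le_rfl
  rw [hl] at h3 ⊢
  refine le_trans ?_ h3
  exact_mod_cast (h2 0).trans (min_le_left _ _)

theorem isTruncationStable_of_multiplicity_le_two (h : C.multiplicity ≤ 2) {n : ℤ} (hn : 1 ≤ n) :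
    C.IsTruncationStable n := fun L U l c =>
  (C.weight_nonneg_and_truncation h).2 n hn L U l c

end ReducedCurveSingularity
end CurveLattice

namespace CurveLattice

/-! ### Square roots of units -/

/-- Otherwise a square root `r` of the unit `u` could be adjoined to `ℂ{t}`, giving a domain `D`
integral over `ℂ{t}`, hence a local ring. For `γ² = u(0)`, the elements `(1 ± r/γ)/2` of `D` are
conjugate with sum one, so both are units; but their product lies in the maximal ideal of
`ℂ{t}`. -/
theorem exists_sq_eq_of_isUnit {u : ConvergentSeries 1} (hu : IsUnit u) :
    ∃ s : ConvergentSeries 1, s ^ 2 = u := by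
  by_contra! hns
  obtain ⟨γ, hγ⟩ := IsAlgClosed.exists_pow_nat_eq (evalOrigin 1 u) two_pos
  have hγ0 : γ ≠ 0 := fun h => isUnit_iff_evalOrigin.mp hu (by rw [← hγ, h]; ring)
  let p : Polynomial (ConvergentSeries 1) := Polynomial.X ^ 2 - Polynomial.C u
  have hm : p.Monic := Polynomial.monic_X_pow_sub_C u two_ne_zero
  have hdeg : p.natDegree = 2 := Polynomial.natDegree_X_pow_sub_C
  have hirr : Irreducible p := by
    rw [hm.irreducible_iff_roots_eq_zero_of_degree_le_three hdeg.ge (by omega)]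
    refine Multiset.eq_zero_of_forall_notMem fun s hs => hns s ?_
    have h := (Polynomial.mem_roots'.mp hs).2
    simpa [p, sub_eq_zero] using h
  have : Fact (Irreducible p) := ⟨hirr⟩
  let D := AdjoinRoot p
  have : IsDomain D := AdjoinRoot.isDomain_of_prime hirr.prime
  have hinj : Function.Injective (algebraMap (ConvergentSeries 1) D) :=
    AdjoinRoot.of.injective_of_degree_ne_zero (by
      rw [Polynomial.degree_eq_natDegree hm.ne_zero, hdeg]; decide)
  have : FaithfulSMul (ConvergentSeries 1) D := (faithfulSMul_iff_algebraMap_injective _ _).2 hinj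
  have : Module.Finite (ConvergentSeries 1) D := hm.finite_adjoinRoot
  have : IsLocalRing D := isLocalRing_of_isIntegral D
  have hr : (AdjoinRoot.root p : D) ^ 2 = algebraMap (ConvergentSeries 1) D u := by
    have h := AdjoinRoot.eval₂_root p
    rw [Polynomial.eval₂_sub, Polynomial.eval₂_X_pow, Polynomial.eval₂_C] at h
    exact sub_eq_zero.mp h
  let κ : D →ₐ[ConvergentSeries 1] D := AdjoinRoot.liftAlgHom p (Algebra.ofId _ _)
    (-AdjoinRoot.root p) (by
      simp only [p, Polynomial.eval₂_sub, Polynomial.eval₂_X_pow, Polynomial.eval₂_C, neg_sq]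
      rw [hr]
      exact sub_self _)
  have hκ : κ (AdjoinRoot.root p) = -AdjoinRoot.root p := AdjoinRoot.liftAlgHom_root _ _ _ _
  let a : ConvergentSeries 1 := algebraMap ℂ _ (2⁻¹ * γ⁻¹)
  let b : ConvergentSeries 1 := algebraMap ℂ _ 2⁻¹
  have hb : b + b = 1 := by
    rw [← map_add, ← map_one (algebraMap ℂ (ConvergentSeries 1))]; norm_num
  set A := algebraMap (ConvergentSeries 1) D with hA
  let e : D := A b + A a * AdjoinRoot.root p
  let e' : D := A b - A a * AdjoinRoot.root p
  have he : κ e = e' := by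
    simp only [e, e', map_add, map_mul, hκ, hA, AlgHom.commutes]; ring
  have he' : κ e' = e := by
    simp only [e, e', map_sub, map_mul, hκ, hA, AlgHom.commutes]; ring
  have hsum : e + e' = 1 := by
    have : e + e' = A (b + b) := by rw [map_add]; ring
    rw [this, hb, map_one]
  have hunit : IsUnit e ∧ IsUnit e' := by
    rcases IsLocalRing.isUnit_or_isUnit_of_add_one hsum with h | h
    · exact ⟨h, he ▸ h.map κ⟩
    · exact ⟨he' ▸ h.map κ, h⟩
  have hprod : e * e' = A (b ^ 2 - a ^ 2 * u) := by
    rw [map_sub, map_mul, map_pow, map_pow, ← hr]; ring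
  have h1 := hunit.1.mul hunit.2
  rw [hprod] at h1
  have h2 : IsUnit (b ^ 2 - a ^ 2 * u) := by
    have := Algebra.IsIntegral.isLocalHom (R := ConvergentSeries 1) (S := D)
    exact isUnit_of_map_unit A _ h1
  refine isUnit_iff_evalOrigin.mp h2 ?_
  simp only [a, b, map_sub, map_mul, map_pow, AlgHom.commutes, Algebra.algebraMap_self_apply, ← hγ]
  field_simp
  ring

end CurveLattice

namespace CurveLattice

theorem exists_eq_algebraMap_add_coord_mul (a : ConvergentSeries 1) :
    ∃ q, a = algebraMap ℂ _ (evalOrigin 1 a) + coord 0 * q := by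
  obtain ⟨q, hq⟩ := exists_eq_add_sum_coord_mul a
  exact ⟨q 0, by simpa using hq⟩

theorem eq_zero_of_forall_coord_pow_dvd {a : ConvergentSeries 1}
    (h : ∀ n, (coord 0 : ConvergentSeries 1) ^ n ∣ a) : a = 0 := by
  by_contra ha
  obtain ⟨n, u, hu, rfl⟩ := exists_eq_pow_mul_unit ha
  have h1 := h (n + 1)
  rw [pow_succ, mul_dvd_mul_iff_left (pow_ne_zero _ (coord_ne_zero 0))] at h1
  exact irreducible_coord.not_isUnit (isUnit_of_dvd_unit h1 hu)

namespace ReducedCurveSingularity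

variable {N r : ℕ} (C : ReducedCurveSingularity N r)

/-! ### Germs of multiplicity one and two -/

theorem finrank_quotient_maxIdeal : Module.finrank ℂ (C.LocalRing ⧸ C.maxIdeal) = 1 := by
  have hne : (1 : C.LocalRing ⧸ C.maxIdeal) ≠ 0 := by
    rw [maxIdeal_eq_maximalIdeal]
    exact one_ne_zero
  rw [finrank_eq_one_iff_of_nonzero' 1 hne]
  intro g
  obtain ⟨g, rfl⟩ := Ideal.Quotient.mk_surjective g
  obtain ⟨c, hc⟩ := C.exists_sub_algebraMap_mem_maxIdeal g
  exact ⟨c, (Algebra.algebraMap_eq_smul_one (A := C.LocalRing ⧸ C.maxIdeal) c).symm.trans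
    (Ideal.Quotient.eq.mpr hc).symm⟩

theorem multiplicity_eq_one_of_algEquiv (e : C.LocalRing ≃ₐ[ℂ] ConvergentSeries 1) : C.multiplicity = 1 := by
  let y : C.LocalRing := e.symm (coord 0)
  have hm : C.maxIdeal = Ideal.span {y} := by
    ext g
    rw [Ideal.mem_span_singleton, maxIdeal_eq_maximalIdeal, IsLocalRing.mem_maximalIdeal,
      mem_nonunits_iff, ← MulEquiv.isUnit_map e, ← mem_nonunits_iff,
      ← IsLocalRing.mem_maximalIdeal, maximalIdeal_eq_originIdeal, originIdeal_one,
      Ideal.mem_span_singleton, ← map_dvd_iff e]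
    simp [y]
  have hy : ∀ g, y * g = 0 → g = 0 := fun g hg => by
    have h1 := congrArg e hg
    rw [map_mul, map_zero, AlgEquiv.apply_symm_apply] at h1
    simpa using (mul_eq_zero.mp h1).resolve_left (coord_ne_zero 0)
  have h1 := C.finrank_quotient_maxIdeal
  have hfin1 : Module.Finite ℂ (C.LocalRing ⧸ Ideal.span {y}) := by
    rw [← hm]
    exact Module.finite_of_finrank_pos (by omega)
  have key : ∀ k : ℕ, Module.Finite ℂ (C.LocalRing ⧸ C.maxIdeal ^ k) ∧
      Module.finrank ℂ (C.LocalRing ⧸ C.maxIdeal ^ k) = k := by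
    intro k
    induction k with
    | zero =>
      rw [pow_zero, Ideal.one_eq_top]
      exact ⟨inferInstance, Module.finrank_zero_of_subsingleton⟩
    | succ k ih =>
      obtain ⟨hf, hk⟩ := ih
      have := finrank_quotient_span_mul hy (C.maxIdeal ^ k)
      rwa [← hm, ← pow_succ', hk, h1] at this
  refine C.multiplicity_eq_of_eventually (b := 0) (Filter.Eventually.of_forall fun k => ?_)
  rw [(key k).2]
  simp

/-- For some generic germ `x`, represented by `x₀`, germs that span the local ring modulo `x` over `ℂ`
span it over `ℂ{x}`. -/
theorem exists_generic_substHom : ∃ x₀ : ConvergentSeries N, ∃ hx₀ : x₀ ∈ originIdeal N,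
    (∀ i, C.valuation i (Ideal.Quotient.mk C.ideal x₀) = C.branchOrder i) ∧
    ∀ {ι : Type} [Fintype ι] (b : ι → C.LocalRing),
      (∀ f, ∃ c : ι → ℂ, f - ∑ i, c i • b i ∈ Ideal.span {Ideal.Quotient.mk C.ideal x₀}) →
      ∀ f, ∃ a : ι → ConvergentSeries 1, f = ∑ i,
        Ideal.Quotient.mk C.ideal (substHom (fun _ => x₀) (fun _ => hx₀) (a i)) * b i := by
  obtain ⟨x, hx, hxv⟩ := C.exists_generic
  obtain ⟨x₀, hx₀, rfl⟩ :=
    (Ideal.mem_map_iff_of_surjective _ Ideal.Quotient.mk_surjective).mp hx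
  have hmem : ∀ g, Ideal.Quotient.mk C.ideal g ∈ Ideal.span {Ideal.Quotient.mk C.ideal x₀} →
      g ∈ Ideal.span {x₀} ⊔ C.ideal := fun g hg => by
    rw [← Set.image_singleton, ← Ideal.map_span] at hg
    have := Ideal.mem_comap.mpr hg
    rwa [Ideal.comap_map_of_surjective _ Ideal.Quotient.mk_surjective, ← RingHom.ker_eq_comap_bot,
      Ideal.mk_ker] at this
  refine ⟨x₀, hx₀, hxv, fun {ι} _ b hb f => ?_⟩
  choose b₀ hb₀ using fun i => Ideal.Quotient.mk_surjective (b i)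
  obtain ⟨f, rfl⟩ := Ideal.Quotient.mk_surjective f
  obtain ⟨K, hK⟩ := exists_filtration_le_span_pow hxv
  have hrad : originIdeal N ≤ (Ideal.span {x₀} ⊔ C.ideal).radical := fun g hg => by
    refine ⟨K + 1, hmem _ ?_⟩
    have h1 := hK 1 ((K + 1) • C.branchOrder) fun i => by
      have := C.branchOrder_pos i
      rw [Pi.smul_apply, smul_eq_mul, one_mul, add_mul, one_mul, add_comm]
      exact Nat.add_le_add_right (Nat.le_mul_of_pos_right _ this) _
    rw [pow_one] at h1
    rw [map_pow]
    exact h1 (C.maxIdeal_pow_le_filtration _ (Ideal.pow_mem_pow (Ideal.mem_map_of_mem _ hg) _))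
  obtain ⟨a, ha⟩ := exists_expansion_of_span hx₀ hrad b₀ (fun g => by
    obtain ⟨c, hc⟩ := hb (Ideal.Quotient.mk C.ideal g)
    refine ⟨c, hmem _ ?_⟩
    rw [map_sub, map_sum]
    simp only [← hb₀] at hc
    exact hc) f
  refine ⟨a, ?_⟩
  have := Ideal.Quotient.eq.mpr ha
  rw [this, map_sum]
  simp only [map_mul, hb₀]

theorem nonempty_algEquiv_of_multiplicity_eq_one (h : C.multiplicity = 1) :
    Nonempty (C.LocalRing ≃ₐ[ℂ] ConvergentSeries 1) := by
  obtain ⟨x₀, hx₀, hxv, hspan⟩ := C.exists_generic_substHom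
  set x := Ideal.Quotient.mk C.ideal x₀ with hx
  have hdim := finrank_quotient_span_generic hxv
  rw [← multiplicity_eq_sum, h] at hdim
  let φ : ConvergentSeries 1 →ₐ[ℂ] C.LocalRing :=
    (Ideal.Quotient.mkₐ ℂ C.ideal).comp (substHom (fun _ => x₀) (fun _ => hx₀))
  have hφ0 : φ (coord 0) = x := by
    change Ideal.Quotient.mk C.ideal (substHom (fun _ => x₀) (fun _ => hx₀) (coord 0)) = x
    rw [substHom_coord]
  have hne : (1 : C.LocalRing ⧸ Ideal.span {x}) ≠ 0 := fun h0 => by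
    have : Subsingleton (C.LocalRing ⧸ Ideal.span {x}) := subsingleton_of_zero_eq_one h0.symm
    rw [Module.finrank_zero_of_subsingleton] at hdim
    omega
  have hsurj : Function.Surjective φ := fun f => by
    obtain ⟨a, ha⟩ := hspan (fun _ : Fin 1 => 1) (fun f => by
      obtain ⟨c, hc⟩ := (finrank_eq_one_iff_of_nonzero' 1 hne).mp hdim
        (Ideal.Quotient.mk (Ideal.span {x}) f)
      refine ⟨fun _ => c, Ideal.Quotient.eq.mp ?_⟩
      rw [← hc, Fin.sum_univ_one]
      rfl) f
    refine ⟨a 0, ?_⟩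
    rw [ha, Fin.sum_univ_one, mul_one]
    rfl
  have hinj : Function.Injective φ := by
    refine (injective_iff_map_eq_zero φ).mpr fun a ha => ?_
    by_contra hane
    obtain ⟨n, u, hu, rfl⟩ := exists_eq_pow_mul_unit hane
    rw [map_mul, map_pow, hφ0, (hu.map φ).mul_left_eq_zero] at ha
    have h1 := C.valuation_pow ⟨0, C.r_pos⟩ x n
    rw [ha, hxv, valuation_eq_addVal, map_zero, IsDiscreteValuationRing.addVal_zero] at h1
    exact ENat.natCast_ne_top (n * C.branchOrder ⟨0, C.r_pos⟩) (by rw [h1]; push_cast; rfl)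
  exact ⟨(AlgEquiv.ofBijective φ ⟨hinj, hsurj⟩).symm⟩

/-- Modulo a generic germ `x`, the local ring of a germ of multiplicity two is spanned by `1` and a
germ `y` vanishing at the origin. -/
theorem exists_basis_quotient_generic (h : C.multiplicity = 2) {x : C.LocalRing}
    (hxv : ∀ i, C.valuation i x = C.branchOrder i) :
    ∃ y ∈ C.maxIdeal, y ∉ Ideal.span {x} ∧
      ∀ f, ∃ c : Fin 2 → ℂ, f - ∑ i, c i • (![1, y] : Fin 2 → C.LocalRing) i ∈ Ideal.span {x} := by
  have hdim := finrank_quotient_span_generic hxv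
  rw [← multiplicity_eq_sum, h] at hdim
  have hxm : x ∈ C.maxIdeal := by
    rw [← C.one_le_valuation_iff ⟨0, C.r_pos⟩, hxv]
    exact_mod_cast C.branchOrder_pos _
  have hle : Ideal.span {x} ≤ C.maxIdeal := by
    rwa [Ideal.span_le, Set.singleton_subset_iff]
  obtain ⟨w, hw⟩ : ∃ w : C.LocalRing ⧸ Ideal.span {x}, ∀ c : ℂ, c • 1 ≠ w := by
    by_contra! hall
    have := finrank_le_one (1 : C.LocalRing ⧸ Ideal.span {x}) hall
    omega
  obtain ⟨g, rfl⟩ := Ideal.Quotient.mk_surjective w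
  obtain ⟨c, hc⟩ := C.exists_sub_algebraMap_mem_maxIdeal g
  have hy : g - algebraMap ℂ _ c ∉ Ideal.span {x} := fun hmem => hw c
    ((Algebra.algebraMap_eq_smul_one (A := C.LocalRing ⧸ Ideal.span {x}) c).symm.trans
      (Ideal.Quotient.eq.mpr hmem).symm)
  refine ⟨_, hc, hy, ?_⟩
  set y := g - algebraMap ℂ _ c
  have hli : LinearIndependent ℂ ![(1 : C.LocalRing ⧸ Ideal.span {x}),
      Ideal.Quotient.mk (Ideal.span {x}) y] := by
    refine LinearIndependent.pair_iff.mpr fun s t hst => ?_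
    have h1 : algebraMap ℂ C.LocalRing s + t • y ∈ Ideal.span {x} := by
      rw [← Ideal.Quotient.eq_zero_iff_mem, ← hst, map_add]
      exact congrArg₂ (· + ·)
        (Algebra.algebraMap_eq_smul_one (A := C.LocalRing ⧸ Ideal.span {x}) s) rfl
    have hs : s = 0 := by
      by_contra hs
      have h2 : algebraMap ℂ C.LocalRing s ∈ C.maxIdeal := by
        rw [← add_sub_cancel_right (algebraMap ℂ C.LocalRing s) (t • y)]
        refine sub_mem (hle h1) ?_
        rw [Algebra.smul_def]
        exact Ideal.mul_mem_left _ _ hc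
      exact C.isUnit_iff_notMem_maxIdeal.mp
        ((isUnit_iff_ne_zero.mpr hs).map (algebraMap ℂ C.LocalRing)) h2
    refine ⟨hs, ?_⟩
    by_contra ht
    refine hy ?_
    rw [hs, map_zero, zero_add, Algebra.smul_def] at h1
    exact (Ideal.unit_mul_mem_iff_mem _
      ((isUnit_iff_ne_zero.mpr ht).map (algebraMap ℂ C.LocalRing))).mp h1
  have hspan := hli.span_eq_top_of_card_eq_finrank (by rw [hdim]; rfl)
  intro f
  have hf : Ideal.Quotient.mk (Ideal.span {x}) f ∈ Submodule.span ℂ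
      (Set.range ![(1 : C.LocalRing ⧸ Ideal.span {x}), Ideal.Quotient.mk (Ideal.span {x}) y]) := by
    rw [hspan]; trivial
  rw [Submodule.mem_span_range_iff_exists_fun] at hf
  obtain ⟨d, hd⟩ := hf
  refine ⟨d, Ideal.Quotient.eq.mp ?_⟩
  rw [← hd, map_sum]
  refine Finset.sum_congr rfl fun i _ => ?_
  fin_cases i <;> rfl

/-- The local ring of a germ of multiplicity two is free over `ℂ{x}` with a basis `1, y` such that
`y² + x^k = 0`, where `k ≥ 2` because `𝔳_i(x)` is the smallest value of `𝔳_i` on the maximal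
ideal. -/
theorem exists_normal_form_of_multiplicity_eq_two (h : C.multiplicity = 2) :
    ∃ x₀ : ConvergentSeries N, ∃ hx₀ : x₀ ∈ originIdeal N, ∃ y ∈ C.maxIdeal, ∃ k : ℕ, 2 ≤ k ∧
      y ^ 2 + Ideal.Quotient.mk C.ideal x₀ ^ k = 0 ∧
      (∀ f, ∃ a b : ConvergentSeries 1,
        f = Ideal.Quotient.mk C.ideal (substHom (fun _ => x₀) (fun _ => hx₀) a) +
        Ideal.Quotient.mk C.ideal (substHom (fun _ => x₀) (fun _ => hx₀) b) * y) ∧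
      ∀ a b : ConvergentSeries 1, Ideal.Quotient.mk C.ideal (substHom (fun _ => x₀) (fun _ => hx₀) a) +
        Ideal.Quotient.mk C.ideal (substHom (fun _ => x₀) (fun _ => hx₀) b) * y = 0 →
        a = 0 ∧ b = 0 := by
  obtain ⟨x₀, hx₀, hxv, hspan⟩ := C.exists_generic_substHom
  refine ⟨x₀, hx₀, ?_⟩
  set x := Ideal.Quotient.mk C.ideal x₀ with hx
  have hxm : x ∈ C.maxIdeal := Ideal.mem_map_of_mem _ hx₀
  have hle : Ideal.span {x} ≤ C.maxIdeal := by
    rwa [Ideal.span_le, Set.singleton_subset_iff]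
  obtain ⟨y₁, hy₁, hy₁x, hb⟩ := C.exists_basis_quotient_generic h hxv
  let φ : ConvergentSeries 1 →ₐ[ℂ] C.LocalRing :=
    (Ideal.Quotient.mkₐ ℂ C.ideal).comp (substHom (fun _ => x₀) (fun _ => hx₀))
  have hφ0 : φ (coord 0) = x := by
    change Ideal.Quotient.mk C.ideal (substHom (fun _ => x₀) (fun _ => hx₀) (coord 0)) = x
    rw [substHom_coord]
  have hφx : ∀ a, evalOrigin 1 a = 0 → φ a ∈ Ideal.span {x} := fun a ha => by
    obtain ⟨q, hq⟩ := exists_eq_algebraMap_add_coord_mul a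
    rw [hq, ha, map_zero, zero_add, map_mul, hφ0]
    exact Ideal.mul_mem_right _ _ (Ideal.mem_span_singleton_self x)
  have hφm : ∀ a, φ a ∈ C.maxIdeal → evalOrigin 1 a = 0 := fun a ha => by
    by_contra hne
    exact C.isUnit_iff_notMem_maxIdeal.mp ((isUnit_iff_evalOrigin.mpr hne).map φ) ha
  have hgen : ∀ f, ∃ a b, f = φ a + φ b * y₁ := fun f => by
    obtain ⟨a, ha⟩ := hspan ![1, y₁] hb f
    exact ⟨a 0, a 1, by rw [ha, Fin.sum_univ_two]; simp [φ]⟩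
  change ∃ y ∈ C.maxIdeal, ∃ k : ℕ, 2 ≤ k ∧ y ^ 2 + x ^ k = 0 ∧
    (∀ f, ∃ a b, f = φ a + φ b * y) ∧ ∀ a b, φ a + φ b * y = 0 → a = 0 ∧ b = 0
  -- a germ vanishing at the origin but not divisible by `x` is linearly independent of `1`
  have hind : ∀ y ∈ C.maxIdeal, y ∉ Ideal.span {x} →
      ∀ a b, φ a + φ b * y = 0 → a = 0 ∧ b = 0 := by
    intro y hy hyx
    have hdvd : ∀ n : ℕ, ∀ a b, φ a + φ b * y = 0 → coord 0 ^ n ∣ a ∧ coord 0 ^ n ∣ b := by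
      intro n
      induction n with
      | zero => intro a b _; simp
      | succ n ih =>
        intro a b hab
        have ha : evalOrigin 1 a = 0 := hφm a (by
          rw [eq_neg_of_add_eq_zero_left hab]
          exact neg_mem (Ideal.mul_mem_left _ _ hy))
        have hb : evalOrigin 1 b = 0 := by
          by_contra hne
          refine hyx ((Ideal.unit_mul_mem_iff_mem _
            ((isUnit_iff_evalOrigin.mpr hne).map φ)).mp ?_)
          rw [eq_neg_of_add_eq_zero_right hab]
          exact neg_mem (hφx a ha)
        obtain ⟨p, hp⟩ := exists_eq_algebraMap_add_coord_mul a
        obtain ⟨q, hq⟩ := exists_eq_algebraMap_add_coord_mul b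
        rw [ha, map_zero, zero_add] at hp
        rw [hb, map_zero, zero_add] at hq
        subst hp hq
        obtain ⟨h1, h2⟩ := ih p q (eq_zero_of_generic_mul hxv (by
          rw [← hab, map_mul, map_mul, hφ0]; ring))
        rw [pow_succ']
        exact ⟨mul_dvd_mul_left _ h1, mul_dvd_mul_left _ h2⟩
    exact fun a b hab => ⟨eq_zero_of_forall_coord_pow_dvd fun n => (hdvd n a b hab).1,
      eq_zero_of_forall_coord_pow_dvd fun n => (hdvd n a b hab).2⟩
  -- completing the square in `y₁² = a + b y₁`
  obtain ⟨a, b, hab⟩ := hgen (y₁ ^ 2)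
  have ha : evalOrigin 1 a = 0 := hφm a (by
    rw [← sub_eq_iff_eq_add] at hab
    rw [← hab]
    exact sub_mem (Ideal.pow_mem_of_mem _ hy₁ 2 two_pos) (Ideal.mul_mem_left _ _ hy₁))
  have hb0 : evalOrigin 1 b = 0 := by
    by_contra hne
    have hu : IsUnit (φ b - y₁) := by
      rw [isUnit_iff_notMem_maxIdeal]
      intro hm
      refine hne (hφm b ?_)
      rw [← sub_add_cancel (φ b) y₁]
      exact add_mem hm hy₁
    refine hy₁x ((Ideal.unit_mul_mem_iff_mem _ hu).mp ?_)
    have : (φ b - y₁) * y₁ = -φ a := by rw [sub_mul, ← sq, hab]; ring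
    rw [this]
    exact neg_mem (hφx a ha)
  let c : ConvergentSeries 1 := algebraMap ℂ _ 2⁻¹
  have hc : φ c + φ c = 1 := by
    rw [← map_add, ← map_add, ← map_one φ, ← map_one (algebraMap ℂ (ConvergentSeries 1))]
    norm_num
  have hcb : φ (c * b) ∈ Ideal.span {x} := hφx _ (by rw [map_mul, hb0, mul_zero])
  set y₂ := y₁ - φ (c * b) with hy₂
  have hy₂m : y₂ ∈ C.maxIdeal := sub_mem hy₁ (hle hcb)
  have hy₂x : y₂ ∉ Ideal.span {x} := fun hmem => hy₁x (by
    rw [← sub_add_cancel y₁ (φ (c * b))]; exact add_mem hmem hcb)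
  have hsq : y₂ ^ 2 = φ (a + (c * b) ^ 2) := by
    have : y₂ ^ 2 = y₁ ^ 2 - (φ c + φ c) * φ b * y₁ + φ (c * b) ^ 2 := by
      rw [hy₂, map_mul]; ring
    rw [this, hab, hc, map_add, map_pow]
    ring
  set d := a + (c * b) ^ 2
  have hd : d ≠ 0 := fun hd => by
    rw [hd, map_zero] at hsq
    refine hy₂x ?_
    have h0 : y₂ = 0 := C.eq_zero_of_valuation_eq_top fun i => by
      have h1 := C.valuation_pow i y₂ 2
      rw [hsq, valuation_eq_addVal, map_zero, IsDiscreteValuationRing.addVal_zero] at h1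
      by_contra hne
      obtain ⟨v, hv⟩ := ENat.ne_top_iff_exists.mp hne
      rw [← hv] at h1
      exact ENat.natCast_ne_top (2 * v) (by push_cast; exact h1.symm)
    rw [h0]
    exact zero_mem _
  obtain ⟨k, u, hu, hdk⟩ := exists_eq_pow_mul_unit hd
  obtain ⟨s, hs⟩ := exists_sq_eq_of_isUnit hu.neg
  have hsu : IsUnit s := isUnit_pow_iff two_ne_zero |>.mp (hs ▸ hu.neg)
  obtain ⟨t, ht⟩ := hsu.exists_left_inv
  have htu : IsUnit (φ t) := (IsUnit.of_mul_eq_one _ ht).map φ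
  set y := φ t * y₂ with hy
  have hym : y ∈ C.maxIdeal := Ideal.mul_mem_left _ _ hy₂m
  have hyx : y ∉ Ideal.span {x} := fun hmem => hy₂x ((Ideal.unit_mul_mem_iff_mem _ htu).mp hmem)
  have hyk : y ^ 2 + x ^ k = 0 := by
    have h1 : t ^ 2 * u = -1 := by
      rw [← neg_neg u, ← hs, mul_neg, ← mul_pow, ht, one_pow]
    rw [hy, mul_pow, hsq, hdk, ← map_pow, ← map_mul,
      show t ^ 2 * (coord 0 ^ k * u) = coord 0 ^ k * (t ^ 2 * u) by ring, h1, mul_neg_one,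
      map_neg, map_pow, hφ0]
    exact neg_add_cancel _
  refine ⟨y, hym, k, ?_, hyk, fun f => ?_, hind y hym hyx⟩
  · by_contra! hk
    have i : Fin r := ⟨0, C.r_pos⟩
    have h1 := C.valuation_pow i y 2
    rw [eq_neg_of_add_eq_zero_left hyk, valuation_neg, valuation_pow, hxv] at h1
    have h2 := C.branchOrder_le hym i
    have h3 := C.branchOrder_pos i
    have h4 : C.valuation i y ≠ ⊤ := fun h => by
      rw [h] at h1
      exact ENat.natCast_ne_top (k * C.branchOrder i)
        (by push_cast; rw [h1]; exact ENat.mul_top (by simp))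
    obtain ⟨v, hv⟩ := ENat.ne_top_iff_exists.mp h4
    rw [← hv] at h1 h2
    have h1 : k * C.branchOrder i = 2 * v := by exact_mod_cast h1
    have h2 : C.branchOrder i ≤ v := by exact_mod_cast h2
    interval_cases k <;> omega
  · obtain ⟨p, q, hpq⟩ := hgen f
    refine ⟨p + q * (c * b), q * s, ?_⟩
    have h1 : φ s * y = y₂ := by
      rw [hy, ← mul_assoc, ← map_mul, mul_comm s, ht, map_one, one_mul]
    rw [map_mul φ q s, mul_assoc, h1, hpq, hy₂, map_add, map_mul φ q]
    ring

/-- With `y² + x^k = 0`, both the local ring and `ℂ{x₀, x₁}/(x₀² + x₁^k)` are free over `ℂ{x}` with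
basis `1, y`. -/
theorem exists_algEquiv_of_multiplicity_eq_two (h : C.multiplicity = 2) :
    ∃ k : ℕ, 2 ≤ k ∧ Nonempty (C.LocalRing ≃ₐ[ℂ] (ConvergentSeries 2 ⧸
      Ideal.span {(coord 0 : ConvergentSeries 2) ^ 2 + coord 1 ^ k})) := by
  obtain ⟨x₀, hx₀, y, hy, k, hk, hyk, hgen, hind⟩ := C.exists_normal_form_of_multiplicity_eq_two h
  obtain ⟨y₀, hy₀, rfl⟩ :=
    (Ideal.mem_map_iff_of_surjective _ Ideal.Quotient.mk_surjective).mp hy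
  refine ⟨k, hk, ?_⟩
  set I : Ideal (ConvergentSeries 2) := Ideal.span {coord 0 ^ 2 + coord 1 ^ k} with hI
  have hg : ∀ i : Fin 2, (![y₀, x₀] : Fin 2 → ConvergentSeries N) i ∈ originIdeal N :=
    Fin.forall_fin_two.mpr ⟨hy₀, hx₀⟩
  let ψ : ConvergentSeries 2 →ₐ[ℂ] C.LocalRing :=
    (Ideal.Quotient.mkₐ ℂ C.ideal).comp (substHom ![y₀, x₀] hg)
  have hψ0 : ψ (coord 0) = Ideal.Quotient.mk C.ideal y₀ := by
    change Ideal.Quotient.mk C.ideal (substHom ![y₀, x₀] hg (coord 0)) = _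
    rw [substHom_coord]; rfl
  have hψ1 : ψ (coord 1) = Ideal.Quotient.mk C.ideal x₀ := by
    change Ideal.Quotient.mk C.ideal (substHom ![y₀, x₀] hg (coord 1)) = _
    rw [substHom_coord]; rfl
  let τ : ConvergentSeries 1 →ₐ[ℂ] ConvergentSeries 2 :=
    substHom (fun _ => coord 1) fun _ => coord_mem_originIdeal 1
  have hψτ : ∀ a, ψ (τ a) =
      Ideal.Quotient.mk C.ideal (substHom (fun _ => x₀) (fun _ => hx₀) a) := fun a => by
    change Ideal.Quotient.mk C.ideal (substHom ![y₀, x₀] hg (substHom _ _ a)) = _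
    rw [substHom_substHom]
    refine congrArg _ (substHom_congr (funext fun _ => ?_) _ _ a)
    rw [substHom_coord]
    rfl
  have hle : I ≤ RingHom.ker ψ := by
    rw [hI, Ideal.span_le, Set.singleton_subset_iff, SetLike.mem_coe, RingHom.mem_ker, map_add,
      map_pow, map_pow, hψ0, hψ1, hyk]
  have hc1 : (coord 1 : ConvergentSeries 2) ∈ Ideal.span {coord 1} ⊔ I :=
    Ideal.mem_sup_left (Ideal.mem_span_singleton_self _)
  have hc0 : (coord 0 : ConvergentSeries 2) ^ 2 ∈ Ideal.span {coord 1} ⊔ I := by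
    have h1 : (coord 0 : ConvergentSeries 2) ^ 2 + coord 1 ^ k ∈ Ideal.span {coord 1} ⊔ I :=
      Ideal.mem_sup_right (Ideal.mem_span_singleton_self _)
    rw [← add_sub_cancel_right (coord 0 ^ 2) (coord 1 ^ k : ConvergentSeries 2)]
    exact sub_mem h1 (Ideal.pow_mem_of_mem _ hc1 k (by omega))
  have hrad : originIdeal 2 ≤ (Ideal.span {coord 1} ⊔ I).radical := by
    rw [originIdeal_eq_span, Ideal.span_le]
    rintro _ ⟨j, rfl⟩
    fin_cases j
    · exact ⟨2, hc0⟩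
    · exact Ideal.le_radical hc1
  have hdecomp : ∀ f, ∃ a b, f - (τ a + τ b * coord 0) ∈ I := fun f => by
    obtain ⟨a, ha⟩ := exists_expansion_of_span (coord_mem_originIdeal 1) hrad ![1, coord 0]
      (fun f => by
        obtain ⟨p, hp⟩ := exists_eq_add_sum_coord_mul f
        obtain ⟨q, hq⟩ := exists_eq_add_sum_coord_mul (p 0)
        rw [Fin.sum_univ_two] at hp hq
        refine ⟨![evalOrigin 2 f, evalOrigin 2 (p 0)], ?_⟩
        have : f - ∑ i, (![evalOrigin 2 f, evalOrigin 2 (p 0)] : Fin 2 → ℂ) i •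
            (![1, coord 0] : Fin 2 → ConvergentSeries 2) i =
            coord 0 ^ 2 * q 0 + coord 1 * (coord 0 * q 1 + p 1) := by
          rw [Fin.sum_univ_two]
          simp only [Matrix.cons_val_zero, Matrix.cons_val_one, Algebra.smul_def, mul_one]
          conv_lhs => rw [hp]
          conv_lhs => rw [hq]
          simp only [map_add, map_mul, AlgHom.commutes, evalOrigin_coord, zero_mul, add_zero,
            Algebra.algebraMap_self_apply]
          ring
        rw [this]
        exact add_mem (Ideal.mul_mem_right _ _ hc0) (Ideal.mul_mem_right _ _ hc1)) f
    refine ⟨a 0, a 1, ?_⟩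
    rw [Fin.sum_univ_two] at ha
    simpa using ha
  have hker : RingHom.ker ψ = I := by
    refine le_antisymm (fun f hf => ?_) hle
    obtain ⟨a, b, hab⟩ := hdecomp f
    have h1 : ψ (f - (τ a + τ b * coord 0)) = 0 := hle hab
    rw [map_sub, RingHom.mem_ker.mp hf, zero_sub, neg_eq_zero, map_add, map_mul, hψτ, hψτ,
      hψ0] at h1
    obtain ⟨rfl, rfl⟩ := hind a b h1
    simpa using hab
  have hsurj : Function.Surjective ψ := fun f => by
    obtain ⟨a, b, rfl⟩ := hgen f
    exact ⟨τ a + τ b * coord 0, by rw [map_add, map_mul, hψτ, hψτ, hψ0]⟩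
  exact ⟨(Ideal.quotientKerAlgEquivOfSurjective hsurj).symm.trans
    (Ideal.quotientEquivAlgOfEq ℂ hker)⟩

/-! ### Multiplicity and lattice cohomology -/

theorem nonneg_weight_iff : (∀ l, 0 ≤ C.weight l) ↔ C.multiplicity ≤ 2 := by
  refine ⟨fun h => ?_, fun h => (C.weight_nonneg_and_truncation h).1⟩
  have h1 := h C.branchOrder
  rw [weight_branchOrder] at h1
  omega

theorem exists_sublevel_nonempty_iff :
    (∃ n : ℤ, n < 0 ∧ (C.sublevel n).Nonempty) ↔ 2 < C.multiplicity := by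
  rw [← not_le, ← nonneg_weight_iff]
  push Not
  constructor
  · rintro ⟨n, hn, h⟩
    obtain ⟨l, hl⟩ := C.sublevel_nonempty_iff.mp h
    exact ⟨l, hl.trans_lt hn⟩
  · rintro ⟨l, hl⟩
    exact ⟨C.weight l, hl, C.sublevel_nonempty_iff.mpr ⟨l, le_rfl⟩⟩

theorem subsingleton_piece_of_isEmpty {n : ℤ} (h : ¬ (C.sublevel n).Nonempty) (q : ℕ) :
    Subsingleton (C.latticeCohomologyPiece q n) := by
  have : IsEmpty (C.sublevel n) := Set.isEmpty_coe_sort.mpr (Set.not_nonempty_iff_eq_empty.mp h)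
  exact subsingleton_cohomology_of_isEmpty q

theorem subsingleton_piece_zero_iff {n : ℤ} :
    Subsingleton (C.latticeCohomologyPiece 0 n) ↔ ¬ (C.sublevel n).Nonempty := by
  refine ⟨fun h hne => ?_, fun h => C.subsingleton_piece_of_isEmpty h 0⟩
  have : Nonempty (C.sublevel n) := hne.to_subtype
  exact not_subsingleton_cohomology_zero h

theorem forall_subsingleton_piece_zero_iff :
    (∀ n : ℤ, n < 0 → Subsingleton (C.latticeCohomologyPiece 0 n)) ↔ C.multiplicity ≤ 2 := by
  rw [← not_lt, ← exists_sublevel_nonempty_iff]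
  simp only [subsingleton_piece_zero_iff, not_exists, not_and]

theorem forall_subsingleton_piece_iff :
    (∀ n : ℤ, n < 0 → ∀ q : ℕ, Subsingleton (C.latticeCohomologyPiece q n)) ↔
      C.multiplicity ≤ 2 := by
  refine ⟨fun h => C.forall_subsingleton_piece_zero_iff.mp fun n hn => h n hn 0,
    fun h n hn q => C.subsingleton_piece_of_isEmpty ?_ q⟩
  exact C.subsingleton_piece_zero_iff.mp (C.forall_subsingleton_piece_zero_iff.mpr h n hn)

theorem subsingleton_reducedLatticeCohomology_zero_iff :
    Subsingleton (C.reducedLatticeCohomology 0) ↔ C.multiplicity = 1 := by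
  constructor
  · intro h
    by_contra hm
    have h1 := C.one_le_multiplicity
    exact C.not_subsingleton_reducedCohomology_sublevel_zero (by omega)
      (subsingleton_of_directSum h 0)
  · intro h
    exact subsingleton_directSum fun n =>
      (C.isTruncationStable_of_multiplicity_eq_one h n).subsingleton_cohomology.2

theorem subsingleton_latticeCohomology (h : C.multiplicity ≤ 2) {q : ℕ} (hq : 0 < q) :
    Subsingleton (C.latticeCohomology q) := by
  obtain ⟨q, rfl⟩ := Nat.exists_eq_succ_of_ne_zero hq.ne'
  refine subsingleton_directSum fun n => ?_
  rcases lt_trichotomy n 0 with hn | rfl | hn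
  · exact C.forall_subsingleton_piece_iff.mpr h n hn _
  · exact C.subsingleton_cohomology_sublevel_zero (C.nonneg_weight_iff.mpr h) q
  · exact (C.isTruncationStable_of_multiplicity_le_two h
      (by omega)).subsingleton_cohomology.1 q

end ReducedCurveSingularity
end CurveLattice

theorem mainTheorem5 {N r : ℕ} (C : CurveLattice.ReducedCurveSingularity N r) :
    -- multiplicity at most two
    ((C.multiplicity ≤ 2 ↔
        ∀ n : ℤ, n < 0 → ∀ q : ℕ, Subsingleton (C.latticeCohomologyPiece q n)) ∧
      ((∀ n : ℤ, n < 0 → ∀ q : ℕ, Subsingleton (C.latticeCohomologyPiece q n)) ↔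
        ∀ l : Fin r → ℕ, 0 ≤ C.weight l)) ∧
    -- multiplicity one, i.e. smooth germs
    ((C.multiplicity = 1 ↔ Subsingleton (C.reducedLatticeCohomology 0)) ∧
      (C.multiplicity = 1 ↔
        Nonempty (C.LocalRing ≃ₐ[ℂ] CurveLattice.ConvergentSeries 1))) ∧
    -- multiplicity two
    ((C.multiplicity = 2 ↔
        ¬ Subsingleton (C.reducedLatticeCohomology 0) ∧
          ∀ n : ℤ, n < 0 → Subsingleton (C.latticeCohomologyPiece 0 n)) ∧
      (C.multiplicity = 2 → ∃ k : ℕ, 2 ≤ k ∧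
        Nonempty (C.LocalRing ≃ₐ[ℂ] (CurveLattice.ConvergentSeries 2 ⧸
          Ideal.span {(CurveLattice.coord 0 : CurveLattice.ConvergentSeries 2) ^ 2 +
            CurveLattice.coord 1 ^ k})))) ∧
    -- multiplicity at least three
    ((2 < C.multiplicity ↔
        ∃ n : ℤ, n < 0 ∧ ¬ Subsingleton (C.latticeCohomologyPiece 0 n)) ∧
      ((∃ n : ℤ, n < 0 ∧ ¬ Subsingleton (C.latticeCohomologyPiece 0 n)) ↔
        ∃ n : ℤ, n < 0 ∧ (C.sublevel n).Nonempty)) ∧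
    -- vanishing in positive cohomological degrees
    (C.multiplicity ≤ 2 → ∀ q : ℕ, 0 < q → Subsingleton (C.latticeCohomology q)) := by
  have h1 := C.one_le_multiplicity
  refine ⟨⟨C.forall_subsingleton_piece_iff.symm,
      C.forall_subsingleton_piece_iff.trans C.nonneg_weight_iff.symm⟩,
    ⟨C.subsingleton_reducedLatticeCohomology_zero_iff.symm,
      C.nonempty_algEquiv_of_multiplicity_eq_one, fun ⟨e⟩ => C.multiplicity_eq_one_of_algEquiv e⟩,
    ⟨?_, C.exists_algEquiv_of_multiplicity_eq_two⟩, ⟨?_, ?_⟩,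
    fun h q hq => C.subsingleton_latticeCohomology h hq⟩
  · rw [C.subsingleton_reducedLatticeCohomology_zero_iff, C.forall_subsingleton_piece_zero_iff]
    omega
  · simp only [C.subsingleton_piece_zero_iff, not_not]
    exact C.exists_sublevel_nonempty_iff.symm
  · simp only [C.subsingleton_piece_zero_iff, not_not]
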